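/- Let $n\ge 0$. A \emph{polyhedron} is a nonempty intersection $\sigma\subseteq\mathbb R^n$ of finitely many closed half-spaces; $N_\sigma$ is the linear span of all $x-y$, $x,y\in\sigma$, and $\dim\sigma=\dim N_\sigma$. A \emph{weight} $\mu$ on $\sigma$ is a generator of $\det N_\sigma$ up to sign. Smooth forms are Lagerberg forms: $A=\bigoplus_{p,q}A^{p,q}$ is the algebra of smooth functions on $\mathbb R^n$ with values in the exterior algebra on $d'x_1,\dots,d'x_n,d''x_1,\dots,d''x_n$, with derivations $d'=\sum_i d'x_i\wedge\partial_i$ and $d''=\sum_i d''x_i\wedge\partial_i$; a smooth form on $\sigma$ is the restriction to $\sigma$ (and to $N_\sigma$ in both types of differentials) of an element of $A$, and $A(\sigma)$, $A^{p,q}(\sigma)$ denote the spaces of these. For $\eta=\varphi\,d'y_1\wedge d''y_1\wedge\dots\wedge d'y_d\wedge d''y_d$ on a $d$-dimensional $\sigma$, where $y_1,\dots,y_d$ are linear coordinates with $y_1\wedge\dots\wedge y_d$ dual to $\mu$, put $\int_{[\sigma,\mu]}\eta=\int_\sigma\varphi\,dy_1\cdots dy_d$. For $\alpha\in A(\sigma)$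 let $\alpha\wedge[\sigma,\mu]$ be the current $\eta\mapsto\int_{[\sigma,\mu]}\alpha\wedge\eta$ on compactly supported smooth forms (only the component of bidegree $(d,d)$ is integrated). For a current $T$ and a homogeneous test form $\eta$ put $(d'T)(\eta)=(-1)^{\deg\eta}T(d'\eta)$ and $(d''T)(\eta)=(-1)^{\deg\eta}T(d''\eta)$. A current is \emph{polyhedral} if it is a locally finite sum of currents $\alpha\wedge[\sigma,\mu]$, and \emph{polyhedral of tridegree $(p,q,r)$} if it is such a sum with all $\alpha\in A^{p,q}(\sigma)$ and all $\sigma$ of codimension $r$. A \emph{$\delta$-form} is a polyhedral current $T$ such that $d'T$ and $d''T$ are both polyhedral. A \emph{polyhedral complex} is a locally finite set $\mathcal T$ of polyhedra that contains all nonempty faces of its members and in which two members with nonempty intersection meet in a common face. If $\tau$ is a facet of $\sigma$ and $\mu_\tau,\mu_\sigma$ are weights, a \emph{normal vector} is any $n_{\sigma,\tau}\in N_\sigma$ with $\mu_\sigma=\pm\mu_\tau\wedge n_{\sigma,\tau}$ whose class in $N_\sigma/N_\tau$ points in the direction of $\sigma$. A datum $(\alpha_\sigma,\sigma,\mu_\sigma)_{\sigma\in\mathcal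 T}$ of smooth forms $\alpha_\sigma\in A(\sigma)$ and weights on a polyhedral complex is \emph{balanced} if for every $\tau\in\mathcal T$ and every affine function $z$ on $\mathbb R^n$ that is constant on $\tau$, $$\sum_{\sigma\in\mathcal T,\ \tau\subset\sigma\text{ a facet}}\frac{\partial z}{\partial n_{\sigma,\tau}}\,\alpha_\sigma|_\tau=0\quad\text{in }A(\tau).$$ A current is \emph{balanced} if it equals $\sum_{\sigma\in\mathcal T}\alpha_\sigma\wedge[\sigma,\mu_\sigma]$ for some balanced datum. \textbf{Theorem.} Let $T$ be a polyhedral current on $\mathbb R^n$. (1) $T$ is a $\delta$-form if and only if $T$ is balanced. Moreover, for every presentation $T=\sum_{\sigma\in\mathcal T}\alpha_\sigma\wedge[\sigma,\mu_\sigma]$ over a polyhedral complex $\mathcal T$, $T$ is a $\delta$-form if and only if the datum $(\alpha_\sigma,\sigma,\mu_\sigma)_{\sigma\in\mathcal T}$ is balanced. (2) $T$ can be written as $T=\sum_{0\le p,q,r\le n}T^{p,q,r}$ with $T^{p,q,r}$ polyhedral of tridegree $(p,q,r)$, and for any such decomposition $T$ is a $\delta$-form if and only if every $T^{p,q,r}$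 is a $\delta$-form. (3) If at least one of $d'T$, $d''T$ is polyhedral, then $T$ is a $\delta$-form. -/

import Mathlib

noncomputable section

namespace DeltaForm

open scoped ContDiff

/-! ## Smooth forms in the sense of Lagerberg -/

/-- The ambient space `ℝⁿ`. -/
abbrev E (n : ℕ) : Type := Fin n → ℝ

/-- The cotangent space `Ω¹ ⊕ Ω¹` at a point: the first summand is spanned by the `d'xᵢ`, the second
one by the `d''xᵢ`. -/
abbrev Cotangent (n : ℕ) : Type := Module.Dual ℝ (E n) × Module.Dual ℝ (E n)

/-- The exterior algebra in which Lagerberg forms on `ℝⁿ` take their values. Its multiplication is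
the wedge product. -/
abbrev FormAlg (n : ℕ) : Type := ExteriorAlgebra ℝ (Cotangent n)

/-- Coordinates on the finite dimensional algebra `FormAlg n`, used only to norm it. -/
def formAlgCoord (n : ℕ) :
    FormAlg n ≃ₗ[ℝ] (Finset (Fin (Module.finrank ℝ (Cotangent n))) → ℝ) :=
  (Module.finBasis ℝ (Cotangent n)).ExteriorAlgebra.equivFun

/-- Since `FormAlg n` is finite dimensional, all norms on it are equivalent; this one serves to speak
about smooth functions with values in `FormAlg n`. -/
instance instNormedAddCommGroupFormAlg (n : ℕ) : NormedAddCommGroup (FormAlg n) :=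
  NormedAddCommGroup.induced (FormAlg n) _ (formAlgCoord n) (formAlgCoord n).injective

instance instNormedSpaceFormAlg (n : ℕ) : NormedSpace ℝ (FormAlg n) :=
  NormedSpace.induced ℝ (FormAlg n) _ (formAlgCoord n)

instance instFiniteDimensionalFormAlg (n : ℕ) : FiniteDimensional ℝ (FormAlg n) :=
  Module.Finite.equiv (formAlgCoord n).symm

/-- The smooth forms `A(ℝⁿ)`. -/
def SmoothForm (n : ℕ) : Submodule ℝ (E n → FormAlg n) where
  carrier := {α | ContDiff ℝ ∞ α}
  add_mem' {a b} (ha : ContDiff ℝ ∞ a) (hb : ContDiff ℝ ∞ b) :=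
    show ContDiff ℝ ∞ (a + b) from ha.add hb
  zero_mem' := show ContDiff ℝ ∞ (fun _ => (0 : FormAlg n)) from contDiff_const
  smul_mem' c a (ha : ContDiff ℝ ∞ a) := show ContDiff ℝ ∞ (c • a) from ha.const_smul c

/-- The smooth forms with compact support `A_c(ℝⁿ)`. -/
def TestForm (n : ℕ) : Submodule ℝ (E n → FormAlg n) where
  carrier := {η | ContDiff ℝ ∞ η ∧ HasCompactSupport η}
  add_mem' ha hb := ⟨ContDiff.add ha.1 hb.1, HasCompactSupport.add ha.2 hb.2⟩
  zero_mem' := ⟨contDiff_const, HasCompactSupport.zero⟩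
  smul_mem' c _ ha := ⟨ContDiff.const_smul c ha.1, HasCompactSupport.smul_left (f := fun _ => c) ha.2⟩

/-- The covector `d'xᵢ`. -/
def dx' {n : ℕ} (i : Fin n) : FormAlg n := ExteriorAlgebra.ι ℝ ((LinearMap.proj i, 0) : Cotangent n)

/-- The covector `d''xᵢ`. -/
def dx'' {n : ℕ} (i : Fin n) : FormAlg n := ExteriorAlgebra.ι ℝ ((0, LinearMap.proj i) : Cotangent n)

/-- The operator `α ↦ ∑ᵢ θᵢ ∧ ∂α/∂xᵢ`, which is `d'` for `θ = d'x` and `d''` for `θ = d''x`. -/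
def diffOp {n : ℕ} (θ : Fin n → FormAlg n) (α : E n → FormAlg n) : E n → FormAlg n :=
  fun x => ∑ i, θ i * fderiv ℝ α x (Pi.single i 1)

theorem diffOp_mem {n : ℕ} (θ : Fin n → FormAlg n) {η : E n → FormAlg n} (h : η ∈ TestForm n) :
    diffOp θ η ∈ TestForm n := by
  obtain ⟨h1, h2⟩ := h
  constructor
  · refine ContDiff.sum fun i _ => ?_
    have h3 : ContDiff ℝ ∞ (fun x => fderiv ℝ η x (Pi.single i 1)) :=
      (h1.fderiv_right (m := ∞) (by simp)).clm_apply contDiff_const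
    exact (LinearMap.toContinuousLinearMap (LinearMap.mulLeft ℝ (θ i))).contDiff.comp h3
  · refine (h2.fderiv (𝕜 := ℝ)).comp_left
      (g := fun L : E n →L[ℝ] FormAlg n => ∑ i, θ i * L (Pi.single i 1)) ?_
    simp

/-- `diffOp` on forms with compact support. -/
def diffOpTest {n : ℕ} (θ : Fin n → FormAlg n) : TestForm n →ₗ[ℝ] TestForm n where
  toFun η := ⟨diffOp θ η, diffOp_mem θ η.2⟩
  map_add' η ξ := by
    ext1
    funext x
    have h1 : DifferentiableAt ℝ (η : E n → FormAlg n) x := (η.2.1.differentiable (by simp)) x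
    have h2 : DifferentiableAt ℝ (ξ : E n → FormAlg n) x := (ξ.2.1.differentiable (by simp)) x
    simp [diffOp, fderiv_add h1 h2, mul_add, Finset.sum_add_distrib]
  map_smul' c η := by
    ext1
    funext x
    have h1 : DifferentiableAt ℝ (η : E n → FormAlg n) x := (η.2.1.differentiable (by simp)) x
    simp [diffOp, fderiv_const_smul h1, Finset.smul_sum]

/-- The map on forms with compact support that multiplies a form of degree `k` by `(-1)^k`. -/
def signTest (n : ℕ) : TestForm n →ₗ[ℝ] TestForm n where
  toFun η := ⟨fun x => CliffordAlgebra.involute ((η : E n → FormAlg n) x), by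
    constructor
    · exact (LinearMap.toContinuousLinearMap
        (CliffordAlgebra.involute : FormAlg n →ₐ[ℝ] FormAlg n).toLinearMap).contDiff.comp η.2.1
    · exact η.2.2.comp_left (g := fun w : FormAlg n => CliffordAlgebra.involute w) (map_zero _)⟩
  map_add' η ξ := by
    ext1
    funext x
    simp
  map_smul' c η := by
    ext1
    funext x
    simp

/-- The value space `Λᵖ ⊗ Λ^q` of the forms of bidegree `(p, q)`. -/
def bidegree (n p q : ℕ) : Submodule ℝ (FormAlg n) :=
  Submodule.span ℝ {w | ∃ (f : Fin p → Module.Dual ℝ (E n)) (g : Fin q → Module.Dual ℝ (E n)),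
    w = ExteriorAlgebra.ιMulti ℝ p (fun i => ((f i, 0) : Cotangent n)) *
      ExteriorAlgebra.ιMulti ℝ q (fun j => ((0, g j) : Cotangent n))}

/-- Contraction with the vector `w = (w₁, w₂)` of `ℝⁿ × ℝⁿ`: insertion of `w` as first entry of an
alternating form. -/
def contract {n : ℕ} (w : E n × E n) : FormAlg n →ₗ[ℝ] FormAlg n :=
  CliffordAlgebra.contractLeft
    ((Module.Dual.eval ℝ (E n) w.1).coprod (Module.Dual.eval ℝ (E n) w.2) :
      Module.Dual ℝ (Cotangent n))

/-- For `b = (b₁, …, b_d)` and a form `ω`, the value `ω(b₁', b₁'', …, b_d', b_d'')` where `v' = (v, 0)`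
and `v'' = (0, v)`. If the `bᵢ` are a basis of a subspace `N` with dual coordinates `xᵢ`, this is the
coefficient of `d'x₁ ∧ d''x₁ ∧ … ∧ d'x_d ∧ d''x_d` in the restriction of `ω` to `N`. -/
def topValue {n d : ℕ} (b : Fin d → E n) : FormAlg n →ₗ[ℝ] ℝ :=
  (ExteriorAlgebra.algebraMapInv : FormAlg n →ₐ[ℝ] ℝ).toLinearMap ∘ₗ
    ((List.finRange d).map fun i =>
      (contract ((0 : E n), b i) ∘ₗ contract (b i, (0 : E n)) : Module.End ℝ (FormAlg n))).prod

/-- Restriction of forms (at a point) to a linear subspace `N`. -/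
def restrict {n : ℕ} (N : Submodule ℝ (E n)) :
    FormAlg n →ₐ[ℝ] ExteriorAlgebra ℝ (Module.Dual ℝ N × Module.Dual ℝ N) :=
  ExteriorAlgebra.map (N.subtype.dualMap.prodMap N.subtype.dualMap)

/-! ## Currents -/

/-- Linear forms on `A_c(ℝⁿ)`. Continuity is not recorded: it is automatic for polyhedral currents,
which are the only ones considered. -/
abbrev Current (n : ℕ) : Type := TestForm n →ₗ[ℝ] ℝ

/-- `d'T`. For `T` of degree `m`, the current `d'T` pairs with forms `η` of degree `2n - m - 1`, so the
sign `(-1)^(m+1)` in `(d'T)(η) = (-1)^(m+1) T(d'η)` is `(-1)^(deg η)`. -/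
def Current.d' {n : ℕ} (T : Current n) : Current n := T ∘ₗ diffOpTest dx' ∘ₗ signTest n

/-- `d''T`, with the same sign convention. -/
def Current.d'' {n : ℕ} (T : Current n) : Current n := T ∘ₗ diffOpTest dx'' ∘ₗ signTest n

/-! ## Polyhedra and weights -/

/-- A nonempty intersection of finitely many closed half-spaces. -/
def IsPolyhedron {n : ℕ} (σ : Set (E n)) : Prop :=
  σ.Nonempty ∧ ∃ H : Finset (Module.Dual ℝ (E n) × ℝ), σ = {x | ∀ h ∈ H, h.1 x ≤ h.2}

/-- The dimension of `N_σ = vectorSpan ℝ σ`. -/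
def dim {n : ℕ} (σ : Set (E n)) : ℕ := Module.finrank ℝ (vectorSpan ℝ σ)

/-- `τ` is a (nonempty) face of `σ`; `σ` is a face of itself. -/
def IsFace {n : ℕ} (τ σ : Set (E n)) : Prop := τ.Nonempty ∧ IsExposed ℝ σ τ

/-- A facet is a face of codimension one. -/
def IsFacet {n : ℕ} (τ σ : Set (E n)) : Prop := IsFace τ σ ∧ dim τ + 1 = dim σ

/-- A weight on `N`, that is a generator of `det N` up to sign, given as `c · b₁ ∧ … ∧ b_d` with a basis
`b` of `N` and a scalar `c > 0`. -/
structure Weight {n : ℕ} (N : Submodule ℝ (E n)) where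
  scale : ℝ
  scale_pos : 0 < scale
  frame : Module.Basis (Fin (Module.finrank ℝ N)) ℝ N

/-- The element `c · b₁ ∧ … ∧ b_d`, in the exterior algebra of the ambient space. -/
def Weight.toExt {n : ℕ} {N : Submodule ℝ (E n)} (μ : Weight N) : ExteriorAlgebra ℝ (E n) :=
  μ.scale • ExteriorAlgebra.ιMulti ℝ _ (fun i => (μ.frame i : E n))

/-- `v` is a normal vector for the facet `τ` of `σ`: `μ = ν ∧ v` up to sign, and the class of `v` in
`N_σ / N_τ` points in the direction of `σ`. -/
def IsNormalVector {n : ℕ} {σ τ : Set (E n)} (μ : Weight (vectorSpan ℝ σ))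
    (ν : Weight (vectorSpan ℝ τ)) (v : E n) : Prop :=
  (μ.toExt = ν.toExt * ExteriorAlgebra.ι ℝ v ∨ μ.toExt = -(ν.toExt * ExteriorAlgebra.ι ℝ v)) ∧
    ∃ c : ℝ, 0 < c ∧ ∃ x ∈ σ, ∃ y ∈ τ, v - c • (x - y) ∈ vectorSpan ℝ τ

open Classical in
/-- Some point of `σ`. -/
def basePoint {n : ℕ} (σ : Set (E n)) : E n := if h : σ.Nonempty then h.some else 0

/-- The affine parametrization `t ↦ x₀ + ∑ tᵢ bᵢ` of the affine span of `σ`. -/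
def param {n : ℕ} {σ : Set (E n)} (μ : Weight (vectorSpan ℝ σ))
    (t : Fin (Module.finrank ℝ (vectorSpan ℝ σ)) → ℝ) : E n :=
  basePoint σ + ∑ i, t i • (μ.frame i : E n)

/-- The integral of a form over the weighted polyhedron `[σ, μ]`; it sees only the component of
bidegree `(dim σ, dim σ)` of the restriction of the form to `σ`. -/
def integral {n : ℕ} (σ : Set (E n)) (μ : Weight (vectorSpan ℝ σ)) (η : E n → FormAlg n) : ℝ :=
  μ.scale * ∫ t in {t | param μ t ∈ σ}, topValue (fun i => (μ.frame i : E n)) (η (param μ t))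

/-! ## Polyhedral currents -/

/-- The datum of a current `α ∧ [σ, μ]`. The form on `σ` is given by a smooth form on `ℝⁿ` which
restricts to it. -/
structure Piece (n : ℕ) where
  carrier : Set (E n)
  isPolyhedron : IsPolyhedron carrier
  weight : Weight (vectorSpan ℝ carrier)
  form : SmoothForm n

/-- `(α ∧ [σ, μ])(η) = ∫_{[σ, μ]} α ∧ η`. -/
def Piece.eval {n : ℕ} (P : Piece n) (η : TestForm n) : ℝ :=
  integral P.carrier P.weight
    (fun x => (P.form : E n → FormAlg n) x * (η : E n → FormAlg n) x)

/-- `T` is the sum of the locally finite family `P`. -/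
def IsLocallyFiniteSum {n : ℕ} {ι : Type} (P : ι → Piece n) (T : Current n) : Prop :=
  LocallyFinite (fun i => (P i).carrier) ∧ ∀ η, T η = ∑ᶠ i, (P i).eval η

/-- Polyhedral currents. -/
def IsPolyhedral {n : ℕ} (T : Current n) : Prop :=
  ∃ (ι : Type) (P : ι → Piece n), IsLocallyFiniteSum P T

/-- Polyhedral currents of tridegree `(p, q, r)`. -/
def IsTrihomogeneous {n : ℕ} (p q r : ℕ) (T : Current n) : Prop :=
  ∃ (ι : Type) (P : ι → Piece n), IsLocallyFiniteSum P T ∧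
    ∀ i, dim (P i).carrier + r = n ∧ ∀ x, ((P i).form : E n → FormAlg n) x ∈ bidegree n p q

/-- `S p q r` are the trihomogeneous components of `T`. Those with `p`, `q` or `r` greater than `n`
vanish automatically. -/
def IsTriDecomposition {n : ℕ} (T : Current n) (S : ℕ → ℕ → ℕ → Current n) : Prop :=
  (∀ p q r, IsTrihomogeneous p q r (S p q r)) ∧
    T = ∑ p ∈ Finset.range (n + 1), ∑ q ∈ Finset.range (n + 1), ∑ r ∈ Finset.range (n + 1), S p q r

/-- A δ-form: a polyhedral current with polyhedral derivatives. -/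
def IsDeltaForm {n : ℕ} (T : Current n) : Prop :=
  IsPolyhedral T ∧ IsPolyhedral T.d' ∧ IsPolyhedral T.d''

/-! ## Polyhedral complexes and balancing -/

/-- Polyhedral complexes in `ℝⁿ`. -/
structure PolyhedralComplex (n : ℕ) where
  cells : Set (Set (E n))
  isPolyhedron : ∀ σ ∈ cells, IsPolyhedron σ
  face_mem : ∀ σ ∈ cells, ∀ τ, IsFace τ σ → τ ∈ cells
  inter_face : ∀ σ₁ ∈ cells, ∀ σ₂ ∈ cells, (σ₁ ∩ σ₂).Nonempty →
    IsFace (σ₁ ∩ σ₂) σ₁ ∧ IsFace (σ₁ ∩ σ₂) σ₂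
  locallyFinite : LocallyFinite (fun σ : cells => (σ : Set (E n)))

/-- A polyhedral complex with weights `μ_σ` and smooth forms `α_σ` on all its polyhedra. -/
structure PolyhedralDatum (n : ℕ) extends PolyhedralComplex n where
  weight : ∀ σ : cells, Weight (vectorSpan ℝ (σ : Set (E n)))
  form : cells → SmoothForm n

/-- The term `α_σ ∧ [σ, μ_σ]`. -/
def PolyhedralDatum.piece {n : ℕ} (D : PolyhedralDatum n) (σ : D.cells) : Piece n where
  carrier := σ
  isPolyhedron := D.isPolyhedron σ σ.2
  weight := D.weight σ
  form := D.form σ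

/-- `T = ∑_σ α_σ ∧ [σ, μ_σ]`. -/
def PolyhedralDatum.Presents {n : ℕ} (D : PolyhedralDatum n) (T : Current n) : Prop :=
  IsLocallyFiniteSum D.piece T

/-- The balancing condition: for every polyhedron `τ`, all choices of normal vectors `v_σ` and every
affine function `z` which is constant on `τ`, the form `∑_σ (∂z/∂v_σ) α_σ|_τ` on `τ` vanishes, the sum
being over the (finitely many) `σ` of which `τ` is a facet. -/
def PolyhedralDatum.Balanced {n : ℕ} (D : PolyhedralDatum n) : Prop :=
  ∀ (τ : D.cells) (v : D.cells → E n),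
    (∀ σ : D.cells, IsFacet (τ : Set (E n)) σ →
      IsNormalVector (D.weight σ) (D.weight τ) (v σ)) →
    ∀ z : E n →ᵃ[ℝ] ℝ, (∀ x ∈ (τ : Set (E n)), ∀ y ∈ (τ : Set (E n)), z x = z y) →
      ∀ x ∈ (τ : Set (E n)),
        ∑ᶠ (σ : D.cells) (_ : IsFacet (τ : Set (E n)) σ),
          z.linear (v σ) • restrict (vectorSpan ℝ (τ : Set (E n)))
            ((D.form σ : E n → FormAlg n) x) = 0

/-- A current is balanced if it is presented by a balanced datum. -/
def IsBalanced {n : ℕ} (T : Current n) : Prop :=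
  ∃ D : PolyhedralDatum n, D.Presents T ∧ D.Balanced

end DeltaForm

end

/-! The whole theorem rests on one boundary term. Stokes' formula (`stokes`) together with the
Leibniz rule (`Piece.eval_ds`) shows that `d'(α ∧ [σ, μ])` is `d'α ∧ [σ, μ]` plus, for every facet
`τ` with normal vector `v`, the functional `η ↦ ∫_τ κ(v)(α ∧ η)`, where `κ(v)` is contraction with
`v''` for `d'` and minus contraction with `v'` for `d''` (`kap`). Summed over a complex
(`PolyhedralDatum.Presents.ds_eq`), the obstruction at `τ` is `∫_τ ∑_σ κ(v_σ)(α_σ ∧ η)`. It need not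
be polyhedral, because contracting `η` with a vector transverse to `τ` detects more than the
restriction of `η` to `τ`.

If the datum is balanced, the tangential part of `v_σ` contributes nothing, since the top
coefficient kills contractions with tangent vectors. By the antiderivation rule the transverse
contractions of `η` are multiplied by the forms `∑_σ (∂z/∂v_σ) α_σ|_τ`, which are zero. What remains
is `(∑_σ κ(v_σ^⊥) α_σ) ∧ η`, a polyhedral current (`PolyhedralDatum.Presents.isPolyhedral_ds`).

Conversely, let `d'T` be polyhedral and let `l` be a linear form vanishing on `N_τ`. Test with `η_k
= exp(-k q) χ d''l ∧ ξ`, where `q ≥ 0` vanishes exactly on the affine span of `τ` and `χ` is a bump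
function. A polyhedron inside this affine span does not see `η_k`, because `d''l` restricts to zero;
on any other polyhedron the integrals tend to zero by dominated convergence. Only the boundary term
at `τ` is independent of `k`, and it is the integral over `τ` of `χ ∑_σ l(v_σ) α_σ ∧ ξ` up to signs.
It therefore vanishes, and nondegeneracy of the wedge pairing gives balancing
(`PolyhedralDatum.Presents.balanced`). For `d''` the roles of the two kinds of covectors are
exchanged. Since one derivative suffices, (3) follows, and so does the statement of (1) about
arbitrary presentations.

It remains to present every polyhedral current over a complex (`exists_adapted_complex`,
`IsLocallyFiniteSum.exists_presentation`). For (2), all components are presented over one common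
complex. Balancing at `τ` involves only cells of dimension `dim τ + 1`, which separates the
codimensions, and restriction to `τ` respects bidegrees, which separates `p` and `q`
(`balanced_of_balanced_sum`). -/

noncomputable section

namespace DeltaForm

open scoped ContDiff

/-! ## Contractions on exterior algebras -/

section Contraction

variable {M M' : Type*} [AddCommGroup M] [Module ℝ M] [AddCommGroup M'] [Module ℝ M']

local notation "Λ" => ExteriorAlgebra ℝ

/-- Contraction of elements of the exterior algebra by a linear form. -/
abbrev ctr (d : Module.Dual ℝ M) : Λ M →ₗ[ℝ] Λ M :=
  CliffordAlgebra.contractLeft (Q := (0 : QuadraticForm ℝ M)) d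

theorem ctr_ι_mul (d : Module.Dual ℝ M) (m : M) (x : Λ M) :
    ctr d (ExteriorAlgebra.ι ℝ m * x) = d m • x - ExteriorAlgebra.ι ℝ m * ctr d x :=
  CliffordAlgebra.contractLeft_ι_mul d m x

theorem involute_ι (m : M) :
    CliffordAlgebra.involute (ExteriorAlgebra.ι ℝ m) = -ExteriorAlgebra.ι ℝ m :=
  CliffordAlgebra.involute_ι m

theorem exterior_left_induction {P : Λ M → Prop} (alg : ∀ r, P (algebraMap ℝ _ r))
    (add : ∀ x y, P x → P y → P (x + y)) (mul : ∀ x m, P x → P (ExteriorAlgebra.ι ℝ m * x))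
    (x : Λ M) : P x :=
  CliffordAlgebra.left_induction (0 : QuadraticForm ℝ M) (P := P) alg add (fun x m h => mul x m h) x

theorem ctr_mul (d : Module.Dual ℝ M) (x y : Λ M) :
    ctr d (x * y) = ctr d x * y + CliffordAlgebra.involute x * ctr d y := by
  induction x using exterior_left_induction with
  | alg r => rw [Algebra.algebraMap_eq_smul_one]; simp
  | add x x' hx hx' => simp only [add_mul, map_add, hx, hx']; abel
  | mul x m hx =>
    rw [mul_assoc, ctr_ι_mul, hx, ctr_ι_mul, map_mul, involute_ι]
    simp only [mul_add, sub_mul, smul_mul_assoc, mul_assoc, neg_mul]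
    abel

theorem ctr_involute (d : Module.Dual ℝ M) (x : Λ M) :
    ctr d (CliffordAlgebra.involute x) = -CliffordAlgebra.involute (ctr d x) := by
  induction x using exterior_left_induction with
  | alg r => rw [Algebra.algebraMap_eq_smul_one]; simp
  | add x x' hx hx' => simp only [map_add, hx, hx', neg_add]
  | mul x m hx =>
    rw [map_mul, involute_ι, neg_mul, map_neg, ctr_ι_mul, ctr_ι_mul, hx, map_sub, map_smul, map_mul,
      involute_ι]
    simp

theorem mul_ι_eq (x : Λ M) (m : M) :
    x * ExteriorAlgebra.ι ℝ m = ExteriorAlgebra.ι ℝ m * CliffordAlgebra.involute x := by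
  induction x using exterior_left_induction with
  | alg r => rw [Algebra.algebraMap_eq_smul_one]; simp
  | add x x' hx hx' => simp only [map_add, add_mul, mul_add, hx, hx']
  | mul x m' hx =>
    rw [mul_assoc, hx, map_mul, involute_ι, ← mul_assoc, neg_mul, mul_neg, ← mul_assoc, ← neg_mul]
    congr 1
    exact eq_neg_of_add_eq_zero_left (ExteriorAlgebra.ι_add_mul_swap m' m)

theorem ctr_map (f : M →ₗ[ℝ] M') (d : Module.Dual ℝ M') (x : Λ M) :
    ctr d (ExteriorAlgebra.map f x) = ExteriorAlgebra.map f (ctr (d ∘ₗ f) x) := by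
  induction x using exterior_left_induction with
  | alg r => rw [Algebra.algebraMap_eq_smul_one]; simp
  | add x x' hx hx' => simp only [map_add, hx, hx']
  | mul x m hx =>
    rw [map_mul, ExteriorAlgebra.map_apply_ι, ctr_ι_mul, ctr_ι_mul, hx]
    simp

theorem algebraMapInv_ι_mul (m : M) (x : Λ M) :
    ExteriorAlgebra.algebraMapInv (ExteriorAlgebra.ι ℝ m * x) = 0 := by
  rw [map_mul]
  simp [ExteriorAlgebra.algebraMapInv]

theorem algebraMapInv_map (f : M →ₗ[ℝ] M') (x : Λ M) :
    ExteriorAlgebra.algebraMapInv (ExteriorAlgebra.map f x) = ExteriorAlgebra.algebraMapInv x := by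
  induction x using exterior_left_induction with
  | alg r => rw [Algebra.algebraMap_eq_smul_one]; simp
  | add x x' hx hx' => simp only [map_add, hx, hx']
  | mul x m hx =>
    rw [map_mul, ExteriorAlgebra.map_apply_ι, algebraMapInv_ι_mul, algebraMapInv_ι_mul]

theorem algebraMapInv_involute (x : Λ M) :
    ExteriorAlgebra.algebraMapInv (CliffordAlgebra.involute x) =
      ExteriorAlgebra.algebraMapInv x := by
  induction x using exterior_left_induction with
  | alg r => rw [Algebra.algebraMap_eq_smul_one]; simp
  | add x x' hx hx' => simp only [map_add, hx, hx']
  | mul x m hx =>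
    rw [map_mul, involute_ι, neg_mul, map_neg, algebraMapInv_ι_mul, algebraMapInv_ι_mul, neg_zero]

/-- There are only terms of order zero and one in `e`, because `e ∧ e = 0`. The formula shows that
an element killed by all contractions is fixed by these maps. -/
theorem map_id_sub_smulRight (f : Module.Dual ℝ M) (e : M) (x : Λ M) :
    ExteriorAlgebra.map (LinearMap.id - f.smulRight e) x = x - ExteriorAlgebra.ι ℝ e * ctr f x := by
  induction x using exterior_left_induction with
  | alg r => rw [Algebra.algebraMap_eq_smul_one]; simp
  | add x x' hx hx' => simp only [map_add, hx, hx', mul_add]; abel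
  | mul x m hx =>
    rw [map_mul, hx, ExteriorAlgebra.map_apply_ι, ctr_ι_mul]
    have h1 : ExteriorAlgebra.ι ℝ e * ExteriorAlgebra.ι ℝ m =
        -(ExteriorAlgebra.ι ℝ m * ExteriorAlgebra.ι ℝ e) :=
      eq_neg_of_add_eq_zero_left (ExteriorAlgebra.ι_add_mul_swap e m)
    have h2 : ExteriorAlgebra.ι ℝ e * (ExteriorAlgebra.ι ℝ e * ctr f x) = 0 := by
      rw [← mul_assoc, ExteriorAlgebra.ι_sq_zero, zero_mul]
    simp only [LinearMap.sub_apply, LinearMap.id_apply, LinearMap.smulRight_apply, map_sub,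
      map_smul, sub_mul, mul_sub, smul_mul_assoc, ← mul_assoc, h1]
    simp only [neg_mul, mul_smul_comm, mul_assoc, h2, smul_zero]
    abel

/-- The endomorphisms `id - e_i* ⊗ e_i` delete one coordinate each, and the maps they induce fix
`x`. Their composite over a basis is induced by the zero map, which retains only the scalar part. -/
theorem eq_algebraMap_of_forall_ctr_eq_zero [FiniteDimensional ℝ M] {x : Λ M}
    (hx : ∀ d, ctr d x = 0) : x = algebraMap ℝ _ (ExteriorAlgebra.algebraMapInv x) := by
  classical
  let e := Module.finBasis ℝ M
  have key : ∀ s : Finset (Fin (Module.finrank ℝ M)),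
      ExteriorAlgebra.map (LinearMap.id - ∑ i ∈ s, (e.coord i).smulRight (e i)) x = x := by
    intro s
    induction s using Finset.induction_on with
    | empty => simp
    | insert a s ha ih =>
      have h1 : (LinearMap.id - ∑ i ∈ insert a s, (e.coord i).smulRight (e i)) =
          (LinearMap.id - (e.coord a).smulRight (e a)) ∘ₗ
            (LinearMap.id - ∑ i ∈ s, (e.coord i).smulRight (e i)) := by
        ext m
        have h2 : e.coord a (∑ i ∈ s, e.coord i m • e i) = 0 := by
          rw [map_sum]
          refine Finset.sum_eq_zero fun i hi => ?_
          have : i ≠ a := fun h => ha (h ▸ hi)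
          simp [this]
        rw [Finset.sum_insert ha]
        simp only [LinearMap.sub_apply, LinearMap.id_apply, LinearMap.sum_apply,
          LinearMap.add_apply, LinearMap.smulRight_apply, LinearMap.comp_apply, map_sub, h2]
        simp only [zero_smul, sub_zero]
        abel
      rw [h1, ← ExteriorAlgebra.map_comp_map, AlgHom.comp_apply, ih, map_id_sub_smulRight, hx]
      simp
  have h0 : (LinearMap.id - ∑ i, (e.coord i).smulRight (e i)) = (0 : M →ₗ[ℝ] M) := by
    ext m
    simp [e.sum_repr]
  have h1 := key Finset.univ
  rw [h0] at h1
  have h2 : ∀ y : Λ M, ExteriorAlgebra.map (0 : M →ₗ[ℝ] M) y =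
      algebraMap ℝ _ (ExteriorAlgebra.algebraMapInv y) := by
    intro y
    induction y using exterior_left_induction with
    | alg r => simp [ExteriorAlgebra.algebraMap_leftInverse M r]
    | add x x' hx hx' => simp only [map_add, hx, hx']
    | mul x m hx => rw [map_mul, ExteriorAlgebra.map_apply_ι, algebraMapInv_ι_mul]; simp
  rw [← h2, h1]

/-- All `k`-fold contractions of `x` vanish. -/
def ContractionsVanish : ℕ → Λ M → Prop
  | 0, x => x = 0
  | k + 1, x => ∀ d, ContractionsVanish k (ctr d x)

theorem ContractionsVanish.zero (k : ℕ) : ContractionsVanish k (0 : Λ M) := by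
  induction k with
  | zero => rfl
  | succ k ih => intro d; simpa using ih

theorem ContractionsVanish.add {k : ℕ} {x y : Λ M} (hx : ContractionsVanish k x)
    (hy : ContractionsVanish k y) : ContractionsVanish k (x + y) := by
  induction k generalizing x y with
  | zero => simp only [ContractionsVanish] at *; simp [hx, hy]
  | succ k ih => intro d; rw [map_add]; exact ih (hx d) (hy d)

theorem ContractionsVanish.smul {k : ℕ} (c : ℝ) {x : Λ M} (hx : ContractionsVanish k x) :
    ContractionsVanish k (c • x) := by
  induction k generalizing x with
  | zero => simp only [ContractionsVanish] at *; simp [hx]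
  | succ k ih => intro d; rw [map_smul]; exact ih (hx d)

theorem ContractionsVanish.succ {k : ℕ} {x : Λ M} (hx : ContractionsVanish k x) :
    ContractionsVanish (k + 1) x := by
  induction k generalizing x with
  | zero => intro d; simp only [ContractionsVanish] at *; simp [hx]
  | succ k ih => intro d; exact ih (hx d)

theorem ContractionsVanish.ι_mul {k : ℕ} (m : M) {x : Λ M} (hx : ContractionsVanish k x) :
    ContractionsVanish (k + 1) (ExteriorAlgebra.ι ℝ m * x) := by
  induction k generalizing x with
  | zero =>
    simp only [ContractionsVanish] at hx
    rw [hx, mul_zero]; exact ContractionsVanish.zero _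
  | succ k ih =>
    intro d
    rw [ctr_ι_mul, sub_eq_add_neg, ← neg_one_smul ℝ (_ * _)]
    exact (hx.smul _).add ((ih (hx d)).smul _)

/-- The bound grows by one with each factor of a product of vectors. It plays the role of the degree
in the induction that proves nondegeneracy, so no grading is needed. -/
theorem exists_contractionsVanish (x : Λ M) : ∃ k, ContractionsVanish k x := by
  induction x using exterior_left_induction with
  | alg r => exact ⟨1, fun d => by simp [ContractionsVanish]⟩
  | add x y hx hy =>
    obtain ⟨k, hk⟩ := hx
    obtain ⟨l, hl⟩ := hy
    have h : ∀ (i j : ℕ) (z : Λ M), ContractionsVanish i z → ContractionsVanish (i + j) z := by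
      intro i j z hz
      induction j with
      | zero => exact hz
      | succ j ih => exact ih.succ
    exact ⟨k + l, (h k l x hk).add (add_comm l k ▸ h l k y hl)⟩
  | mul x m hx => obtain ⟨k, hk⟩ := hx; exact ⟨k + 1, hk.ι_mul m⟩

/-- The wedge product followed by a functional which is invariant under the sign involution and which
vanishes on contractions is a nondegenerate pairing. -/
theorem eq_zero_of_forall_mul_eq_zero [FiniteDimensional ℝ M] (φ : Λ M →ₗ[ℝ] ℝ) (hφ : φ ≠ 0)
    (hinv : ∀ x, φ (CliffordAlgebra.involute x) = φ x) (hctr : ∀ d x, φ (ctr d x) = 0)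
    {x : Λ M} (hx : ∀ y, φ (x * y) = 0) : x = 0 := by
  obtain ⟨k, hk⟩ := exists_contractionsVanish x
  induction k generalizing x with
  | zero => exact hk
  | succ k ih =>
    -- `φ` kills the contraction of `x ∧ y`, and in the antiderivation rule the term that contracts
    -- `y` is, up to the involution, again a value `φ (x ∧ y')`. Hence the contraction of `x` is
    -- also orthogonal to everything, and the induction hypothesis applies to it.
    have h1 : ∀ d, ctr d x = 0 := by
      intro d
      refine ih (fun y => ?_) (hk d)
      have h2 := hctr d (x * y)
      rw [ctr_mul, map_add] at h2
      have h3 : φ (CliffordAlgebra.involute x * ctr d y) = 0 := by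
        rw [← hinv, map_mul, CliffordAlgebra.involute_involute, hx]
      rwa [h3, add_zero] at h2
    have h2 := eq_algebraMap_of_forall_ctr_eq_zero h1
    set c := ExteriorAlgebra.algebraMapInv x
    by_contra hne
    have hc : c ≠ 0 := by rintro hc; rw [hc, map_zero] at h2; exact hne h2
    refine hφ (LinearMap.ext fun y => ?_)
    have h3 := hx y
    rw [h2, ← Algebra.smul_def, map_smul, smul_eq_mul] at h3
    simpa [hc] using h3

end Contraction

/-! ## The two kinds of covectors and contractions -/

section Sides

variable {n : ℕ}

/-- `cov false l = d'l` and `cov true l = d''l` for a linear form `l`. -/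
def cov (s : Bool) : Module.Dual ℝ (E n) →ₗ[ℝ] FormAlg n :=
  ExteriorAlgebra.ι ℝ ∘ₗ (bif s then LinearMap.inr ℝ _ _ else LinearMap.inl ℝ _ _)

/-- The vector `v' = (v, 0)` or `v'' = (0, v)`. -/
def vec (s : Bool) : E n →ₗ[ℝ] E n × E n :=
  bif s then LinearMap.inr ℝ _ _ else LinearMap.inl ℝ _ _

/-- The functional on the cotangent space given by `w`. -/
def evalAt : E n × E n →ₗ[ℝ] Module.Dual ℝ (Cotangent n) :=
  (LinearMap.coprodEquiv ℝ (R := ℝ) (M := Module.Dual ℝ (E n)) (M₂ := Module.Dual ℝ (E n))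
    (M₃ := ℝ)).toLinearMap ∘ₗ ((Module.Dual.eval ℝ (E n)).prodMap (Module.Dual.eval ℝ (E n)))

/-- Contraction with `v'` or `v''`, linear in `v`. -/
def con (s : Bool) : E n →ₗ[ℝ] FormAlg n →ₗ[ℝ] FormAlg n :=
  CliffordAlgebra.contractLeft (Q := (0 : QuadraticForm ℝ (Cotangent n))) ∘ₗ evalAt ∘ₗ vec s

theorem con_eq (s : Bool) (v : E n) : con s v = ctr (evalAt (vec s v)) := rfl

theorem con_cov_mul (s : Bool) (v : E n) (l : Module.Dual ℝ (E n)) (x : FormAlg n) :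
    con s v (cov s l * x) = l v • x - cov s l * con s v x := by
  cases s <;> · rw [con_eq, cov, LinearMap.comp_apply, ctr_ι_mul]; simp [evalAt, vec]

theorem con_cov_not_mul (s : Bool) (v : E n) (l : Module.Dual ℝ (E n)) (x : FormAlg n) :
    con s v (cov (!s) l * x) = -(cov (!s) l * con s v x) := by
  cases s <;> · rw [con_eq, cov, LinearMap.comp_apply, ctr_ι_mul]; simp [evalAt, vec]

theorem con_cov_mul' (s t : Bool) (v : E n) (l : Module.Dual ℝ (E n)) (x : FormAlg n)
    (h : l v = 0) : con s v (cov t l * x) = -(cov t l * con s v x) := by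
  by_cases hst : t = s
  · subst hst; rw [con_cov_mul, h]; simp
  · have : t = !s := by cases s <;> cases t <;> simp_all
    subst this; exact con_cov_not_mul s v l x

theorem con_comm (s t : Bool) (v w : E n) (x : FormAlg n) :
    con s v (con t w x) = -con t w (con s v x) :=
  CliffordAlgebra.contractLeft_comm _ _ _

theorem con_con (s : Bool) (v : E n) (x : FormAlg n) : con s v (con s v x) = 0 :=
  CliffordAlgebra.contractLeft_contractLeft _ _

theorem con_mul (s : Bool) (v : E n) (x y : FormAlg n) :
    con s v (x * y) = con s v x * y + CliffordAlgebra.involute x * con s v y :=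
  ctr_mul _ x y

theorem con_involute (s : Bool) (v : E n) (x : FormAlg n) :
    con s v (CliffordAlgebra.involute x) = -CliffordAlgebra.involute (con s v x) :=
  ctr_involute _ x

theorem mul_cov (s : Bool) (l : Module.Dual ℝ (E n)) (x : FormAlg n) :
    x * cov s l = cov s l * CliffordAlgebra.involute x := mul_ι_eq x _

theorem involute_cov (s : Bool) (l : Module.Dual ℝ (E n)) :
    CliffordAlgebra.involute (cov s l) = -cov s l := involute_ι _

theorem algebraMapInv_cov_mul (s : Bool) (l : Module.Dual ℝ (E n)) (x : FormAlg n) :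
    ExteriorAlgebra.algebraMapInv (cov s l * x) = 0 := algebraMapInv_ι_mul _ x

/-! ## The top coefficient -/

theorem topValue_zero (b : Fin 0 → E n) (x : FormAlg n) :
    topValue b x = ExteriorAlgebra.algebraMapInv x := by
  simp [topValue]

theorem topValue_succ {d : ℕ} (b : Fin (d + 1) → E n) (x : FormAlg n) :
    topValue b x = topValue (fun i : Fin d => b i.castSucc)
      (con true (b (Fin.last d)) (con false (b (Fin.last d)) x)) := by
  simp only [topValue, List.finRange_succ_last, List.map_append, List.map_map, List.prod_append,
    LinearMap.comp_apply, Module.End.mul_apply]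
  simp only [List.map_cons, List.map_nil, List.prod_cons, List.prod_nil, mul_one]
  rfl

/-- Such a covector anticommutes with every contraction in `topValue`, so it stays in front and is
killed by the final projection to scalars. -/
theorem topValue_cov_mul {d : ℕ} (b : Fin d → E n) (s : Bool) (l : Module.Dual ℝ (E n))
    (hl : ∀ i, l (b i) = 0) (x : FormAlg n) : topValue b (cov s l * x) = 0 := by
  induction d generalizing x with
  | zero => rw [topValue_zero, algebraMapInv_cov_mul]
  | succ d ih =>
    rw [topValue_succ, con_cov_mul' _ _ _ _ _ (hl _), map_neg, con_cov_mul' _ _ _ _ _ (hl _),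
      neg_neg]
    exact ih _ (fun i => hl _) _

/-- Contractions anticommute and have square zero, so the additional one can be moved until it meets
its twin in `topValue`. -/
theorem topValue_con_apply {d : ℕ} (b : Fin d → E n) (s : Bool) (i : Fin d) (x : FormAlg n) :
    topValue b (con s (b i) x) = 0 := by
  induction d generalizing x with
  | zero => exact i.elim0
  | succ d ih =>
    rw [topValue_succ]
    induction i using Fin.lastCases with
    | last =>
      cases s
      · rw [con_con]; simp
      · rw [con_comm false true, map_neg, con_con]; simp
    | cast i =>
      rw [con_comm false s, map_neg, con_comm true s, neg_neg]
      exact ih (fun i => b i.castSucc) i _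

theorem topValue_con {d : ℕ} (b : Fin d → E n) (s : Bool) {v : E n}
    (hv : v ∈ Submodule.span ℝ (Set.range b)) (x : FormAlg n) :
    topValue b (con s v x) = 0 := by
  induction hv using Submodule.span_induction with
  | mem v h => obtain ⟨i, rfl⟩ := h; exact topValue_con_apply b s i x
  | zero => simp
  | add v w _ _ hv hw => simp [hv, hw]
  | smul c v _ hv => simp [hv]

/-- The number of contractions is even, so the signs cancel. -/
theorem topValue_involute {d : ℕ} (b : Fin d → E n) (x : FormAlg n) :
    topValue b (CliffordAlgebra.involute x) = topValue b x := by
  induction d generalizing x with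
  | zero => rw [topValue_zero, topValue_zero, algebraMapInv_involute]
  | succ d ih =>
    rw [topValue_succ, topValue_succ, con_involute, map_neg, con_involute, neg_neg, ih]

/-- The contraction of the other kind, with the sign that occurs in the formula of Stokes. -/
def kap (s : Bool) : E n →ₗ[ℝ] FormAlg n →ₗ[ℝ] FormAlg n :=
  bif s then -con false else con true

theorem kap_eq (s : Bool) (v : E n) (x : FormAlg n) :
    kap s v x = (bif s then (-1 : ℝ) else 1) • con (!s) v x := by
  cases s <;> simp [kap]

theorem topValue_kap {d : ℕ} (b : Fin d → E n) (s : Bool) {v : E n}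
    (hv : v ∈ Submodule.span ℝ (Set.range b)) (x : FormAlg n) :
    topValue b (kap s v x) = 0 := by
  rw [kap_eq, map_smul, topValue_con b _ hv, smul_zero]

theorem kap_mul (s : Bool) (v : E n) (x y : FormAlg n) :
    kap s v (x * y) = kap s v x * y + CliffordAlgebra.involute x * kap s v y := by
  simp only [kap_eq, con_mul, smul_add, smul_mul_assoc, mul_smul_comm]

/-- Only the contraction with the last vector that matches the kind of the covector can see `l`; the
other member of the pair is left over. For `d''` the leftover contraction first passes the covector,
whence the sign built into `kap`. -/
theorem topValue_snoc_cov_mul {d : ℕ} (b : Fin (d + 1) → E n) (s : Bool)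
    (l : Module.Dual ℝ (E n)) (hl : ∀ i : Fin d, l (b i.castSucc) = 0) (x : FormAlg n) :
    topValue b (cov s l * x) =
      l (b (Fin.last d)) * topValue (fun i : Fin d => b i.castSucc) (kap s (b (Fin.last d)) x) := by
  rw [topValue_succ]
  cases s
  · have h := con_cov_not_mul true (b (Fin.last d)) l (con false (b (Fin.last d)) x)
    rw [Bool.not_true] at h
    rw [con_cov_mul, map_sub, map_sub, map_smul, map_smul, h, map_neg,
      topValue_cov_mul _ _ _ hl]
    simp [kap]
  · have h := con_cov_not_mul false (b (Fin.last d)) l x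
    rw [Bool.not_false] at h
    rw [h, map_neg, con_cov_mul, map_neg, map_sub, map_smul, topValue_cov_mul _ _ _ hl]
    simp [kap]

theorem exists_topValue_ne_zero {d : ℕ} (b : Fin d → E n) (hb : LinearIndependent ℝ b) :
    ∃ x, topValue b x ≠ 0 := by
  induction d with
  | zero => exact ⟨1, by rw [topValue_zero]; simp⟩
  | succ d ih =>
    obtain ⟨x, hx⟩ := ih (fun i => b i.castSucc) (hb.comp _ (Fin.castSucc_injective d))
    obtain ⟨l, hl⟩ : ∃ l : Module.Dual ℝ (E n), ∀ i, l (b i) = if i = Fin.last d then 1 else 0 := by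
      obtain ⟨g, hg⟩ := LinearMap.exists_leftInverse_of_injective
        (Finsupp.linearCombination ℝ b) (LinearMap.ker_eq_bot.2 hb)
      refine ⟨Finsupp.lapply (Fin.last d) ∘ₗ g, fun i => ?_⟩
      have h := LinearMap.congr_fun hg (Finsupp.single i 1)
      simp only [LinearMap.comp_apply, Finsupp.linearCombination_single, one_smul,
        LinearMap.id_apply] at h
      simp [h, Finsupp.single_apply]
    have hl' : ∀ i : Fin d, l (b i.castSucc) = 0 := fun i => by
      rw [hl, if_neg (Fin.castSucc_lt_last i).ne]
    -- With `l` dual to the last vector, the factor `d'l ∧ d''l` is consumed exactly by the last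
    -- pair of contractions.
    refine ⟨cov false l * (cov true l * x), ?_⟩
    rw [topValue_snoc_cov_mul b false l hl', hl, if_pos rfl, one_mul]
    simp only [kap, cond_false]
    rw [con_cov_mul, map_sub, topValue_cov_mul _ _ _ hl', sub_zero, hl, if_pos rfl, one_smul]
    exact hx

end Sides

end DeltaForm

end

noncomputable section

namespace DeltaForm

open scoped ContDiff
open MeasureTheory

section ChangeOfFrame

variable {n : ℕ}

/-! ## Restriction to subspaces -/

/-- Pull-back of forms along an endomorphism of `ℝⁿ`. -/
def pullback (P : E n →ₗ[ℝ] E n) : FormAlg n →ₐ[ℝ] FormAlg n :=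
  ExteriorAlgebra.map (P.dualMap.prodMap P.dualMap)

theorem con_pullback (P : E n →ₗ[ℝ] E n) (s : Bool) (v : E n) (x : FormAlg n) :
    con s v (pullback P x) = pullback P (con s (P v) x) := by
  rw [con_eq, con_eq, pullback, ctr_map]
  congr 2
  congr 1
  refine LinearMap.ext fun w => ?_
  cases s <;> simp [evalAt, vec]

theorem topValue_pullback {d : ℕ} (P : E n →ₗ[ℝ] E n) (b : Fin d → E n) (hb : ∀ i, P (b i) = b i)
    (x : FormAlg n) : topValue b (pullback P x) = topValue b x := by
  induction d generalizing x with
  | zero => rw [topValue_zero, topValue_zero, pullback, algebraMapInv_map]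
  | succ d ih =>
    rw [topValue_succ, topValue_succ b, con_pullback, con_pullback, hb, ih _ (fun i => hb _)]

/-- Extension of forms from a subspace along a linear retraction. -/
def extendForm (N : Submodule ℝ (E n)) (p : E n →ₗ[ℝ] N) :
    ExteriorAlgebra ℝ (Module.Dual ℝ N × Module.Dual ℝ N) →ₐ[ℝ] FormAlg n :=
  ExteriorAlgebra.map (p.dualMap.prodMap p.dualMap)

theorem extendForm_restrict (N : Submodule ℝ (E n)) (p : E n →ₗ[ℝ] N) (x : FormAlg n) :
    extendForm N p (restrict N x) = pullback (N.subtype ∘ₗ p) x := by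
  rw [extendForm, restrict, pullback, ← AlgHom.comp_apply, ExteriorAlgebra.map_comp_map]
  rfl

theorem restrict_extendForm (N : Submodule ℝ (E n)) (p : E n →ₗ[ℝ] N)
    (hp : p ∘ₗ N.subtype = LinearMap.id)
    (y : ExteriorAlgebra ℝ (Module.Dual ℝ N × Module.Dual ℝ N)) :
    restrict N (extendForm N p y) = y := by
  rw [extendForm, restrict, ← AlgHom.comp_apply, ExteriorAlgebra.map_comp_map]
  have h : (N.subtype.dualMap.prodMap N.subtype.dualMap) ∘ₗ (p.dualMap.prodMap p.dualMap) =
      LinearMap.id := by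
    refine LinearMap.ext fun w => ?_
    refine Prod.ext ?_ ?_
    · refine LinearMap.ext fun v => ?_
      have := LinearMap.congr_fun hp v
      simp only [LinearMap.comp_apply, Submodule.subtype_apply, LinearMap.id_apply] at this
      simp [this]
    · refine LinearMap.ext fun v => ?_
      have := LinearMap.congr_fun hp v
      simp only [LinearMap.comp_apply, Submodule.subtype_apply, LinearMap.id_apply] at this
      simp [this]
  rw [h, ExteriorAlgebra.map_id, AlgHom.id_apply]

theorem exists_retraction (N : Submodule ℝ (E n)) :
    ∃ p : E n →ₗ[ℝ] N, p ∘ₗ N.subtype = LinearMap.id :=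
  LinearMap.exists_leftInverse_of_injective _ N.ker_subtype

/-- Pulling back along a projection onto `N` does not change the top coefficient on a frame in `N`,
and this pull-back factors through `restrict`. -/
theorem topValue_eq_zero_of_restrict {d : ℕ} (N : Submodule ℝ (E n)) (b : Fin d → E n)
    (hb : ∀ i, b i ∈ N) {x : FormAlg n} (hx : restrict N x = 0) : topValue b x = 0 := by
  obtain ⟨p, hp⟩ := exists_retraction N
  rw [← topValue_pullback (N.subtype ∘ₗ p) b, ← extendForm_restrict, hx]
  · simp
  · intro i
    have := LinearMap.congr_fun hp ⟨b i, hb i⟩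
    simp only [LinearMap.comp_apply, Submodule.subtype_apply, LinearMap.id_apply] at this
    simp [this]

theorem map_involute {M M' : Type*} [AddCommGroup M] [Module ℝ M] [AddCommGroup M'] [Module ℝ M']
    (f : M →ₗ[ℝ] M') (x : ExteriorAlgebra ℝ M) :
    ExteriorAlgebra.map f (CliffordAlgebra.involute x) =
      CliffordAlgebra.involute (ExteriorAlgebra.map f x) := by
  induction x using exterior_left_induction with
  | alg r => rw [Algebra.algebraMap_eq_smul_one]; simp
  | add x x' hx hx' => simp only [map_add, hx, hx']
  | mul x m hx =>
    rw [map_mul, map_mul, map_mul, map_mul, hx, involute_ι, map_neg, ExteriorAlgebra.map_apply_ι,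
      involute_ι]

theorem restrict_involute (N : Submodule ℝ (E n)) (x : FormAlg n) :
    restrict N (CliffordAlgebra.involute x) = CliffordAlgebra.involute (restrict N x) :=
  map_involute _ x

/-- This is nondegeneracy of the wedge pairing on the exterior algebra over `N`, applied to the
functional obtained by extending forms from `N` and taking their top coefficient. -/
theorem restrict_eq_zero_of_forall_topValue {d : ℕ} (N : Submodule ℝ (E n)) (b : Fin d → E n)
    (hb : LinearIndependent ℝ b) (hN : Submodule.span ℝ (Set.range b) = N) {x : FormAlg n}
    (hx : ∀ y, topValue b (x * y) = 0) : restrict N x = 0 := by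
  obtain ⟨p, hp⟩ := exists_retraction N
  have hpN : ∀ v : N, p v = v := fun v => LinearMap.congr_fun hp v
  have hbN : ∀ i, b i ∈ N := fun i => hN ▸ Submodule.subset_span ⟨i, rfl⟩
  have hfix : ∀ i, (N.subtype ∘ₗ p) (b i) = b i := fun i => by
    simp [hpN ⟨b i, hbN i⟩]
  refine eq_zero_of_forall_mul_eq_zero (topValue b ∘ₗ (extendForm N p).toLinearMap) ?_ ?_ ?_ ?_
  · obtain ⟨y, hy⟩ := exists_topValue_ne_zero b hb
    intro h
    apply hy
    have := LinearMap.congr_fun h (restrict N y)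
    simp only [LinearMap.comp_apply, AlgHom.toLinearMap_apply, extendForm_restrict] at this
    rw [topValue_pullback _ b hfix] at this
    simpa using this
  · intro y
    simp only [LinearMap.comp_apply, AlgHom.toLinearMap_apply]
    rw [extendForm, map_involute, topValue_involute]
  · intro δ y
    -- By reflexivity a functional on `N* ⊕ N*` is evaluation at a pair of vectors of `N`, so its
    -- contraction is a sum of two tangential ones, to which `topValue_con` applies.
    obtain ⟨w₁, hw₁⟩ : ∃ w : N, Module.Dual.eval ℝ N w = δ ∘ₗ LinearMap.inl ℝ _ _ :=
      (Module.evalEquiv ℝ N).surjective _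
    obtain ⟨w₂, hw₂⟩ : ∃ w : N, Module.Dual.eval ℝ N w = δ ∘ₗ LinearMap.inr ℝ _ _ :=
      (Module.evalEquiv ℝ N).surjective _
    have h1 : δ = evalAt ((w₁ : E n), (w₂ : E n)) ∘ₗ (p.dualMap.prodMap p.dualMap) := by
      refine LinearMap.ext fun f => ?_
      have e1 := LinearMap.congr_fun hw₁ f.1
      have e2 := LinearMap.congr_fun hw₂ f.2
      simp only [Module.Dual.eval_apply, LinearMap.comp_apply, LinearMap.inl_apply,
        LinearMap.inr_apply] at e1 e2
      have e3 : δ f = δ (f.1, 0) + δ (0, f.2) := by rw [← map_add]; simp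
      rw [e3, ← e1, ← e2]
      simp [evalAt, hpN]
    simp only [LinearMap.comp_apply, AlgHom.toLinearMap_apply]
    rw [h1, extendForm, ← ctr_map]
    have h2 : evalAt ((w₁ : E n), (w₂ : E n)) = evalAt (vec false w₁) + evalAt (vec true w₂) := by
      rw [← map_add]; simp [vec]
    have h5 : ctr (evalAt (vec false (w₁ : E n)) + evalAt (vec true (w₂ : E n))) =
        ctr (evalAt (vec false (w₁ : E n))) + ctr (evalAt (vec true (w₂ : E n))) :=
      map_add CliffordAlgebra.contractLeft _ _
    rw [h2, h5, LinearMap.add_apply, map_add]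
    have h3 := topValue_con b false (hN.symm ▸ w₁.2 :
      (w₁ : E n) ∈ _) (ExteriorAlgebra.map (p.dualMap.prodMap p.dualMap) y)
    have h4 := topValue_con b true (hN.symm ▸ w₂.2 :
      (w₂ : E n) ∈ _) (ExteriorAlgebra.map (p.dualMap.prodMap p.dualMap) y)
    rw [con_eq] at h3 h4
    rw [h3, h4, add_zero]
  · intro y
    obtain ⟨z, rfl⟩ : ∃ z, restrict N z = y := ⟨_, restrict_extendForm N p hp y⟩
    simp only [LinearMap.comp_apply, AlgHom.toLinearMap_apply]
    rw [← map_mul, extendForm_restrict, topValue_pullback _ b hfix, hx]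

/-! ## Change of frames -/

/-- After composition with a functional on `W`, the left side is an alternating form of degree `d`
in the columns of `A`, hence a multiple of the determinant. Functionals separate the points of `W`.
-/
theorem alternating_map_matrix {V W : Type*} [AddCommGroup V] [Module ℝ V] [AddCommGroup W]
    [Module ℝ W] {d : ℕ} (f : V [⋀^Fin d]→ₗ[ℝ] W) (b : Fin d → V) (A : Matrix (Fin d) (Fin d) ℝ) :
    f (fun j => ∑ i, A i j • b i) = A.det • f b := by
  rw [← sub_eq_zero, ← Module.forall_dual_apply_eq_zero_iff ℝ]
  intro φ
  rw [map_sub, map_smul, sub_eq_zero]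
  let g : (Fin d → ℝ) [⋀^Fin d]→ₗ[ℝ] ℝ :=
    (φ.compAlternatingMap f).compLinearMap (Fintype.linearCombination ℝ b)
  have h := AlternatingMap.eq_smul_basis_det (Pi.basisFun ℝ (Fin d)) g
  have h2 := congrArg (fun k => k (fun j i => A i j)) h
  simp only [AlternatingMap.smul_apply, Pi.basisFun_det_apply] at h2
  have h3 : g (fun j i => A i j) = φ (f (fun j => ∑ i, A i j • b i)) := by
    simp [g, Fintype.linearCombination_apply]
  have h4 : g (Pi.basisFun ℝ (Fin d)) = φ (f b) := by
    simp only [g, AlternatingMap.compLinearMap_apply, LinearMap.compAlternatingMap_apply]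
    congr 2
    funext i
    simp [Fintype.linearCombination_apply, Pi.single_apply]
  rw [h3, h4] at h2
  rw [h2, ← Matrix.det_transpose A, smul_eq_mul, smul_eq_mul, mul_comm]
  rfl

/-- Iterated contraction, as an action of the exterior algebra of multivectors. -/
def contractHom (n : ℕ) : ExteriorAlgebra ℝ (E n × E n) →ₐ[ℝ] Module.End ℝ (FormAlg n) :=
  ExteriorAlgebra.lift ℝ ⟨CliffordAlgebra.contractLeft ∘ₗ evalAt, fun _ =>
    LinearMap.ext fun x => CliffordAlgebra.contractLeft_contractLeft _ x⟩

theorem involute_ιMulti {M : Type*} [AddCommGroup M] [Module ℝ M] {d : ℕ} (b : Fin d → M) :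
    CliffordAlgebra.involute (ExteriorAlgebra.ιMulti ℝ d b) =
      (-1 : ℝ) ^ d • ExteriorAlgebra.ιMulti ℝ d b := by
  induction d with
  | zero => simp [ExteriorAlgebra.ιMulti_zero_apply]
  | succ d ih =>
    rw [ExteriorAlgebra.ιMulti_succ_apply, map_mul, involute_ι, ih, pow_succ]
    simp

/-- Sorting the interleaved product costs a sign that depends on `d` only. As it is the same for all
frames, its value is irrelevant and it is left as an unspecified constant. -/
theorem exists_prod_eq (d : ℕ) : ∃ c : ℝ, ∀ b : Fin d → E n,
    ((List.finRange d).map fun i => ExteriorAlgebra.ι ℝ (vec true (b i)) *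
      ExteriorAlgebra.ι ℝ (vec false (b i))).prod =
    c • (ExteriorAlgebra.ιMulti ℝ d (fun i => vec true (b i)) *
      ExteriorAlgebra.ιMulti ℝ d (fun i => vec false (b i))) := by
  induction d with
  | zero => exact ⟨1, fun b => by simp [ExteriorAlgebra.ιMulti_zero_apply]⟩
  | succ d ih =>
    obtain ⟨c, hc⟩ := ih
    refine ⟨c * (-1) ^ d, fun b => ?_⟩
    have h := hc (fun i => b i.succ)
    rw [List.finRange_succ, List.map_cons, List.prod_cons, List.map_map]
    simp only [Function.comp_def]
    rw [h, ExteriorAlgebra.ιMulti_succ_apply, ExteriorAlgebra.ιMulti_succ_apply]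
    simp only [Matrix.vecTail, Function.comp_def]
    have h1 := mul_ι_eq (CliffordAlgebra.involute
      (ExteriorAlgebra.ιMulti ℝ d fun i => vec true (b i.succ))) (vec false (b 0))
    rw [CliffordAlgebra.involute_involute, involute_ιMulti, smul_mul_assoc] at h1
    rw [mul_smul_comm, mul_assoc, ← mul_assoc (ExteriorAlgebra.ι ℝ (vec false (b 0))), ← h1,
      smul_mul_assoc, mul_smul_comm, smul_smul, mul_assoc, mul_assoc]

/-- After sorting, the vectors of both kinds enter through one alternating product each, and a
change of frame contributes one determinant for each kind. -/
theorem topValue_matrix {d : ℕ} (b : Fin d → E n) (A : Matrix (Fin d) (Fin d) ℝ) (x : FormAlg n) :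
    topValue (fun j => ∑ i, A i j • b i) x = A.det ^ 2 * topValue b x := by
  obtain ⟨c, hc⟩ := exists_prod_eq (n := n) d
  have key : ∀ b : Fin d → E n, topValue b x = c * ExteriorAlgebra.algebraMapInv
      (contractHom n (ExteriorAlgebra.ιMulti ℝ d (fun i => vec true (b i)) *
        ExteriorAlgebra.ιMulti ℝ d (fun i => vec false (b i))) x) := by
    intro b
    have h := congrArg (fun y => contractHom n y x) (hc b)
    simp only [map_list_prod, List.map_map, map_smul, LinearMap.smul_apply] at h
    have h2 : (⇑(contractHom n) ∘ fun i => ExteriorAlgebra.ι ℝ (vec true (b i)) *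
        ExteriorAlgebra.ι ℝ (vec false (b i))) = fun i : Fin d =>
        (contract ((0 : E n), b i) ∘ₗ contract (b i, (0 : E n)) : Module.End ℝ (FormAlg n)) := by
      funext i
      simp only [Function.comp_apply, map_mul, contractHom, ExteriorAlgebra.lift_ι_apply]
      rfl
    rw [h2] at h
    rw [topValue, LinearMap.comp_apply, h, AlgHom.toLinearMap_apply, map_smul, smul_eq_mul]
  rw [key, key]
  have hv : ∀ s : Bool, (fun j => vec s (∑ i, A i j • b i)) =
      fun j => ∑ i, A i j • vec s (b i) := by
    intro s; funext j; simp
  rw [hv, hv, alternating_map_matrix, alternating_map_matrix, smul_mul_smul_comm, map_smul,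
    LinearMap.smul_apply, map_smul, smul_eq_mul]
  ring

/-- The integral of a form over the part of `S` in an affine subspace with given affine frame. -/
def frameIntegral {d : ℕ} (x₀ : E n) (b : Fin d → E n) (S : Set (E n)) (ζ : E n → FormAlg n) : ℝ :=
  ∫ t in {t : Fin d → ℝ | x₀ + ∑ i, t i • b i ∈ S}, topValue b (ζ (x₀ + ∑ i, t i • b i))

theorem integral_comp_matrix {d : ℕ} (A : Matrix (Fin d) (Fin d) ℝ) (hA : A.det ≠ 0)
    (a : Fin d → ℝ) (f : (Fin d → ℝ) → ℝ) :
    ∫ t, f (a + A.mulVec t) = |A.det|⁻¹ * ∫ t, f t := by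
  have h1 : ∫ t, f (a + A.mulVec t) = ∫ t, f (a + t) ∂(Measure.map (Matrix.toLin' A) volume) := by
    have he : MeasurableEmbedding (Matrix.toLin' A) := by
      have hinj : Function.Injective (Matrix.toLin' A) := by
        rw [Matrix.toLin'_apply']
        exact Matrix.mulVec_injective_of_isUnit ((Matrix.isUnit_iff_isUnit_det A).2 hA.isUnit)
      exact (LinearMap.isClosedEmbedding_of_injective
        (LinearMap.ker_eq_bot.2 hinj)).measurableEmbedding
    rw [he.integral_map]
    rfl
  rw [h1, Real.map_matrix_volume_pi_eq_smul_volume_pi hA, integral_smul_measure,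
    integral_add_left_eq_self (μ := volume) f a, ENNReal.toReal_ofReal (abs_nonneg _), abs_inv,
    smul_eq_mul]

theorem frameIntegral_eq_indicator {d : ℕ} (x₀ : E n) (b : Fin d → E n) {S : Set (E n)}
    (hS : MeasurableSet S) (ζ : E n → FormAlg n) :
    frameIntegral x₀ b S ζ =
      ∫ t : Fin d → ℝ, S.indicator (fun x => topValue b (ζ x)) (x₀ + ∑ i, t i • b i) := by
  rw [frameIntegral, ← integral_indicator]
  · rfl
  · exact hS.preimage (by fun_prop)

/-- The coefficient contributes `det²` and Lebesgue measure `|det|⁻¹`. That only `|det|` remains is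
the reason why integration needs no orientation and weights matter only up to sign. -/
theorem frameIntegral_matrix {d : ℕ} (x₀ : E n) (b : Fin d → E n) {S : Set (E n)}
    (hS : MeasurableSet S) (ζ : E n → FormAlg n) (A : Matrix (Fin d) (Fin d) ℝ) (hA : A.det ≠ 0)
    (a : Fin d → ℝ) :
    frameIntegral (x₀ + ∑ i, a i • b i) (fun j => ∑ i, A i j • b i) S ζ =
      |A.det| * frameIntegral x₀ b S ζ := by
  rw [frameIntegral_eq_indicator _ _ hS, frameIntegral_eq_indicator _ _ hS]
  have h1 : ∀ t : Fin d → ℝ, x₀ + ∑ i, a i • b i + ∑ j, t j • ∑ i, A i j • b i =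
      x₀ + ∑ i, (a + A.mulVec t) i • b i := by
    intro t
    rw [add_assoc]
    congr 1
    simp only [Pi.add_apply, add_smul, Finset.sum_add_distrib, Matrix.mulVec, dotProduct,
      Finset.smul_sum, Finset.sum_smul, smul_smul]
    rw [Finset.sum_comm]
    simp only [mul_comm]
  simp only [h1]
  have h2 : (fun x => topValue (fun j => ∑ i, A i j • b i) (ζ x)) =
      fun x => A.det ^ 2 * topValue b (ζ x) := by
    funext x; exact topValue_matrix b A _
  rw [h2]
  rw [integral_comp_matrix A hA a
    (fun t => S.indicator (fun x => A.det ^ 2 * topValue b (ζ x)) (x₀ + ∑ i, t i • b i))]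
  have h3 : ∀ x, S.indicator (fun x => A.det ^ 2 * topValue b (ζ x)) x =
      A.det ^ 2 * S.indicator (fun x => topValue b (ζ x)) x := by
    intro x; by_cases hx : x ∈ S <;> simp [hx]
  simp only [h3]
  rw [integral_const_mul, ← mul_assoc]
  congr 1
  have h4 : |A.det| ≠ 0 := abs_ne_zero.2 hA
  rw [← sq_abs]
  field_simp

/-! ## Weights -/

theorem ιMulti_ne_zero {d : ℕ} {b : Fin d → E n} (hb : LinearIndependent ℝ b) :
    ExteriorAlgebra.ιMulti ℝ d b ≠ 0 := by
  obtain ⟨g, hg⟩ := LinearMap.exists_leftInverse_of_injective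
    (Fintype.linearCombination ℝ b) (LinearMap.ker_eq_bot.2 (by
      exact linearIndependent_iff_injective_fintypeLinearCombination.1 hb))
  have hgb : ∀ i, g (b i) = Pi.single i 1 := by
    intro i
    have h := LinearMap.congr_fun hg (Pi.single i 1)
    simpa [Fintype.linearCombination_apply, Pi.single_apply] using h
  let f : E n [⋀^Fin d]→ₗ[ℝ] ℝ := Matrix.detRowAlternating.compLinearMap g
  have hf : f b = 1 := by
    have : (fun i => g (b i)) = (1 : Matrix (Fin d) (Fin d) ℝ) := by
      funext i j
      rw [hgb, Matrix.one_apply, Pi.single_apply]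
      simp only [eq_comm]
    simp only [f, AlternatingMap.compLinearMap_apply, this]
    exact Matrix.det_one
  intro h0
  -- The determinant form `f` extends to a functional on the exterior algebra when completed by zero
  -- in the other degrees; its value at the product is `1`.
  have h1 := ExteriorAlgebra.liftAlternating_apply_ιMulti (R := ℝ)
    (fun i => if h : d = i then h ▸ f else 0) b
  rw [h0, map_zero] at h1
  simp [hf] at h1

theorem exists_matrix {d : ℕ} {N : Submodule ℝ (E n)} {b b' : Fin d → E n}
    (hbN : Submodule.span ℝ (Set.range b) = N) (hb' : LinearIndependent ℝ b')
    (hb'N : ∀ i, b' i ∈ N) :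
    ∃ A : Matrix (Fin d) (Fin d) ℝ, A.det ≠ 0 ∧ b' = fun j => ∑ i, A i j • b i := by
  have h1 : ∀ j, ∃ c : Fin d → ℝ, ∑ i, c i • b i = b' j := by
    intro j
    have := hb'N j
    rw [← hbN, Submodule.mem_span_range_iff_exists_fun] at this
    exact this
  choose c hc using h1
  have h2 : b' = fun j => ∑ i, (Matrix.of fun i j => c j i) i j • b i := by
    funext j; exact (hc j).symm
  refine ⟨Matrix.of fun i j => c j i, fun hdet => ?_, h2⟩
  have h3 := alternating_map_matrix (ExteriorAlgebra.ιMulti ℝ d) b (Matrix.of fun i j => c j i)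
  rw [hdet, zero_smul, ← h2] at h3
  exact ιMulti_ne_zero hb' h3

theorem frame_linearIndependent {N : Submodule ℝ (E n)} (μ : Weight N) :
    LinearIndependent ℝ (fun i => (μ.frame i : E n)) :=
  μ.frame.linearIndependent.map' N.subtype N.ker_subtype

theorem span_frame {N : Submodule ℝ (E n)} (μ : Weight N) :
    Submodule.span ℝ (Set.range (fun i => (μ.frame i : E n))) = N := by
  have h := μ.frame.span_eq
  have h2 := congrArg (Submodule.map N.subtype) h
  rw [Submodule.map_span, Submodule.map_top, Submodule.range_subtype, ← Set.range_comp] at h2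
  exact h2

theorem toExt_ne_zero {N : Submodule ℝ (E n)} (μ : Weight N) : μ.toExt ≠ 0 :=
  smul_ne_zero μ.scale_pos.ne' (ιMulti_ne_zero (frame_linearIndependent μ))

theorem exists_toExt_eq {N : Submodule ℝ (E n)} (μ : Weight N) {d : ℕ} {b : Fin d → E n}
    (hb : LinearIndependent ℝ b) (hbN : Submodule.span ℝ (Set.range b) = N) :
    ∃ c : ℝ, 0 < c ∧ (μ.toExt = c • ExteriorAlgebra.ιMulti ℝ d b ∨
      μ.toExt = -(c • ExteriorAlgebra.ιMulti ℝ d b)) := by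
  have hd : d = Module.finrank ℝ N := by
    rw [← hbN, finrank_span_eq_card hb, Fintype.card_fin]
  subst hd
  obtain ⟨A, hA, hA2⟩ := exists_matrix hbN (frame_linearIndependent μ) (fun i => (μ.frame i).2)
  have h := alternating_map_matrix (ExteriorAlgebra.ιMulti ℝ _) b A
  rw [← hA2] at h
  refine ⟨μ.scale * |A.det|, mul_pos μ.scale_pos (abs_pos.2 hA), ?_⟩
  rw [Weight.toExt, h, smul_smul]
  rcases abs_choice A.det with h1 | h1 <;> rw [h1]
  · exact Or.inl rfl
  · right; simp

/-- Integrals depend only on the multivector up to sign: the factor `|det A|` between the two frame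
integrals is also the ratio of the multivectors, so it cancels against the scales. -/
theorem scale_mul_frameIntegral {N : Submodule ℝ (E n)} (μ : Weight N) {S : Set (E n)}
    (hS : MeasurableSet S) {d : ℕ} {b : Fin d → E n}
    (hb : LinearIndependent ℝ b) (hbN : Submodule.span ℝ (Set.range b) = N)
    {x₀ x₁ : E n} (hx : x₁ - x₀ ∈ N) {c : ℝ} (hc : 0 < c)
    (hμ : μ.toExt = c • ExteriorAlgebra.ιMulti ℝ d b ∨
      μ.toExt = -(c • ExteriorAlgebra.ιMulti ℝ d b)) (ζ : E n → FormAlg n) :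
    μ.scale * frameIntegral x₀ (fun i => (μ.frame i : E n)) S ζ = c * frameIntegral x₁ b S ζ := by
  have hd : d = Module.finrank ℝ N := by
    rw [← hbN, finrank_span_eq_card hb, Fintype.card_fin]
  subst hd
  obtain ⟨A, hA, hA2⟩ := exists_matrix (span_frame μ) hb
    (fun i => by rw [← hbN]; exact Submodule.subset_span ⟨i, rfl⟩)
  obtain ⟨a, ha⟩ : ∃ a : Fin (Module.finrank ℝ N) → ℝ,
      ∑ i, a i • (μ.frame i : E n) = x₁ - x₀ := by
    rwa [← Submodule.mem_span_range_iff_exists_fun, span_frame μ]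
  have hx : x₁ = x₀ + ∑ i, a i • (μ.frame i : E n) := by rw [ha]; abel
  have h := alternating_map_matrix (ExteriorAlgebra.ιMulti ℝ _)
    (fun i => (μ.frame i : E n)) A
  rw [← hA2] at h
  have hsc : μ.scale = c * |A.det| := by
    have hne0 := ιMulti_ne_zero (frame_linearIndependent μ)
    rw [Weight.toExt, h, smul_smul, ← neg_smul] at hμ
    have h1 : μ.scale = c * A.det ∨ μ.scale = -(c * A.det) := by
      rcases hμ with h1 | h1
      · exact Or.inl (smul_left_injective ℝ hne0 h1)
      · exact Or.inr (smul_left_injective ℝ hne0 h1)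
    rw [← abs_of_pos μ.scale_pos, ← abs_of_pos hc, ← abs_mul]
    rcases h1 with h1 | h1 <;> simp [h1]
  rw [hx, hA2, frameIntegral_matrix _ _ hS ζ A hA a, ← mul_assoc, ← hsc]

theorem basePoint_mem {σ : Set (E n)} (hne : σ.Nonempty) : basePoint σ ∈ σ := by
  rw [basePoint, dif_pos hne]; exact hne.some_mem

theorem integral_eq_frameIntegral {σ : Set (E n)} (hσ : MeasurableSet σ) (hne : σ.Nonempty)
    (μ : Weight (vectorSpan ℝ σ)) {d : ℕ} {b : Fin d → E n}
    (hb : LinearIndependent ℝ b) (hbN : Submodule.span ℝ (Set.range b) = vectorSpan ℝ σ)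
    {x₀ : E n} (hx₀ : x₀ ∈ affineSpan ℝ σ) {c : ℝ} (hc : 0 < c)
    (hμ : μ.toExt = c • ExteriorAlgebra.ιMulti ℝ d b ∨
      μ.toExt = -(c • ExteriorAlgebra.ιMulti ℝ d b)) (ζ : E n → FormAlg n) :
    integral σ μ ζ = c * frameIntegral x₀ b σ ζ := by
  refine scale_mul_frameIntegral μ hσ hb hbN ?_ hc hμ ζ
  have := AffineSubspace.vsub_mem_direction hx₀ (mem_affineSpan ℝ (basePoint_mem hne))
  rwa [direction_affineSpan] at this

end ChangeOfFrame

end DeltaForm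

end

noncomputable section

namespace DeltaForm

open scoped ContDiff
open MeasureTheory

section Geometry

variable {n : ℕ} {σ τ : Set (E n)}

/-! ## Polyhedra and faces -/

theorem continuous_dual (l : Module.Dual ℝ (E n)) : Continuous l :=
  LinearMap.continuous_of_finiteDimensional l

theorem IsPolyhedron.isClosed (h : IsPolyhedron σ) : IsClosed σ := by
  obtain ⟨-, H, rfl⟩ := h
  simp only [Set.ofPred_forall]
  exact isClosed_iInter fun h => isClosed_iInter fun _ =>
    isClosed_le (continuous_dual h.1) continuous_const

theorem IsPolyhedron.measurableSet (h : IsPolyhedron σ) : MeasurableSet σ :=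
  h.isClosed.measurableSet

theorem IsPolyhedron.convex (h : IsPolyhedron σ) : Convex ℝ σ := by
  obtain ⟨-, H, rfl⟩ := h
  simp only [Set.ofPred_forall]
  exact convex_iInter fun h => convex_iInter fun _ => convex_halfSpace_le h.1.isLinear _

theorem isFace_iff : IsFace τ σ ↔ τ.Nonempty ∧ ∃ (l : Module.Dual ℝ (E n)) (m : ℝ),
    (∀ x ∈ σ, l x ≤ m) ∧ τ = {x ∈ σ | l x = m} := by
  constructor
  · rintro ⟨hne, hex⟩
    refine ⟨hne, ?_⟩
    obtain ⟨l, hl⟩ := hex hne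
    obtain ⟨x₀, hx₀⟩ := hne
    have hx₀' := hx₀
    rw [hl] at hx₀'
    refine ⟨l.toLinearMap, l x₀, fun x hx => hx₀'.2 x hx, ?_⟩
    rw [hl]
    ext x
    constructor
    · rintro ⟨h1, h2⟩
      exact ⟨h1, le_antisymm (hx₀'.2 x h1) (h2 x₀ hx₀'.1)⟩
    · rintro ⟨h1, h2⟩
      refine ⟨h1, fun y hy => (hx₀'.2 y hy).trans (le_of_eq ?_)⟩
      exact h2.symm
  · rintro ⟨hne, l, m, hl, hτ⟩
    refine ⟨hne, fun _ => ⟨LinearMap.toContinuousLinearMap l, ?_⟩⟩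
    obtain ⟨x₀, hx₀⟩ := hne
    rw [hτ] at hx₀
    rw [hτ]
    ext x
    simp only [Set.mem_ofPred_eq, LinearMap.coe_toContinuousLinearMap']
    constructor
    · rintro ⟨h1, h2⟩
      exact ⟨h1, fun y hy => h2 ▸ hl y hy⟩
    · rintro ⟨h1, h2⟩
      exact ⟨h1, le_antisymm (hl x h1) (hx₀.2 ▸ h2 x₀ hx₀.1)⟩

theorem IsFace.subset (h : IsFace τ σ) : τ ⊆ σ := by
  obtain ⟨-, l, m, -, rfl⟩ := isFace_iff.1 h
  exact fun x hx => hx.1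

theorem IsFace.isClosed (h : IsFace τ σ) (hσ : IsClosed σ) : IsClosed τ := by
  obtain ⟨-, l, m, -, rfl⟩ := isFace_iff.1 h
  exact hσ.inter (isClosed_eq (continuous_dual l) continuous_const)

theorem IsFace.convex (h : IsFace τ σ) (hσ : Convex ℝ σ) : Convex ℝ τ := by
  obtain ⟨-, l, m, -, rfl⟩ := isFace_iff.1 h
  exact hσ.inter (convex_hyperplane l.isLinear m)

theorem IsFace.mem_of_mem_affineSpan (h : IsFace τ σ) {x : E n} (hx : x ∈ σ)
    (hx' : x ∈ affineSpan ℝ τ) : x ∈ τ := by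
  obtain ⟨hne, l, m, -, hτ⟩ := isFace_iff.1 h
  have h1 : affineSpan ℝ τ ≤ (AffineSubspace.mk' m ⊥).comap l.toAffineMap := by
    rw [affineSpan_le]
    intro y hy
    rw [hτ] at hy
    simp [hy.2]
  have h2 := h1 hx'
  simp only [AffineSubspace.mem_comap, LinearMap.coe_toAffineMap, AffineSubspace.mem_mk',
    vsub_eq_sub, Submodule.mem_bot, sub_eq_zero] at h2
  rw [hτ]
  exact ⟨hx, h2⟩

theorem mem_affineSpan_iff {x y : E n} (hy : y ∈ σ) :
    x ∈ affineSpan ℝ σ ↔ x - y ∈ vectorSpan ℝ σ := by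
  rw [← direction_affineSpan, ← vsub_eq_sub, AffineSubspace.vsub_right_mem_direction_iff_mem
    (mem_affineSpan ℝ hy)]

theorem sub_mem_vectorSpan {x y : E n} (hx : x ∈ σ) (hy : y ∈ σ) : x - y ∈ vectorSpan ℝ σ :=
  vsub_mem_vectorSpan ℝ hx hy

/-- A linear form which is constant on `σ` vanishes on `N_σ`. -/
theorem eq_zero_of_mem_vectorSpan {l : Module.Dual ℝ (E n)} (hl : ∀ x ∈ σ, ∀ y ∈ σ, l x = l y)
    {v : E n} (hv : v ∈ vectorSpan ℝ σ) : l v = 0 := by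
  have : vectorSpan ℝ σ ≤ LinearMap.ker l := by
    rw [vectorSpan_def, Submodule.span_le]
    rintro _ ⟨x, hx, y, hy, rfl⟩
    simp [hl x hx y hy]
  exact this hv

theorem IsFacet.exists_mem_diff (h : IsFacet τ σ) : ∃ x ∈ σ, x ∉ τ := by
  by_contra! hcon
  have : τ = σ := h.1.subset.antisymm hcon
  have := h.2
  subst τ
  omega

theorem ιMulti_snoc {M : Type*} [AddCommGroup M] [Module ℝ M] {d : ℕ} (b : Fin d → M) (v : M) :
    ExteriorAlgebra.ιMulti ℝ (d + 1) (Fin.snoc b v) =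
      ExteriorAlgebra.ιMulti ℝ d b * ExteriorAlgebra.ι ℝ v := by
  rw [ExteriorAlgebra.ιMulti_apply, ExteriorAlgebra.ιMulti_apply, List.ofFn_succ_last]
  simp

/-- The frame of `N_σ` obtained from the frame of a facet and a normal vector. -/
theorem IsNormalVector.frame (hf : IsFacet τ σ) {μ : Weight (vectorSpan ℝ σ)}
    {ν : Weight (vectorSpan ℝ τ)} {v : E n} (hv : IsNormalVector μ ν v) :
    LinearIndependent ℝ (Fin.snoc (fun i => (ν.frame i : E n)) v : Fin (_ + 1) → E n) ∧
    Submodule.span ℝ (Set.range (Fin.snoc (fun i => (ν.frame i : E n)) v : Fin (_ + 1) → E n)) =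
      vectorSpan ℝ σ ∧
    (μ.toExt = ν.scale • ExteriorAlgebra.ιMulti ℝ _ (Fin.snoc (fun i => (ν.frame i : E n)) v) ∨
      μ.toExt =
        -(ν.scale • ExteriorAlgebra.ιMulti ℝ _ (Fin.snoc (fun i => (ν.frame i : E n)) v))) := by
  have h3 : (μ.toExt =
      ν.scale • ExteriorAlgebra.ιMulti ℝ _ (Fin.snoc (fun i => (ν.frame i : E n)) v) ∨
      μ.toExt =
        -(ν.scale • ExteriorAlgebra.ιMulti ℝ _ (Fin.snoc (fun i => (ν.frame i : E n)) v))) := by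
    rw [ιMulti_snoc, ← smul_mul_assoc]
    exact hv.1
  have h1 : LinearIndependent ℝ
      (Fin.snoc (fun i => (ν.frame i : E n)) v : Fin (_ + 1) → E n) := by
    by_contra hcon
    have h0 := AlternatingMap.map_linearDependent (ExteriorAlgebra.ιMulti ℝ _) _ hcon
    rw [h0, smul_zero, neg_zero, or_self] at h3
    exact toExt_ne_zero μ h3
  have hle : vectorSpan ℝ τ ≤ vectorSpan ℝ σ := vectorSpan_mono ℝ hf.1.subset
  have hvσ : v ∈ vectorSpan ℝ σ := by
    obtain ⟨c, -, x, hx, y, hy, hxy⟩ := hv.2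
    have h4 := hle hxy
    have h5 := (vectorSpan ℝ σ).smul_mem c (sub_mem_vectorSpan hx (hf.1.subset hy))
    simpa using (vectorSpan ℝ σ).add_mem h4 h5
  refine ⟨h1, ?_, h3⟩
  refine Submodule.eq_of_le_of_finrank_eq ?_ ?_
  · rw [Submodule.span_le]
    rintro _ ⟨i, rfl⟩
    induction i using Fin.lastCases with
    | last => simpa using hvσ
    | cast i => simpa using hle (ν.frame i).2
  · rw [finrank_span_eq_card h1, Fintype.card_fin]
    exact hf.2

theorem exists_isNormalVector (hf : IsFacet τ σ) (μ : Weight (vectorSpan ℝ σ))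
    (ν : Weight (vectorSpan ℝ τ)) : ∃ v, IsNormalVector μ ν v := by
  obtain ⟨x, hxσ, hxτ⟩ := hf.exists_mem_diff
  obtain ⟨y, hy⟩ := hf.1.1
  have hnot : x - y ∉ vectorSpan ℝ τ := fun h =>
    hxτ (hf.1.mem_of_mem_affineSpan hxσ ((mem_affineSpan_iff hy).2 h))
  have hle : vectorSpan ℝ τ ≤ vectorSpan ℝ σ := vectorSpan_mono ℝ hf.1.subset
  have hli : LinearIndependent ℝ
      (Fin.snoc (fun i => (ν.frame i : E n)) (x - y) : Fin (_ + 1) → E n) := by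
    rw [linearIndependent_finSnoc]
    exact ⟨frame_linearIndependent ν, by rwa [span_frame]⟩
  have hspan : Submodule.span ℝ (Set.range
      (Fin.snoc (fun i => (ν.frame i : E n)) (x - y) : Fin (_ + 1) → E n)) = vectorSpan ℝ σ := by
    refine Submodule.eq_of_le_of_finrank_eq ?_ ?_
    · rw [Submodule.span_le]
      rintro _ ⟨i, rfl⟩
      induction i using Fin.lastCases with
      | last => simpa using sub_mem_vectorSpan hxσ (hf.1.subset hy)
      | cast i => simpa using hle (ν.frame i).2
    · rw [finrank_span_eq_card hli, Fintype.card_fin]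
      exact hf.2
  obtain ⟨c, hc, hc2⟩ := exists_toExt_eq μ hli hspan
  -- Any `x - y` with `x ∈ σ` off `τ` and `y ∈ τ` has the right direction; the positive factor
  -- adjusts its length to the two weights.
  refine ⟨(c / ν.scale) • (x - y), ?_, c / ν.scale, div_pos hc ν.scale_pos, x, hxσ, y, hy, by simp⟩
  have h5 : ν.toExt * ExteriorAlgebra.ι ℝ ((c / ν.scale) • (x - y)) =
      c • ExteriorAlgebra.ιMulti ℝ _ (Fin.snoc (fun i => (ν.frame i : E n)) (x - y)) := by
    rw [ιMulti_snoc, Weight.toExt, map_smul, smul_mul_smul_comm,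
      mul_div_cancel₀ _ ν.scale_pos.ne']
  rw [h5]
  exact hc2

theorem exists_weight (N : Submodule ℝ (E n)) : Nonempty (Weight N) :=
  ⟨1, one_pos, Module.finBasis ℝ N⟩

/-! ## Relative interiors -/

/-- `x` is in the relative interior of `σ`. -/
def InRelint (x : E n) (σ : Set (E n)) : Prop :=
  x ∈ σ ∧ ∃ ε : ℝ, 0 < ε ∧ ∀ y ∈ affineSpan ℝ σ, dist y x < ε → y ∈ σ

theorem exists_inRelint (hσ : Convex ℝ σ) (hne : σ.Nonempty) : ∃ x, InRelint x σ := by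
  obtain ⟨x, hx⟩ := Set.Nonempty.intrinsicInterior hσ hne
  obtain ⟨y, hy, rfl⟩ := mem_intrinsicInterior.1 hx
  refine ⟨y, intrinsicInterior_subset hx, ?_⟩
  rw [mem_interior_iff_mem_nhds, Metric.mem_nhds_iff] at hy
  obtain ⟨ε, hε, hy⟩ := hy
  exact ⟨ε, hε, fun z hz hd => hy (a := ⟨z, hz⟩) (by simpa [Subtype.dist_eq] using hd)⟩

/-- A segment in `σ` can be prolonged beyond a point of the relative interior. -/
theorem InRelint.exists_prolong {x y : E n} (hx : InRelint x σ) (hy : y ∈ affineSpan ℝ σ) :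
    ∃ t : ℝ, 0 < t ∧ x + t • (x - y) ∈ σ := by
  obtain ⟨hxσ, ε, hε, h⟩ := hx
  refine ⟨ε / (2 * (‖x - y‖ + 1)), by positivity, h _ ?_ ?_⟩
  · have h1 : x - y ∈ vectorSpan ℝ σ := by
      rw [← direction_affineSpan]
      exact AffineSubspace.vsub_mem_direction (mem_affineSpan ℝ hxσ) hy
    rw [mem_affineSpan_iff hxσ, add_sub_cancel_left]
    exact Submodule.smul_mem _ _ h1
  · rw [dist_eq_norm, add_sub_cancel_left, norm_smul, Real.norm_of_nonneg (by positivity)]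
    have : 0 ≤ ‖x - y‖ := norm_nonneg _
    rw [div_mul_eq_mul_div, div_lt_iff₀ (by positivity)]
    nlinarith

/-- A linear form on `σ` that is maximal at a point of the relative interior is constant. -/
theorem InRelint.eq_of_le {x : E n} (hx : InRelint x σ) {l : Module.Dual ℝ (E n)}
    (hl : ∀ y ∈ σ, l y ≤ l x) {y : E n} (hy : y ∈ σ) : l y = l x := by
  obtain ⟨t, ht, h⟩ := hx.exists_prolong (mem_affineSpan ℝ hy)
  have h1 := hl _ h
  simp only [map_add, map_smul, map_sub, smul_eq_mul] at h1
  have h2 : t * (l x - l y) ≤ 0 := by linarith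
  have h3 : l x - l y ≤ 0 := by
    by_contra hcon
    push Not at hcon
    have := mul_pos ht hcon
    linarith
  linarith [hl y hy]

theorem IsFace.eq_of_inRelint {x : E n} (hf : IsFace τ σ) (hx : InRelint x σ) (hxτ : x ∈ τ) :
    τ = σ := by
  obtain ⟨-, l, m, hl, hτ⟩ := isFace_iff.1 hf
  refine hf.subset.antisymm fun y hy => ?_
  rw [hτ] at hxτ ⊢
  refine ⟨hy, ?_⟩
  rw [hx.eq_of_le (fun z hz => by rw [hxτ.2]; exact hl z hz) hy, hxτ.2]

/-! ## Half-spaces -/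

/-- In its affine span, `σ` is described by the half-spaces in `H`. -/
def Describes (H : Finset (Module.Dual ℝ (E n) × ℝ)) (σ : Set (E n)) : Prop :=
  ∀ x ∈ affineSpan ℝ σ, x ∈ σ ↔ ∀ h ∈ H, h.1 x ≤ h.2

/-- A description of a polyhedron by half-spaces with boundaries that are pairwise distinct
hyperplanes of the affine span. -/
structure IsReduced (H : Finset (Module.Dual ℝ (E n) × ℝ)) (σ : Set (E n)) : Prop where
  describes : Describes H σ
  nonconst : ∀ h ∈ H, ∃ v ∈ vectorSpan ℝ σ, h.1 v ≠ 0
  distinct : ∀ h ∈ H, ∀ k ∈ H, h ≠ k → ∃ x ∈ affineSpan ℝ σ, h.1 x = h.2 ∧ k.1 x ≠ k.2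

/-- A description with the fewest half-spaces is reduced. A half-space that is constant on the
affine span could be dropped. If the boundary of `h` lies in that of `k`, then `k` is a multiple `c`
of `h` as an affine function: for `c ≥ 0` the half-space `k` is redundant, and for `c < 0` the
polyhedron would lie in the boundary of `h`. -/
theorem IsPolyhedron.exists_isReduced (hσ : IsPolyhedron σ) :
    ∃ H, IsReduced H σ := by
  classical
  have hex : ∃ m : ℕ, ∃ H : Finset (Module.Dual ℝ (E n) × ℝ), H.card = m ∧ Describes H σ := by
    obtain ⟨-, H, hH⟩ := hσ
    refine ⟨_, H, rfl, fun x _ => ?_⟩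
    rw [hH]; rfl
  obtain ⟨H, hcard, hH⟩ := Nat.find_spec hex
  have hmin : ∀ h ∈ H, ¬ Describes (H.erase h) σ := fun h hh hd =>
    Nat.find_min hex (m := (H.erase h).card) (by rw [← hcard]; exact Finset.card_erase_lt_of_mem hh)
      ⟨_, rfl, hd⟩
  obtain ⟨x₀, hx₀⟩ := hσ.1
  have herase : ∀ h ∈ H, (∀ x ∈ affineSpan ℝ σ, (∀ k ∈ H.erase h, k.1 x ≤ k.2) → h.1 x ≤ h.2) →
      False := by
    intro h hh hx
    refine hmin h hh fun x hxA => ?_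
    rw [hH x hxA]
    constructor
    · intro h1 k hk; exact h1 k (Finset.mem_of_mem_erase hk)
    · intro h1 k hk
      by_cases hkh : k = h
      · subst hkh; exact hx x hxA h1
      · exact h1 k (Finset.mem_erase.2 ⟨hkh, hk⟩)
  have hnc : ∀ h ∈ H, ∃ v ∈ vectorSpan ℝ σ, h.1 v ≠ 0 := by
    intro h hh
    by_contra! hcon
    refine herase h hh fun x hxA _ => ?_
    have h1 := hcon _ ((mem_affineSpan_iff hx₀).1 hxA)
    rw [map_sub, sub_eq_zero] at h1
    rw [h1]
    exact (hH x₀ (mem_affineSpan ℝ hx₀)).1 hx₀ h hh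
  refine ⟨H, hH, hnc, fun h hh k hk hne => ?_⟩
  by_contra! hcon
  obtain ⟨v, hv, hhv⟩ := hnc h hh
  obtain ⟨c, hc⟩ : ∃ c : ℝ, ∀ x ∈ affineSpan ℝ σ, k.1 x - k.2 = c * (h.1 x - h.2) := by
    refine ⟨k.1 v / h.1 v, fun x hx => ?_⟩
    -- Moving `x` along `v` onto the boundary of `h` makes `k` an equality as well, which determines
    -- the ratio.
    have h1 : x - ((h.1 x - h.2) / h.1 v) • v ∈ affineSpan ℝ σ := by
      rw [mem_affineSpan_iff hx₀] at hx ⊢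
      have := Submodule.sub_mem _ hx (Submodule.smul_mem _ ((h.1 x - h.2) / h.1 v) hv)
      convert this using 1
      abel
    have h2 := hcon _ h1 (by simp [hhv])
    simp only [map_sub, map_smul, smul_eq_mul] at h2
    rw [← h2]
    field_simp
    ring
  have hhx₀ := (hH x₀ (mem_affineSpan ℝ hx₀)).1 hx₀
  rcases lt_or_ge 0 c with hcpos | hcneg
  · refine herase k hk fun x hxA hx => ?_
    have h1 := hx h (Finset.mem_erase.2 ⟨hne, hh⟩)
    have h2 := hc x hxA
    nlinarith
  · have hsub : ∀ x ∈ σ, h.1 x = h.2 ∨ c = 0 := by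
      intro x hx
      by_cases hc0 : c = 0
      · exact Or.inr hc0
      · left
        have hcneg' : c < 0 := lt_of_le_of_ne hcneg hc0
        have h1 := (hH x (mem_affineSpan ℝ hx)).1 hx
        have h2 := h1 h hh
        have h3 := h1 k hk
        have h4 := hc x (mem_affineSpan ℝ hx)
        nlinarith
    by_cases hc0 : c = 0
    · refine herase k hk fun x hxA _ => ?_
      have := hc x hxA
      rw [hc0] at this
      linarith
    · apply hhv
      refine eq_zero_of_mem_vectorSpan (σ := σ) (fun x hx y hy => ?_) hv
      rw [(hsub x hx).resolve_right hc0, (hsub y hy).resolve_right hc0]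

/-- The part of `σ` in the boundary hyperplane of a half-space. -/
def wall (σ : Set (E n)) (h : Module.Dual ℝ (E n) × ℝ) : Set (E n) := {x ∈ σ | h.1 x = h.2}

theorem IsReduced.isFace_wall {H : Finset (Module.Dual ℝ (E n) × ℝ)} (hH : IsReduced H σ)
    {h : Module.Dual ℝ (E n) × ℝ} (hh : h ∈ H) (hne : (wall σ h).Nonempty) :
    IsFace (wall σ h) σ :=
  isFace_iff.2 ⟨hne, h.1, h.2,
    fun x hx => (hH.describes x (mem_affineSpan ℝ hx)).1 hx h hh, rfl⟩

/-- The direction of a boundary hyperplane. -/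
theorem finrank_ker_inf {N : Submodule ℝ (E n)} {l : Module.Dual ℝ (E n)}
    (hl : ∃ v ∈ N, l v ≠ 0) :
    Module.finrank ℝ (LinearMap.ker l ⊓ N : Submodule ℝ (E n)) + 1 = Module.finrank ℝ N := by
  obtain ⟨v, hv, hlv⟩ := hl
  have h1 : (LinearMap.ker l ⊓ N) ⊔ Submodule.span ℝ {v} = N := by
    apply le_antisymm
    · refine sup_le inf_le_right ?_
      rw [Submodule.span_singleton_le_iff_mem]; exact hv
    · intro w hw
      rw [Submodule.mem_sup]
      refine ⟨w - (l w / l v) • v, ⟨by simp [hlv], N.sub_mem hw (N.smul_mem _ hv)⟩,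
        (l w / l v) • v, Submodule.smul_mem _ _ (Submodule.mem_span_singleton_self v), by simp⟩
  have h2 : (LinearMap.ker l ⊓ N) ⊓ Submodule.span ℝ {v} = ⊥ := by
    rw [eq_bot_iff]
    rintro w ⟨⟨hw, -⟩, hw2⟩
    obtain ⟨a, rfl⟩ := Submodule.mem_span_singleton.1 hw2
    simp only [SetLike.mem_coe, LinearMap.mem_ker, map_smul, smul_eq_mul, mul_eq_zero] at hw
    simp [hw.resolve_right hlv]
  have h3 := Submodule.finrank_sup_add_finrank_inf_eq (LinearMap.ker l ⊓ N) (Submodule.span ℝ {v})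
  rw [h1, h2, finrank_bot, add_zero, finrank_span_singleton (fun h => hlv (by simp [h]))] at h3
  exact h3.symm

theorem vectorSpan_wall_le (σ : Set (E n)) (h : Module.Dual ℝ (E n) × ℝ) :
    vectorSpan ℝ (wall σ h) ≤ LinearMap.ker h.1 ⊓ vectorSpan ℝ σ := by
  refine le_inf (fun v hv => ?_) (vectorSpan_mono ℝ fun x hx => hx.1)
  exact eq_zero_of_mem_vectorSpan (fun x hx y hy => by rw [hx.2, hy.2]) hv

theorem IsReduced.vectorSpan_wall {H : Finset (Module.Dual ℝ (E n) × ℝ)} (hH : IsReduced H σ)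
    {h : Module.Dual ℝ (E n) × ℝ} (hh : h ∈ H) (hf : IsFacet (wall σ h) σ) :
    vectorSpan ℝ (wall σ h) = LinearMap.ker h.1 ⊓ vectorSpan ℝ σ := by
  refine Submodule.eq_of_le_of_finrank_eq (vectorSpan_wall_le σ h) ?_
  have h1 := finrank_ker_inf (hH.nonconst h hh)
  exact Nat.add_right_cancel (hf.2.trans h1.symm)

/-- The facets are exactly the walls of the right dimension. -/
theorem IsReduced.exists_wall_eq {H : Finset (Module.Dual ℝ (E n) × ℝ)} (hH : IsReduced H σ)
    (hσ : Convex ℝ σ) (hf : IsFacet τ σ) : ∃ h ∈ H, wall σ h = τ := by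
  obtain ⟨x, hx⟩ := exists_inRelint (hf.1.convex hσ) hf.1.1
  obtain ⟨-, l, m, hl, hτ⟩ := isFace_iff.1 hf.1
  have hxσ : x ∈ σ := hf.1.subset hx.1
  have hle := (hH.describes x (mem_affineSpan ℝ hxσ)).1 hxσ
  -- If no inequality were tight at `x`, a segment from a point `z` of `σ` off `τ` could be
  -- prolonged beyond `x` inside `σ`, and `l` would exceed its maximum `m` there.
  have h1 : ∃ h ∈ H, h.1 x = h.2 := by
    by_contra! hcon
    obtain ⟨z, hzσ, hzτ⟩ := hf.exists_mem_diff
    have hlt : ∀ h ∈ H, h.1 x < h.2 := fun h hh => lt_of_le_of_ne (hle h hh) (hcon h hh)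
    have hev : ∀ᶠ t : ℝ in nhdsWithin 0 (Set.Ioi 0), ∀ h ∈ H, h.1 (x + t • (x - z)) < h.2 := by
      rw [Filter.eventually_all_finset]
      intro h hh
      apply Filter.Tendsto.eventually_lt_const (hlt h hh)
      have : Filter.Tendsto (fun t : ℝ => h.1 (x + t • (x - z))) (nhds 0)
          (nhds (h.1 (x + (0 : ℝ) • (x - z)))) := by
        apply Continuous.tendsto
        exact (continuous_dual h.1).comp (by fun_prop)
      simp only [zero_smul, add_zero] at this
      exact this.mono_left nhdsWithin_le_nhds
    obtain ⟨t, ht, ht0⟩ := (hev.and self_mem_nhdsWithin).exists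
    have hmem : x + t • (x - z) ∈ σ := by
      refine (hH.describes _ ?_).2 fun h hh => (ht h hh).le
      rw [mem_affineSpan_iff hxσ, add_sub_cancel_left]
      exact Submodule.smul_mem _ _ (sub_mem_vectorSpan hxσ hzσ)
    have h2 := hl _ hmem
    have hx2 : l x = m := by have := hx.1; rw [hτ] at this; exact this.2
    have hz2 : l z < m := lt_of_le_of_ne (hl z hzσ) fun h => hzτ (by rw [hτ]; exact ⟨hzσ, h⟩)
    simp only [map_add, map_smul, map_sub, smul_eq_mul] at h2
    have h3 : 0 < t * (l x - l z) := mul_pos ht0 (by linarith)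
    linarith
  obtain ⟨h, hh, hhx⟩ := h1
  have hsub : ∀ y ∈ τ, h.1 y = h.2 := by
    intro y hy
    rw [← hhx]
    refine hx.eq_of_le (fun z hz => ?_) hy
    have hzσ := hf.1.subset hz
    rw [hhx]
    exact (hH.describes z (mem_affineSpan ℝ hzσ)).1 hzσ h hh
  refine ⟨h, hh, Set.Subset.antisymm ?_ fun y hy => ⟨hf.1.subset hy, hsub y hy⟩⟩
  rintro y ⟨hyσ, hy⟩
  refine hf.1.mem_of_mem_affineSpan hyσ ((mem_affineSpan_iff hx.1).2 ?_)
  have h4 : vectorSpan ℝ τ = LinearMap.ker h.1 ⊓ vectorSpan ℝ σ := by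
    refine Submodule.eq_of_le_of_finrank_eq
      (le_inf (fun v hv => ?_) (vectorSpan_mono ℝ hf.1.subset)) ?_
    · exact eq_zero_of_mem_vectorSpan (fun x hx y hy => by rw [hsub x hx, hsub y hy]) hv
    · have h1 := finrank_ker_inf (hH.nonconst h hh)
      exact Nat.add_right_cancel (hf.2.trans h1.symm)
  rw [h4]
  exact ⟨by simp [hy, hhx], sub_mem_vectorSpan hyσ hxσ⟩

/-- A wall that is a facet spans the whole boundary hyperplane in the affine span, so equal walls
would put the boundary of `h` inside that of `k`, against `distinct`. -/
theorem IsReduced.wall_injOn {H : Finset (Module.Dual ℝ (E n) × ℝ)} (hH : IsReduced H σ)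
    {h k : Module.Dual ℝ (E n) × ℝ} (hh : h ∈ H) (hk : k ∈ H) (hf : IsFacet (wall σ h) σ)
    (heq : wall σ h = wall σ k) : h = k := by
  by_contra hne
  obtain ⟨x, hx, hx1, hx2⟩ := hH.distinct h hh k hk hne
  obtain ⟨y, hy⟩ := hf.1.1
  have hyk : y ∈ wall σ k := heq ▸ hy
  have h1 : x - y ∈ vectorSpan ℝ (wall σ h) := by
    rw [hH.vectorSpan_wall hh hf]
    exact ⟨by simp [hx1, hy.2], (mem_affineSpan_iff hy.1).1 hx⟩
  rw [heq] at h1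
  have h2 := (vectorSpan_wall_le σ k h1).1
  simp only [SetLike.mem_coe, LinearMap.mem_ker, map_sub, sub_eq_zero] at h2
  exact hx2 (h2.trans hyk.2)

end Geometry

end DeltaForm

end

noncomputable section

namespace DeltaForm

open scoped ContDiff
open MeasureTheory Filter Topology

/-! ## Analysis on affine frames -/

section Frames

variable {n d : ℕ}

/-- The affine parametrization `t ↦ x₀ + ∑ tᵢ bᵢ`. -/
def affFrame (x₀ : E n) (b : Fin d → E n) : (Fin d → ℝ) →ᵃ[ℝ] E n :=
  AffineMap.const ℝ _ x₀ + (Fintype.linearCombination ℝ b).toAffineMap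

theorem affFrame_apply (x₀ : E n) (b : Fin d → E n) (t : Fin d → ℝ) :
    affFrame x₀ b t = x₀ + ∑ i, t i • b i := by
  simp [affFrame, Fintype.linearCombination_apply]

theorem volume_preimage_affineSubspace {V : Type*} [AddCommGroup V] [Module ℝ V]
    (f : (Fin d → ℝ) →ᵃ[ℝ] V) (S : AffineSubspace ℝ V) {t : Fin d → ℝ} (ht : f t ∉ S) :
    volume (f ⁻¹' (S : Set V)) = 0 := by
  have h := Measure.addHaar_affineSubspace (volume : Measure (Fin d → ℝ)) (S.comap f) (by
    intro h
    apply ht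
    have : t ∈ S.comap f := h ▸ AffineSubspace.mem_top ℝ _ t
    exact this)
  exact h

theorem volume_affine_eq_zero (f : (Fin d → ℝ) →ᵃ[ℝ] ℝ) {t : Fin d → ℝ} (ht : f t ≠ 0) :
    volume {t | f t = 0} = 0 := by
  have h := volume_preimage_affineSubspace f (AffineSubspace.mk' (0 : ℝ) ⊥) (t := t) (by simpa)
  have h2 : {t | f t = 0} = f ⁻¹' ((AffineSubspace.mk' (0 : ℝ) ⊥ : AffineSubspace ℝ ℝ) : Set ℝ) := by
    ext t; simp
  rw [h2]; exact h

theorem isClosedEmbedding_frame (x₀ : E n) {b : Fin d → E n} (hb : LinearIndependent ℝ b) :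
    IsClosedEmbedding (fun t : Fin d → ℝ => x₀ + ∑ i, t i • b i) := by
  have h1 : IsClosedEmbedding (Fintype.linearCombination ℝ b) :=
    LinearMap.isClosedEmbedding_of_injective (LinearMap.ker_eq_bot.2
      (linearIndependent_iff_injective_fintypeLinearCombination.1 hb))
  exact (Homeomorph.addLeft x₀).isClosedEmbedding.comp h1

theorem integrable_frame (x₀ : E n) {b : Fin d → E n} (hb : LinearIndependent ℝ b) {f : E n → ℝ}
    (hf : Continuous f) (hc : HasCompactSupport f) :
    Integrable (fun t : Fin d → ℝ => f (x₀ + ∑ i, t i • b i)) := by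
  have he := isClosedEmbedding_frame x₀ hb
  exact (hf.comp he.continuous).integrable_of_hasCompactSupport (hc.comp_isClosedEmbedding he)

end Frames

/-! ## Thin slabs -/

section Slab

local notation "χ" => Real.smoothTransition

theorem smoothTransition_hasDerivAt (x : ℝ) : HasDerivAt χ (deriv χ x) x :=
  ((Real.smoothTransition.contDiff (n := 1)).differentiable (by simp)).differentiableAt.hasDerivAt

theorem continuous_deriv_smoothTransition : Continuous (deriv χ) :=
  (Real.smoothTransition.contDiff (n := 1)).continuous_deriv (by simp)

theorem deriv_smoothTransition_eq_zero {x : ℝ} (hx : x ∉ Set.Icc (0 : ℝ) 1) : deriv χ x = 0 := by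
  rw [Set.mem_Icc, not_and_or, not_le, not_le] at hx
  rcases hx with hx | hx
  · have : χ =ᶠ[𝓝 x] fun _ => 0 := by
      filter_upwards [Iio_mem_nhds hx] with y hy
      exact Real.smoothTransition.zero_of_nonpos (le_of_lt hy)
    rw [this.deriv_eq, deriv_const]
  · have : χ =ᶠ[𝓝 x] fun _ => 1 := by
      filter_upwards [Ioi_mem_nhds hx] with y hy
      exact Real.smoothTransition.one_of_one_le (le_of_lt hy)
    rw [this.deriv_eq, deriv_const]

theorem hasCompactSupport_deriv_smoothTransition : HasCompactSupport (deriv χ) :=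
  HasCompactSupport.intro isCompact_Icc fun _ hx => deriv_smoothTransition_eq_zero hx

theorem integral_deriv_smoothTransition : ∫ x, deriv χ x = 1 := by
  have h := integral_of_hasDerivAt_of_tendsto (f := χ) (m := 0) (n := 1)
    smoothTransition_hasDerivAt
    (continuous_deriv_smoothTransition.integrable_of_hasCompactSupport
      hasCompactSupport_deriv_smoothTransition)
    (tendsto_const_nhds.congr' (by
      filter_upwards [eventually_le_atBot 0] with x hx
      exact (Real.smoothTransition.zero_of_nonpos hx).symm))
    (tendsto_const_nhds.congr' (by
      filter_upwards [eventually_ge_atTop 1] with x hx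
      exact (Real.smoothTransition.one_of_one_le hx).symm))
  simpa using h

theorem tendsto_smoothTransition_mul {a : ℝ} (ha : a ≠ 0) (c : ℝ) :
    ∀ᶠ k : ℕ in atTop, χ (((k : ℝ) + 1) * a + c) = if 0 ≤ a then 1 else 0 := by
  have h1 : Tendsto (fun k : ℕ => (k : ℝ) + 1) atTop atTop :=
    tendsto_atTop_add_const_right _ _ tendsto_natCast_atTop_atTop
  rcases lt_or_gt_of_ne ha with h | h
  · have h2 : Tendsto (fun k : ℕ => ((k : ℝ) + 1) * a + c) atTop atBot :=
      tendsto_atBot_add_const_right _ _ (h1.atTop_mul_const_of_neg h)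
    filter_upwards [h2.eventually (eventually_le_atBot 0)] with k hk
    rw [Real.smoothTransition.zero_of_nonpos hk, if_neg (not_le.2 h)]
  · have h2 : Tendsto (fun k : ℕ => ((k : ℝ) + 1) * a + c) atTop atTop :=
      tendsto_atTop_add_const_right _ _ (h1.atTop_mul_const h)
    filter_upwards [h2.eventually (eventually_ge_atTop 1)] with k hk
    rw [Real.smoothTransition.one_of_one_le hk, if_pos h.le]

theorem eventually_prod_smoothTransition {ι : Type*} (J : Finset ι) (a c : ι → ℝ)
    (ha : ∀ j ∈ J, a j ≠ 0) :
    ∀ᶠ k : ℕ in atTop, ∏ j ∈ J, χ (((k : ℝ) + 1) * a j + c j) =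
      (open scoped Classical in if ∀ j ∈ J, 0 ≤ a j then (1 : ℝ) else 0) := by
  classical
  have h : ∀ᶠ k : ℕ in atTop, ∀ j ∈ J, χ (((k : ℝ) + 1) * a j + c j) = if 0 ≤ a j then 1 else 0 := by
    rw [eventually_all_finset]
    exact fun j hj => tendsto_smoothTransition_mul (ha j hj) (c j)
  filter_upwards [h] with k hk
  rw [Finset.prod_congr rfl hk]
  split_ifs with hj
  · exact Finset.prod_eq_one fun j hjJ => if_pos (hj j hjJ)
  · push Not at hj
    obtain ⟨j, hjJ, hj⟩ := hj
    exact Finset.prod_eq_zero hjJ (if_neg (not_le.2 hj))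

theorem prod_smoothTransition_mem {ι : Type*} (J : Finset ι) (a : ι → ℝ) :
    0 ≤ ∏ j ∈ J, χ (a j) ∧ ∏ j ∈ J, χ (a j) ≤ 1 :=
  ⟨Finset.prod_nonneg fun _ _ => Real.smoothTransition.nonneg _,
    Finset.prod_le_one (fun _ _ => Real.smoothTransition.nonneg _)
      fun _ _ => Real.smoothTransition.le_one _⟩

/-- Here `z.1` is the coordinate transverse to a wall and `z.2` runs along it. The substitution `s ↦
s / (k + 1)` absorbs the factor `k + 1` and leaves `χ'(κ s)`, of integral `κ⁻¹`. The remaining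
cut-offs become, for almost every `t`, the indicator of the part of the wall they bound; the shift
`q j * z.1` stays bounded and has no influence. -/
theorem tendsto_slab {e : ℕ} {ι : Type*} (J : Finset ι) (p : ι → (Fin e → ℝ) → ℝ)
    (hp : ∀ j, Continuous (p j)) (q : ι → ℝ) (hnull : ∀ j ∈ J, volume {t | p j t = 0} = 0)
    (g : ℝ × (Fin e → ℝ) → ℝ) (hg : Continuous g) (hgc : HasCompactSupport g) {κ : ℝ}
    (hκ : 0 < κ) :
    Tendsto (fun k : ℕ => ∫ z : ℝ × (Fin e → ℝ), ((k : ℝ) + 1) *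
        (deriv χ (((k : ℝ) + 1) * (κ * z.1)) *
          (∏ j ∈ J, χ (((k : ℝ) + 1) * (p j z.2 + q j * z.1))) * g z)) atTop
      (𝓝 (κ⁻¹ * ∫ t, {t | ∀ j ∈ J, 0 ≤ p j t}.indicator (fun t => g (0, t)) t)) := by
  classical
  have hdc := continuous_deriv_smoothTransition
  have hχ := Real.smoothTransition.continuous
  obtain ⟨R, hR⟩ := hgc.isCompact.isBounded.subset_closedBall 0
  have hgR : ∀ z, g z ≠ 0 → ‖z‖ ≤ R := fun z hz => by
    simpa using hR (subset_tsupport g hz)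
  obtain ⟨C, hC⟩ := hdc.bounded_above_of_compact_support hasCompactSupport_deriv_smoothTransition
  obtain ⟨D, hD⟩ := hg.bounded_above_of_compact_support hgc
  -- rescaling
  let G : ℕ → ℝ × (Fin e → ℝ) → ℝ := fun k z => deriv χ (κ * z.1) *
    (∏ j ∈ J, χ (((k : ℝ) + 1) * p j z.2 + q j * z.1)) * g (z.1 / ((k : ℝ) + 1), z.2)
  have hGc : ∀ k, Continuous (G k) := by
    intro k
    refine ((hdc.comp (by fun_prop)).mul (continuous_finsetProd _ fun j _ => ?_)).mul
      (hg.comp (by fun_prop))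
    exact hχ.comp ((continuous_const.mul ((hp j).comp continuous_snd)).add (by fun_prop))
  -- The majorant is independent of `k`: the factor `χ'(κ s)` confines `s` to `[0, 1 / κ]`, and the
  -- support of `g` confines `t` to the ball of radius `R`.
  have hGbd : ∀ k z, ‖G k z‖ ≤
      (Metric.closedBall (0 : ℝ × (Fin e → ℝ)) (max (1 / κ) R)).indicator (fun _ => C * D) z := by
    intro k z
    have hk : (1 : ℝ) ≤ (k : ℝ) + 1 := by simp
    by_cases hz : z ∈ Metric.closedBall (0 : ℝ × (Fin e → ℝ)) (max (1 / κ) R)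
    · rw [Set.indicator_of_mem hz]
      have h2 := prod_smoothTransition_mem J (fun j => ((k : ℝ) + 1) * p j z.2 + q j * z.1)
      simp only [G, norm_mul]
      have h3 : ‖∏ j ∈ J, χ (((k : ℝ) + 1) * p j z.2 + q j * z.1)‖ ≤ 1 := by
        rw [Real.norm_of_nonneg h2.1]; exact h2.2
      calc _ ≤ C * 1 * D := by
            refine mul_le_mul (mul_le_mul (hC _) h3 (norm_nonneg _) ?_) (hD _) (norm_nonneg _) ?_
            · exact (norm_nonneg _).trans (hC 0)
            · exact mul_nonneg ((norm_nonneg _).trans (hC 0)) zero_le_one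
        _ = C * D := by ring
    · rw [Set.indicator_of_notMem hz]
      have hz' : max (1 / κ) R < ‖z‖ := by simpa using hz
      have : G k z = 0 := by
        by_cases h1 : κ * z.1 ∈ Set.Icc (0 : ℝ) 1
        · have h4 : ‖z.1‖ ≤ 1 / κ := by
            have h5 : 0 ≤ z.1 := by
              have := h1.1
              by_contra hcon; push Not at hcon
              have := mul_neg_of_pos_of_neg hκ hcon
              linarith
            rw [Real.norm_of_nonneg h5, le_div_iff₀ hκ, mul_comm]; exact h1.2
          have h6 : max (1 / κ) R < ‖z.2‖ := by
            rw [Prod.norm_def, lt_max_iff] at hz'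
            exact hz'.resolve_left (not_lt.2 (h4.trans (le_max_left _ _)))
          have h7 : g (z.1 / ((k : ℝ) + 1), z.2) = 0 := by
            by_contra hcon
            have h8 := hgR _ hcon
            rw [Prod.norm_def] at h8
            have h9 := (le_max_right _ _).trans h8
            exact absurd (h6.trans_le h9) (not_lt.2 (le_max_right _ _))
          simp [G, h7]
        · simp [G, deriv_smoothTransition_eq_zero h1]
      rw [this, norm_zero]
  have hbdI : Integrable ((Metric.closedBall (0 : ℝ × (Fin e → ℝ)) (max (1 / κ) R)).indicator
      (fun _ => C * D)) := by
    rw [integrable_indicator_iff Metric.isClosed_closedBall.measurableSet]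
    exact integrableOn_const (isCompact_closedBall _ _).measure_lt_top.ne
  have hGI : ∀ k, Integrable (G k) := fun k =>
    hbdI.mono' (hGc k).aestronglyMeasurable (ae_of_all _ (hGbd k))
  have hscale : ∀ k : ℕ, ∫ z : ℝ × (Fin e → ℝ), ((k : ℝ) + 1) *
        (deriv χ (((k : ℝ) + 1) * (κ * z.1)) *
          (∏ j ∈ J, χ (((k : ℝ) + 1) * (p j z.2 + q j * z.1))) * g z) = ∫ z, G k z := by
    intro k
    have hk : (0 : ℝ) < (k : ℝ) + 1 := by positivity
    have hFI : Integrable (fun z : ℝ × (Fin e → ℝ) => (deriv χ (((k : ℝ) + 1) * (κ * z.1)) *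
          (∏ j ∈ J, χ (((k : ℝ) + 1) * (p j z.2 + q j * z.1))) * g z)) := by
      refine Continuous.integrable_of_hasCompactSupport ?_ hgc.mul_left
      refine ((hdc.comp (by fun_prop)).mul (continuous_finsetProd _ fun j _ => ?_)).mul hg
      exact hχ.comp (continuous_const.mul (((hp j).comp continuous_snd).add (by fun_prop)))
    rw [integral_const_mul]
    rw [Measure.volume_eq_prod] at hFI ⊢
    have hGI' := hGI k
    rw [Measure.volume_eq_prod] at hGI'
    rw [integral_prod _ hFI, integral_prod _ hGI']
    have h1 := Measure.integral_comp_div (fun s : ℝ => ∫ t : Fin e → ℝ,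
      (deriv χ (((k : ℝ) + 1) * (κ * s)) *
          (∏ j ∈ J, χ (((k : ℝ) + 1) * (p j t + q j * s))) * g (s, t))) ((k : ℝ) + 1)
    rw [abs_of_pos hk, smul_eq_mul] at h1
    rw [← h1]
    congr 1
    funext s
    congr 1
    funext t
    simp only [G]
    congr 2
    · congr 1; field_simp
    · refine Finset.prod_congr rfl fun j _ => ?_
      congr 1; field_simp
  simp only [hscale]
  have hlim : ∀ᵐ z : ℝ × (Fin e → ℝ), Tendsto (fun k => G k z) atTop
      (𝓝 (deriv χ (κ * z.1) * {t | ∀ j ∈ J, 0 ≤ p j t}.indicator (fun t => g (0, t)) z.2)) := by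
    have hae : ∀ᵐ t : Fin e → ℝ, ∀ j ∈ J, p j t ≠ 0 := by
      rw [eventually_all_finset]
      exact fun j hj => measure_eq_zero_iff_ae_notMem.1 (hnull j hj)
    have hae2 : ∀ᵐ z : ℝ × (Fin e → ℝ), ∀ j ∈ J, p j z.2 ≠ 0 :=
      Measure.quasiMeasurePreserving_snd.ae hae
    filter_upwards [hae2] with z hz
    have h1 := eventually_prod_smoothTransition J (fun j => p j z.2) (fun j => q j * z.1) hz
    have h2 : Tendsto (fun k : ℕ => g (z.1 / ((k : ℝ) + 1), z.2)) atTop (𝓝 (g (0, z.2))) := by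
      refine (hg.tendsto _).comp (Tendsto.prodMk_nhds ?_ tendsto_const_nhds)
      exact tendsto_const_nhds.div_atTop
        (tendsto_atTop_add_const_right _ _ tendsto_natCast_atTop_atTop)
    have h3 := (h2.const_mul (if ∀ j ∈ J, 0 ≤ p j z.2 then (1 : ℝ) else 0)).const_mul
      (deriv χ (κ * z.1))
    have h4 : {t | ∀ j ∈ J, 0 ≤ p j t}.indicator (fun t => g (0, t)) z.2 =
        (if ∀ j ∈ J, 0 ≤ p j z.2 then (1 : ℝ) else 0) * g (0, z.2) := by
      rw [Set.indicator_apply, ite_mul, one_mul, zero_mul]; rfl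
    rw [h4]
    refine h3.congr' ?_
    filter_upwards [h1] with k hk
    simp only [G, hk]
    rw [mul_assoc]
  have hint := tendsto_integral_of_dominated_convergence _
    (fun k => (hGc k).aestronglyMeasurable) hbdI (fun k => ae_of_all _ (hGbd k)) hlim
  convert hint using 2
  rw [Measure.volume_eq_prod, integral_prod_mul (fun s : ℝ => deriv χ (κ * s)),
    Measure.integral_comp_mul_left, integral_deriv_smoothTransition, abs_of_pos (inv_pos.2 hκ),
    smul_eq_mul, mul_one]

end Slab

end DeltaForm

end

noncomputable section

namespace DeltaForm

open scoped ContDiff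
open MeasureTheory Filter Topology

/-! ### Stokes' formula: absence of boundary and smooth cut-offs -/

section Stokes

variable {n d : ℕ}

local notation "χ" => Real.smoothTransition

/-- The covectors `d'xᵢ` or `d''xᵢ`. -/
def dxs (s : Bool) (i : Fin n) : FormAlg n := cov s (LinearMap.proj i)

theorem continuous_linearMap_formAlg {V : Type*} [NormedAddCommGroup V] [NormedSpace ℝ V]
    (f : FormAlg n →ₗ[ℝ] V) : Continuous f := LinearMap.continuous_of_finiteDimensional f

/-- Dual linear forms of a linearly independent family. -/
theorem exists_dual {b : Fin d → E n} (hb : LinearIndependent ℝ b) :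
    ∃ β : Fin d → Module.Dual ℝ (E n), ∀ i j, β i (b j) = if i = j then 1 else 0 := by
  obtain ⟨g, hg⟩ := LinearMap.exists_leftInverse_of_injective
    (Fintype.linearCombination ℝ b) (LinearMap.ker_eq_bot.2 (by
      exact linearIndependent_iff_injective_fintypeLinearCombination.1 hb))
  refine ⟨fun i => LinearMap.proj i ∘ₗ g, fun i j => ?_⟩
  have h := LinearMap.congr_fun hg (Pi.single j 1)
  have h2 : g (b j) = Pi.single j 1 := by
    simpa [Fintype.linearCombination_apply, Pi.single_apply] using h
  simp [h2, Pi.single_apply]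

/-- The difference between a coordinate covector and its expansion in the `β k` vanishes on the
frame, hence is invisible to `topValue`. This replaces the coordinates of `ℝⁿ` by those of the
frame. -/
theorem topValue_sum_cov_mul {b : Fin d → E n} {β : Fin d → Module.Dual ℝ (E n)}
    (hβ : ∀ i j, β i (b j) = if i = j then 1 else 0) (s : Bool) (L : E n →ₗ[ℝ] FormAlg n) :
    topValue b (∑ i, dxs s i * L (Pi.single i 1)) = ∑ k, topValue b (cov s (β k) * L (b k)) := by
  have h1 : ∀ k, L (b k) = ∑ i, b k i • L (Pi.single i 1) := by
    intro k
    conv_lhs => rw [pi_eq_sum_univ' (b k)]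
    rw [map_sum]
    refine Finset.sum_congr rfl fun i _ => ?_
    rw [map_smul]
  have h2 : ∀ i : Fin n, topValue b (dxs s i * L (Pi.single i 1)) =
      ∑ k, b k i * topValue b (cov s (β k) * L (Pi.single i 1)) := by
    intro i
    have h3 : topValue b (cov s (LinearMap.proj i - ∑ k, b k i • β k) * L (Pi.single i 1)) = 0 := by
      apply topValue_cov_mul
      intro j
      simp [hβ]
    rw [map_sub, sub_mul, map_sub, sub_eq_zero] at h3
    rw [dxs, h3, map_sum, Finset.sum_mul, map_sum]
    refine Finset.sum_congr rfl fun k _ => ?_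
    rw [map_smul, smul_mul_assoc, map_smul, smul_eq_mul]
  rw [map_sum]
  simp only [h2, h1, Finset.mul_sum, map_sum, mul_smul_comm, map_smul, smul_eq_mul]
  exact Finset.sum_comm

/-- Integration by parts against the constant function `1`. -/
theorem integral_fderiv_eq_zero {F F' : (Fin d → ℝ) → ℝ} {v : Fin d → ℝ}
    (hF : ∀ t, HasLineDerivAt ℝ F (F' t) t v) (hFi : Integrable F) (hF'i : Integrable F') :
    ∫ t, F' t = 0 := by
  have h := integral_bilinear_hasLineDerivAt_right_eq_neg_left_of_integrable
    (μ := (volume : Measure (Fin d → ℝ))) (f := fun _ => (1 : ℝ)) (f' := fun _ => 0) (g := F)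
    (g' := F') (v := v) (B := ContinuousLinearMap.mul ℝ ℝ) (by simp) (by simpa using hF'i)
    (by simpa using hFi) (fun x _ => by
      simpa using ((hasFDerivAt_const (1 : ℝ) x).hasLineDerivAt v)) (fun x _ => hF x)
  simpa using h

theorem frameIntegral_diffOp_univ (x₀ : E n) {b : Fin d → E n} (hb : LinearIndependent ℝ b)
    (s : Bool) {w : E n → FormAlg n} (hw : w ∈ TestForm n) :
    frameIntegral x₀ b Set.univ (diffOp (dxs s) w) = 0 := by
  obtain ⟨β, hβ⟩ := exists_dual hb
  obtain ⟨hw1, hw2⟩ := hw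
  have hdw := hw1.differentiable (by simp)
  have hcont : ∀ v : E n, Continuous (fun x => fderiv ℝ w x v) := fun v =>
    (hw1.continuous_fderiv (by simp)).clm_apply continuous_const
  have hcs : ∀ v : E n, HasCompactSupport (fun x => fderiv ℝ w x v) := fun v =>
    (hw2.fderiv (𝕜 := ℝ)).comp_left (g := fun L : E n →L[ℝ] FormAlg n => L v) rfl
  obtain ⟨L, hL⟩ : ∃ L : Fin d → FormAlg n →ₗ[ℝ] ℝ, ∀ k x, L k x = topValue b (cov s (β k) * x) :=
    ⟨fun k => topValue b ∘ₗ LinearMap.mulLeft ℝ (cov s (β k)), fun k x => rfl⟩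
  have h1 : ∀ t : Fin d → ℝ, topValue b (diffOp (dxs s) w (x₀ + ∑ i, t i • b i)) =
      ∑ k, L k (fderiv ℝ w (x₀ + ∑ i, t i • b i) (b k)) := by
    intro t
    simp only [hL]
    exact topValue_sum_cov_mul hβ s (fderiv ℝ w (x₀ + ∑ i, t i • b i)).toLinearMap
  rw [frameIntegral]
  simp only [Set.mem_univ, Set.ofPred_true, Measure.restrict_univ, h1]
  have hInt : ∀ k (f : E n → FormAlg n), Continuous f → HasCompactSupport f →
      Integrable (fun t : Fin d → ℝ => L k (f (x₀ + ∑ i, t i • b i))) := by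
    intro k f hf hfc
    exact integrable_frame x₀ hb (f := fun x => L k (f x))
      ((continuous_linearMap_formAlg (L k)).comp hf) (hfc.comp_left (map_zero _))
  have hI : ∀ k, Integrable (fun t : Fin d → ℝ => L k (fderiv ℝ w (x₀ + ∑ i, t i • b i) (b k))) :=
    fun k => hInt k (fun x => fderiv ℝ w x (b k)) (hcont (b k)) (hcs (b k))
  rw [integral_finsetSum _ fun k _ => hI k]
  refine Finset.sum_eq_zero fun k _ => ?_
  refine integral_fderiv_eq_zero (F := fun t => L k (w (x₀ + ∑ i, t i • b i)))
    (v := Pi.single k 1) (fun t => ?_) (hInt k w hw1.continuous hw2) (hI k)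
  have h2 : HasFDerivAt (fun t : Fin d → ℝ => x₀ + ∑ i, t i • b i)
      (LinearMap.toContinuousLinearMap (Fintype.linearCombination ℝ b)) t := by
    have := (LinearMap.toContinuousLinearMap (Fintype.linearCombination ℝ b)).hasFDerivAt
      (x := t) |>.const_add x₀
    exact this
  have h3 := ((LinearMap.toContinuousLinearMap (L k)).hasFDerivAt.comp t
    ((hdw _).hasFDerivAt.comp t h2)).hasLineDerivAt (Pi.single k 1)
  have h4 : (Fintype.linearCombination ℝ b) (Pi.single k 1) = b k := by
    simp [Fintype.linearCombination_apply, Pi.single_apply]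
  rw [← h4]
  exact h3

theorem diffOp_smul (s : Bool) {Φ : E n → ℝ} {w : E n → FormAlg n} {x : E n}
    (hΦ : DifferentiableAt ℝ Φ x) (hw : DifferentiableAt ℝ w x) :
    diffOp (dxs s) (fun y => Φ y • w y) x =
      Φ x • diffOp (dxs s) w x + cov s (fderiv ℝ Φ x).toLinearMap * w x := by
  have h1 : (fderiv ℝ Φ x).toLinearMap =
      ∑ i, fderiv ℝ Φ x (Pi.single i 1) • (LinearMap.proj i : Module.Dual ℝ (E n)) := by
    refine LinearMap.ext fun v => ?_
    have h2 : fderiv ℝ Φ x v = ∑ i, v i • fderiv ℝ Φ x (Pi.single i 1) := by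
      conv_lhs => rw [pi_eq_sum_univ' v]
      rw [map_sum]
      refine Finset.sum_congr rfl fun i _ => ?_
      rw [map_smul]
    simp [h2, mul_comm]
  rw [h1]
  simp only [diffOp, fderiv_fun_smul hΦ hw, map_sum, map_smul, Finset.sum_mul, Finset.smul_sum,
    ← Finset.sum_add_distrib]
  refine Finset.sum_congr rfl fun i _ => ?_
  simp [mul_add, dxs]

/-- A product of smooth cut-off functions along the half-spaces `h ≤ c`. -/
def cutoff (H : Finset (Module.Dual ℝ (E n) × ℝ)) (k : ℕ) (x : E n) : ℝ :=
  ∏ h ∈ H, χ (((k : ℝ) + 1) * (h.2 - h.1 x))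

theorem contDiff_dual (l : Module.Dual ℝ (E n)) : ContDiff ℝ ∞ l :=
  (LinearMap.toContinuousLinearMap l).contDiff

theorem contDiff_cutoff (H : Finset (Module.Dual ℝ (E n) × ℝ)) (k : ℕ) :
    ContDiff ℝ ∞ (cutoff H k) := by
  refine contDiff_prod fun h _ => ?_
  exact Real.smoothTransition.contDiff.comp
    (contDiff_const.mul (contDiff_const.sub (contDiff_dual h.1)))

open Classical in
theorem fderiv_cutoff (H : Finset (Module.Dual ℝ (E n) × ℝ)) (k : ℕ) (x : E n) :
    (fderiv ℝ (cutoff H k) x).toLinearMap =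
      -∑ h ∈ H, (((k : ℝ) + 1) * (deriv χ (((k : ℝ) + 1) * (h.2 - h.1 x)) *
        cutoff (H.erase h) k x)) • h.1 := by
  have h1 : ∀ h ∈ H, HasFDerivAt (fun x : E n => χ (((k : ℝ) + 1) * (h.2 - h.1 x)))
      (-((((k : ℝ) + 1) * deriv χ (((k : ℝ) + 1) * (h.2 - h.1 x))) •
        LinearMap.toContinuousLinearMap h.1)) x := by
    intro h _
    have h2 : HasFDerivAt (fun x : E n => ((k : ℝ) + 1) * (h.2 - h.1 x))
        (((k : ℝ) + 1) • -LinearMap.toContinuousLinearMap h.1) x :=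
      (((LinearMap.toContinuousLinearMap h.1).hasFDerivAt (x := x)).const_sub h.2).const_mul _
    have h3 := (smoothTransition_hasDerivAt (((k : ℝ) + 1) * (h.2 - h.1 x))).comp_hasFDerivAt x h2
    refine h3.congr_fderiv (ContinuousLinearMap.ext fun v => ?_)
    simp only [neg_apply, smul_apply, smul_eq_mul]
    ring
  have h4 := HasFDerivAt.finsetProd h1
  have h5 : HasFDerivAt (cutoff H k) _ x := h4
  rw [h5.fderiv]
  refine LinearMap.ext fun v => ?_
  simp only [cutoff, ContinuousLinearMap.coe_coe, sum_apply, LinearMap.neg_apply,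
    LinearMap.sum_apply, LinearMap.smul_apply, smul_eq_mul, ← Finset.sum_neg_distrib]
  refine Finset.sum_congr rfl fun h _ => ?_
  simp
  ring

theorem frameIntegral_univ (x₀ : E n) (b : Fin d → E n) (ζ : E n → FormAlg n) :
    frameIntegral x₀ b Set.univ ζ = ∫ t : Fin d → ℝ, topValue b (ζ (x₀ + ∑ i, t i • b i)) := by
  simp [frameIntegral]

theorem add_sum_mem_affineSpan {σ : Set (E n)} {x₀ : E n} (hx₀ : x₀ ∈ affineSpan ℝ σ)
    {b : Fin d → E n} (hb : ∀ i, b i ∈ vectorSpan ℝ σ) (t : Fin d → ℝ) :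
    x₀ + ∑ i, t i • b i ∈ affineSpan ℝ σ := by
  have h : ∑ i, t i • b i ∈ (affineSpan ℝ σ).direction := by
    rw [direction_affineSpan]
    exact Submodule.sum_mem _ fun i _ => Submodule.smul_mem _ _ (hb i)
  have := AffineSubspace.vadd_mem_of_mem_direction h hx₀
  rwa [vadd_eq_add, add_comm] at this

/-- Affine coordinates of a point of the affine span. -/
theorem exists_add_sum_eq {σ : Set (E n)} {x₀ x : E n} (hx₀ : x₀ ∈ affineSpan ℝ σ)
    (hx : x ∈ affineSpan ℝ σ) {b : Fin d → E n}
    (hb : Submodule.span ℝ (Set.range b) = vectorSpan ℝ σ) :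
    ∃ t : Fin d → ℝ, x₀ + ∑ i, t i • b i = x := by
  have h := AffineSubspace.vsub_mem_direction hx hx₀
  rw [direction_affineSpan, ← hb, Submodule.mem_span_range_iff_exists_fun] at h
  obtain ⟨t, ht⟩ := h
  exact ⟨t, by rw [ht, vsub_eq_sub]; abel⟩

/-- The affine function `t ↦ c - l(x₀ + ∑ tᵢ bᵢ)`. -/
def affDual (x₀ : E n) (b : Fin d → E n) (h : Module.Dual ℝ (E n) × ℝ) : (Fin d → ℝ) →ᵃ[ℝ] ℝ :=
  AffineMap.const ℝ _ h.2 - h.1.toAffineMap.comp (affFrame x₀ b)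

theorem affDual_apply (x₀ : E n) (b : Fin d → E n) (h : Module.Dual ℝ (E n) × ℝ) (t : Fin d → ℝ) :
    affDual x₀ b h t = h.2 - h.1 (x₀ + ∑ i, t i • b i) := by
  rw [← affFrame_apply]
  rfl

/-- The cut-offs are bounded by `1`. Off the boundary hyperplanes, which are null sets by
`nonconst`, they are eventually equal to the indicator of `σ`. -/
theorem tendsto_frameIntegral_cutoff {σ : Set (E n)}
    {H : Finset (Module.Dual ℝ (E n) × ℝ)} (hH : IsReduced H σ) {x₀ : E n}
    (hx₀ : x₀ ∈ affineSpan ℝ σ) {b : Fin d → E n} (hb : LinearIndependent ℝ b)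
    (hbN : Submodule.span ℝ (Set.range b) = vectorSpan ℝ σ) {ζ : E n → FormAlg n}
    (hζ : Continuous ζ) (hζc : HasCompactSupport ζ) (hσm : MeasurableSet σ) :
    Tendsto (fun k : ℕ => frameIntegral x₀ b Set.univ (fun x => cutoff H k x • ζ x)) atTop
      (𝓝 (frameIntegral x₀ b σ ζ)) := by
  classical
  have hbN' : ∀ i, b i ∈ vectorSpan ℝ σ := fun i => hbN ▸ Submodule.subset_span ⟨i, rfl⟩
  rw [frameIntegral_eq_indicator _ _ hσm]
  simp only [frameIntegral_univ, map_smul, smul_eq_mul]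
  have hint : Integrable (fun t : Fin d → ℝ => topValue b (ζ (x₀ + ∑ i, t i • b i))) :=
    integrable_frame x₀ hb (f := fun x => topValue b (ζ x))
      ((continuous_linearMap_formAlg _).comp hζ) (hζc.comp_left (map_zero _))
  refine tendsto_integral_of_dominated_convergence _ (fun k => ?_) hint.norm (fun k => ?_) ?_
  · refine AEStronglyMeasurable.mul ?_ hint.aestronglyMeasurable
    exact ((contDiff_cutoff H k).continuous.comp (by fun_prop)).aestronglyMeasurable
  · refine ae_of_all _ fun t => ?_
    rw [norm_mul]
    have h := prod_smoothTransition_mem H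
      (fun h => ((k : ℝ) + 1) * (h.2 - h.1 (x₀ + ∑ i, t i • b i)))
    refine mul_le_of_le_one_left (norm_nonneg _) ?_
    rw [cutoff, Real.norm_of_nonneg h.1]
    exact h.2
  · have hae : ∀ᵐ t : Fin d → ℝ, ∀ h ∈ H, affDual x₀ b h t ≠ 0 := by
      rw [eventually_all_finset]
      intro h hh
      obtain ⟨v, hv, hhv⟩ := hH.nonconst h hh
      have hex : ∃ t, affDual x₀ b h t ≠ 0 := by
        by_contra! hcon
        obtain ⟨t₁, ht₁⟩ := exists_add_sum_eq hx₀ hx₀ hbN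
        have hxv : x₀ + v ∈ affineSpan ℝ σ := by
          have := AffineSubspace.vadd_mem_of_mem_direction
            (by rwa [direction_affineSpan] : v ∈ (affineSpan ℝ σ).direction) hx₀
          rwa [vadd_eq_add, add_comm] at this
        obtain ⟨t₂, ht₂⟩ := exists_add_sum_eq hx₀ hxv hbN
        have h1 := hcon t₁
        have h2 := hcon t₂
        rw [affDual_apply, ht₁] at h1
        rw [affDual_apply, ht₂, map_add] at h2
        apply hhv
        linarith
      obtain ⟨t, ht⟩ := hex
      exact measure_eq_zero_iff_ae_notMem.1 (volume_affine_eq_zero _ ht)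
    filter_upwards [hae] with t ht
    have h1 := eventually_prod_smoothTransition H (fun h => affDual x₀ b h t) (fun _ => 0) ht
    have h2 : σ.indicator (fun x => topValue b (ζ x)) (x₀ + ∑ i, t i • b i) =
        (if ∀ h ∈ H, 0 ≤ affDual x₀ b h t then (1 : ℝ) else 0) *
          topValue b (ζ (x₀ + ∑ i, t i • b i)) := by
      rw [Set.indicator_apply, ite_mul, one_mul, zero_mul]
      refine if_congr ?_ rfl rfl
      rw [hH.describes _ (add_sum_mem_affineSpan hx₀ hbN' t)]
      simp only [affDual_apply, sub_nonneg]
    rw [h2]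
    refine tendsto_const_nhds.congr' ?_
    filter_upwards [h1] with k hk
    rw [cutoff, ← hk]
    simp only [affDual_apply, add_zero]

end Stokes

end DeltaForm

end

noncomputable section

namespace DeltaForm

open scoped ContDiff
open MeasureTheory Filter Topology

/-! ### Stokes' formula: the contributions of the facets -/

section Stokes

variable {n e : ℕ}

local notation "χ" => Real.smoothTransition

/-- The linear map `(s, t) ↦ s v + ∑ tᵢ bᵢ`. -/
def slabMap (b : Fin e → E n) (v : E n) : ℝ × (Fin e → ℝ) →ₗ[ℝ] E n :=
  (LinearMap.toSpanSingleton ℝ _ v).coprod (Fintype.linearCombination ℝ b)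

theorem slabMap_apply (b : Fin e → E n) (v : E n) (z : ℝ × (Fin e → ℝ)) :
    slabMap b v z = z.1 • v + ∑ i, z.2 i • b i := by
  simp [slabMap, Fintype.linearCombination_apply]

theorem sum_snoc (b : Fin e → E n) (v : E n) (z : Fin (e + 1) → ℝ) :
    ∑ i, z i • (Fin.snoc b v : Fin (e + 1) → E n) i =
      slabMap b v (z (Fin.last e), fun i => z i.castSucc) := by
  rw [Fin.sum_univ_castSucc, slabMap_apply]
  simp [add_comm]

theorem slabMap_injective {b : Fin e → E n} {v : E n}
    (hb : LinearIndependent ℝ (Fin.snoc b v : Fin (e + 1) → E n)) :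
    Function.Injective (slabMap b v) := by
  rw [← LinearMap.ker_eq_bot, LinearMap.ker_eq_bot']
  rintro ⟨s, t⟩ h
  have h1 := sum_snoc b v (Fin.snoc t s)
  simp only [Fin.snoc_last, Fin.snoc_castSucc, h] at h1
  have h2 := Fintype.linearIndependent_iff.1 hb (Fin.snoc t s) h1
  refine Prod.ext ?_ (funext fun i => ?_)
  · simpa using h2 (Fin.last e)
  · simpa using h2 i.castSucc

/-- In the coordinates `(s, t)` of the frame `(v, b)` based on the wall, `h.2 - h.1` is `κ s` with
`κ = -h.1 v > 0`, so `tendsto_slab` applies. The factor `h.1 v` which `topValue_snoc_cov_mul`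
extracts cancels `κ⁻¹` up to the sign `-1`. -/
theorem tendsto_wall {σ : Set (E n)} {H : Finset (Module.Dual ℝ (E n) × ℝ)} [DecidableEq
    (Module.Dual ℝ (E n) × ℝ)] (hH : IsReduced H σ) (hσm : MeasurableSet σ)
    {h : Module.Dual ℝ (E n) × ℝ} (hh : h ∈ H) {x₀ : E n} (hx₀ : x₀ ∈ affineSpan ℝ σ)
    (hhx₀ : h.1 x₀ = h.2) {b : Fin e → E n} {v : E n}
    (hb : LinearIndependent ℝ (Fin.snoc b v : Fin (e + 1) → E n))
    (hbN : Submodule.span ℝ (Set.range (Fin.snoc b v : Fin (e + 1) → E n)) = vectorSpan ℝ σ)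
    (hhb : ∀ i, h.1 (b i) = 0) (hhv : h.1 v < 0) (s : Bool) {w : E n → FormAlg n}
    (hw : Continuous w) (hwc : HasCompactSupport w) :
    Tendsto (fun k : ℕ => frameIntegral x₀ (Fin.snoc b v : Fin (e + 1) → E n) Set.univ
      (fun x => (((k : ℝ) + 1) * (deriv χ (((k : ℝ) + 1) * (h.2 - h.1 x)) *
        cutoff (H.erase h) k x)) • (cov s h.1 * w x))) atTop
      (𝓝 (-frameIntegral x₀ b σ (fun x => kap s v (w x)))) := by
  classical
  have hbN' : ∀ i, b i ∈ vectorSpan ℝ σ := fun i => by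
    rw [← hbN]; exact Submodule.subset_span ⟨i.castSucc, by simp⟩
  have hemb : IsClosedEmbedding (fun z => x₀ + slabMap b v z) :=
    (Homeomorph.addLeft x₀).isClosedEmbedding.comp
      (LinearMap.isClosedEmbedding_of_injective (LinearMap.ker_eq_bot.2 (slabMap_injective hb)))
  have hlin : Continuous (fun x => topValue b (kap s v x)) :=
    continuous_linearMap_formAlg (topValue b ∘ₗ kap s v)
  let g : ℝ × (Fin e → ℝ) → ℝ := fun z => topValue b (kap s v (w (x₀ + slabMap b v z)))
  have hg : Continuous g := hlin.comp (hw.comp hemb.continuous)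
  have hgc : HasCompactSupport g :=
    (hwc.comp_isClosedEmbedding hemb).comp_left (g := fun x => topValue b (kap s v x)) (by simp)
  have hκ : 0 < -h.1 v := by linarith
  -- By `distinct`, some point of the boundary of `h` is off that of `j`. Its transverse coordinate
  -- is zero, so `j` is not identically tight on the wall.
  have hnull : ∀ j ∈ H.erase h, volume {t | affDual x₀ b j t = 0} = 0 := by
    intro j hj
    obtain ⟨x, hx, hx1, hx2⟩ := hH.distinct h hh j (Finset.mem_of_mem_erase hj)
      (Finset.ne_of_mem_erase hj).symm
    obtain ⟨z, hz⟩ := exists_add_sum_eq hx₀ hx hbN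
    rw [sum_snoc, slabMap_apply] at hz
    have h1 : z (Fin.last e) = 0 := by
      have h2 := congrArg h.1 hz
      simp only [map_add, map_smul, map_sum, hhb, hx1, hhx₀, smul_eq_mul] at h2
      simp only [mul_zero, Finset.sum_const_zero, add_zero, add_eq_left, mul_eq_zero] at h2
      exact h2.resolve_right hhv.ne
    simp only [h1, zero_smul, zero_add] at hz
    refine volume_affine_eq_zero _ (t := fun i => z i.castSucc) ?_
    rw [affDual_apply, hz]
    exact sub_ne_zero.2 hx2.symm
  have hlim := tendsto_slab (H.erase h) (fun j => affDual x₀ b j)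
    (fun j => (affDual x₀ b j).continuous_of_finiteDimensional) (fun j => -j.1 v) hnull g hg hgc hκ
  have hlim2 := hlim.const_mul (h.1 v)
  have hval : h.1 v * ((-h.1 v)⁻¹ * ∫ t, {t | ∀ j ∈ H.erase h, 0 ≤ affDual x₀ b j t}.indicator
      (fun t => g (0, t)) t) = -frameIntegral x₀ b σ (fun x => kap s v (w x)) := by
    rw [← mul_assoc, inv_neg, mul_neg, mul_inv_cancel₀ hhv.ne, neg_one_mul,
      frameIntegral_eq_indicator _ _ hσm]
    congr 2
    funext t
    have h0 : x₀ + slabMap b v (0, t) = x₀ + ∑ i, t i • b i := by simp [slabMap_apply]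
    rw [Set.indicator_apply, Set.indicator_apply]
    refine if_congr ?_ (by simp only [g, h0]) rfl
    rw [hH.describes _ (add_sum_mem_affineSpan hx₀ hbN' t)]
    simp only [Set.mem_ofPred_eq, affDual_apply, sub_nonneg]
    constructor
    · intro h1 j hj
      by_cases hjh : j = h
      · subst hjh
        simp [hhx₀, hhb]
      · exact h1 j (Finset.mem_erase.2 ⟨hjh, hj⟩)
    · intro h1 j hj
      exact h1 j (Finset.mem_of_mem_erase hj)
  rw [hval] at hlim2
  refine hlim2.congr fun k => ?_
  rw [frameIntegral_univ, ← integral_const_mul]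
  have hmp := (volume_preserving_piFinSuccAbove (fun _ : Fin (e + 1) => ℝ) (Fin.last e))
  rw [← hmp.integral_comp']
  congr 1
  funext z
  have hz : (MeasurableEquiv.piFinSuccAbove (fun _ : Fin (e + 1) => ℝ) (Fin.last e)) z =
      (z (Fin.last e), fun i => z i.castSucc) := by
    refine Prod.ext rfl (funext fun i => ?_)
    change z (Fin.succAbove (Fin.last e) i) = z i.castSucc
    rw [Fin.succAbove_last]
  rw [hz, sum_snoc]
  set y : ℝ × (Fin e → ℝ) := (z (Fin.last e), fun i => z i.castSucc) with hy
  have hy1 : ∀ j : Module.Dual ℝ (E n) × ℝ, j.2 - j.1 (x₀ + slabMap b v y) =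
      affDual x₀ b j y.2 + -j.1 v * y.1 := by
    intro j
    rw [affDual_apply, slabMap_apply]
    simp only [map_add, map_smul, smul_eq_mul]
    ring
  have hy2 : affDual x₀ b h y.2 = 0 := by
    rw [affDual_apply]
    simp [hhx₀, hhb]
  rw [map_smul, topValue_snoc_cov_mul _ s h.1 (by simpa using hhb)]
  simp only [Fin.snoc_last, Fin.snoc_castSucc, cutoff, hy1, hy2, zero_add, smul_eq_mul, g]
  ring

/-- The integrals of the facets that correspond to the half-space `h`. -/
theorem exists_tendsto_wall {σ : Set (E n)} (hσ : IsPolyhedron σ)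
    {H : Finset (Module.Dual ℝ (E n) × ℝ)} [DecidableEq (Module.Dual ℝ (E n) × ℝ)]
    (hH : IsReduced H σ) {h : Module.Dual ℝ (E n) × ℝ} (hh : h ∈ H) (μ : Weight (vectorSpan ℝ σ))
    {v : E n} {ν : Weight (vectorSpan ℝ (wall σ h))}
    (hv : IsFacet (wall σ h) σ → IsNormalVector μ ν v) (s : Bool)
    {w : E n → FormAlg n} (hw : Continuous w) (hwc : HasCompactSupport w) :
    Tendsto (fun k : ℕ => μ.scale * frameIntegral (basePoint σ) (fun i => (μ.frame i : E n)) Set.univ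
      (fun x => (((k : ℝ) + 1) * (deriv χ (((k : ℝ) + 1) * (h.2 - h.1 x)) *
        cutoff (H.erase h) k x)) • (cov s h.1 * w x))) atTop
      (𝓝 (-(open scoped Classical in if IsFacet (wall σ h) σ then
        integral (wall σ h) ν (fun x => kap s v (w x)) else 0))) := by
  classical
  have hbase := basePoint_mem hσ.1
  have hsub : ∀ {x}, x ∈ affineSpan ℝ σ → x - basePoint σ ∈ vectorSpan ℝ σ := fun hx =>
    (mem_affineSpan_iff hbase).1 hx
  by_cases hf : IsFacet (wall σ h) σ
  · rw [if_pos hf]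
    obtain ⟨hli, hspan, hext⟩ := (hv hf).frame hf
    obtain ⟨x₀, hx₀⟩ := hf.1.1
    have hhb : ∀ i, h.1 (ν.frame i : E n) = 0 := fun i =>
      (vectorSpan_wall_le σ h (ν.frame i).2).1
    have hhv : h.1 v < 0 := by
      obtain ⟨c, hc, x, hx, y, hy, hxy⟩ := (hv hf).2
      have h1 : h.1 (v - c • (x - y)) = 0 := (vectorSpan_wall_le σ h hxy).1
      have h2 : h.1 x ≤ h.2 := (hH.describes x (mem_affineSpan ℝ hx)).1 hx h hh
      have h3 : h.1 v = c * (h.1 x - h.2) := by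
        rw [map_sub, map_smul, map_sub, smul_eq_mul, sub_eq_zero] at h1
        rw [h1, hy.2]
      refine lt_of_le_of_ne ?_ fun h0 => ?_
      · rw [h3]; exact mul_nonpos_of_nonneg_of_nonpos hc.le (by linarith)
      · obtain ⟨u, hu, hhu⟩ := hH.nonconst h hh
        rw [← hspan] at hu
        apply hhu
        have : Submodule.span ℝ (Set.range
            (Fin.snoc (fun i => (ν.frame i : E n)) v : Fin (_ + 1) → E n)) ≤
            LinearMap.ker h.1 := by
          rw [Submodule.span_le]
          rintro _ ⟨i, rfl⟩
          induction i using Fin.lastCases with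
          | last => simpa using h0
          | cast i => simpa using hhb i
        exact this hu
    have hlim := tendsto_wall hH hσ.measurableSet hh (mem_affineSpan ℝ hx₀.1) hx₀.2 hli hspan hhb
      hhv s hw hwc
    have hlim2 := hlim.const_mul ν.scale
    have hcl : IsClosed (wall σ h) := hf.1.isClosed hσ.isClosed
    have h1 : integral (wall σ h) ν (fun x => kap s v (w x)) =
        ν.scale * frameIntegral x₀ (fun i => (ν.frame i : E n)) σ (fun x => kap s v (w x)) := by
      rw [integral_eq_frameIntegral hcl.measurableSet hf.1.1 ν (frame_linearIndependent ν)
        (span_frame ν) (mem_affineSpan ℝ hx₀) ν.scale_pos (Or.inl rfl)]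
      congr 1
      rw [frameIntegral, frameIntegral]
      congr 2
      refine Set.ext fun t => ⟨fun ht => ht.1, fun ht => ⟨ht, ?_⟩⟩
      rw [map_add, map_sum, hx₀.2, Finset.sum_eq_zero, add_zero]
      intro i _
      rw [map_smul, hhb, smul_zero]
    rw [h1, ← mul_neg]
    refine hlim2.congr fun k => ?_
    exact (scale_mul_frameIntegral μ MeasurableSet.univ hli hspan
      (hsub (mem_affineSpan ℝ hx₀.1)) ν.scale_pos hext _).symm
  -- Without a facet there is no normal vector, so a frame of the boundary hyperplane and a
  -- transverse `v` are chosen by hand. The limit is then an integral over a null set, since `σ`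
  -- meets the hyperplane in a set that is empty or of smaller dimension.
  · rw [if_neg hf]
    obtain ⟨u, hu, hhu⟩ := hH.nonconst h hh
    obtain ⟨v, hvN, hhv⟩ : ∃ v ∈ vectorSpan ℝ σ, h.1 v < 0 := by
      rcases lt_or_gt_of_ne hhu with h1 | h1
      · exact ⟨u, hu, h1⟩
      · exact ⟨-u, Submodule.neg_mem _ hu, by simpa using h1⟩
    let K : Submodule ℝ (E n) := LinearMap.ker h.1 ⊓ vectorSpan ℝ σ
    obtain ⟨ν'⟩ := exists_weight K
    let b : Fin (Module.finrank ℝ K) → E n := fun i => (ν'.frame i : E n)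
    have hhb : ∀ i, h.1 (b i) = 0 := fun i => (ν'.frame i).2.1
    have hli : LinearIndependent ℝ (Fin.snoc b v : Fin (_ + 1) → E n) := by
      rw [linearIndependent_finSnoc]
      refine ⟨frame_linearIndependent ν', ?_⟩
      rw [span_frame]
      exact fun h1 => hhv.ne h1.1
    have hspan : Submodule.span ℝ (Set.range (Fin.snoc b v : Fin (_ + 1) → E n)) =
        vectorSpan ℝ σ := by
      refine Submodule.eq_of_le_of_finrank_eq ?_ ?_
      · rw [Submodule.span_le]
        rintro _ ⟨i, rfl⟩
        induction i using Fin.lastCases with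
        | last => simpa using hvN
        | cast i => simpa using (ν'.frame i).2.2
      · rw [finrank_span_eq_card hli, Fintype.card_fin]
        exact finrank_ker_inf (hH.nonconst h hh)
    let x₀ : E n := basePoint σ + ((h.2 - h.1 (basePoint σ)) / h.1 v) • v
    have hx₀ : x₀ ∈ affineSpan ℝ σ := by
      rw [mem_affineSpan_iff hbase]
      simp only [x₀, add_sub_cancel_left]
      exact Submodule.smul_mem _ _ hvN
    have hhx₀ : h.1 x₀ = h.2 := by
      simp only [x₀, map_add, map_smul, smul_eq_mul]
      field_simp [hhv.ne]
      ring
    obtain ⟨c, hc, hext⟩ := exists_toExt_eq μ hli hspan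
    have hlim := (tendsto_wall hH hσ.measurableSet hh hx₀ hhx₀ hli hspan hhb
      hhv s hw hwc).const_mul c
    have h0 : frameIntegral x₀ b σ (fun x => kap s v (w x)) = 0 := by
      rw [frameIntegral]
      refine setIntegral_measure_zero _ ?_
      by_cases hne : (wall σ h).Nonempty
      · have hsubset : {t : Fin (Module.finrank ℝ K) → ℝ | x₀ + ∑ i, t i • b i ∈ σ} ⊆
            affFrame x₀ b ⁻¹' (affineSpan ℝ (wall σ h) : Set (E n)) := by
          intro t ht
          rw [Set.mem_preimage, affFrame_apply]
          refine mem_affineSpan ℝ ⟨ht, ?_⟩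
          simp [hhx₀, hhb]
        refine measure_mono_null hsubset ?_
        have hex : ∃ t, affFrame x₀ b t ∉ affineSpan ℝ (wall σ h) := by
          by_contra! hcon
          apply hf
          refine ⟨hH.isFace_wall hh hne, ?_⟩
          have hle : K ≤ vectorSpan ℝ (wall σ h) := by
            have h2 : Submodule.span ℝ (Set.range b) ≤ vectorSpan ℝ (wall σ h) := by
              rw [Submodule.span_le]
              rintro _ ⟨i, rfl⟩
              have h3 := AffineSubspace.vsub_mem_direction (hcon (Pi.single i 1)) (hcon 0)
              rw [direction_affineSpan, affFrame_apply, affFrame_apply] at h3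
              simpa [Pi.single_apply] using h3
            rwa [span_frame] at h2
          have heq : vectorSpan ℝ (wall σ h) = K := le_antisymm (vectorSpan_wall_le σ h) hle
          have h4 := finrank_ker_inf (hH.nonconst h hh)
          rw [dim, heq]
          exact h4
        obtain ⟨t, ht⟩ := hex
        exact volume_preimage_affineSubspace _ _ ht
      · have : {t : Fin (Module.finrank ℝ K) → ℝ | x₀ + ∑ i, t i • b i ∈ σ} = ∅ := by
          rw [Set.eq_empty_iff_forall_notMem]
          intro t ht
          refine hne ⟨_, ht, ?_⟩
          simp [hhx₀, hhb]
        rw [this, measure_empty]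
    rw [h0, neg_zero, mul_zero] at hlim
    rw [neg_zero]
    refine hlim.congr fun k => ?_
    exact (scale_mul_frameIntegral μ MeasurableSet.univ hli hspan (hsub hx₀) hc hext _).symm

theorem frameIntegral_add {d : ℕ} (x₀ : E n) {b : Fin d → E n} (hb : LinearIndependent ℝ b)
    {S : Set (E n)} {ζ ξ : E n → FormAlg n} (hζ : Continuous ζ) (hζc : HasCompactSupport ζ)
    (hξ : Continuous ξ) (hξc : HasCompactSupport ξ) :
    frameIntegral x₀ b S (fun x => ζ x + ξ x) =
      frameIntegral x₀ b S ζ + frameIntegral x₀ b S ξ := by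
  have hint : ∀ f : E n → FormAlg n, Continuous f → HasCompactSupport f →
      Integrable (fun t : Fin d → ℝ => topValue b (f (x₀ + ∑ i, t i • b i))) := fun f hf hfc =>
    integrable_frame x₀ hb (f := fun x => topValue b (f x))
      ((continuous_linearMap_formAlg _).comp hf) (hfc.comp_left (map_zero _))
  simp only [frameIntegral, map_add]
  exact integral_add (hint ζ hζ hζc).integrableOn (hint ξ hξ hξc).integrableOn

theorem frameIntegral_sum {d : ℕ} (x₀ : E n) {b : Fin d → E n} (hb : LinearIndependent ℝ b)
    {S : Set (E n)} {ι : Type*} (J : Finset ι) {ζ : ι → E n → FormAlg n}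
    (hζ : ∀ j ∈ J, Continuous (ζ j)) (hζc : ∀ j ∈ J, HasCompactSupport (ζ j)) :
    frameIntegral x₀ b S (fun x => ∑ j ∈ J, ζ j x) = ∑ j ∈ J, frameIntegral x₀ b S (ζ j) := by
  have hint : ∀ f : E n → FormAlg n, Continuous f → HasCompactSupport f →
      Integrable (fun t : Fin d → ℝ => topValue b (f (x₀ + ∑ i, t i • b i))) := fun f hf hfc =>
    integrable_frame x₀ hb (f := fun x => topValue b (f x))
      ((continuous_linearMap_formAlg _).comp hf) (hfc.comp_left (map_zero _))
  simp only [frameIntegral, map_sum]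
  exact integral_finsetSum _ fun j hj => (hint _ (hζ j hj) (hζc j hj)).integrableOn

theorem continuous_mul_formAlg {f g : E n → FormAlg n} (hf : Continuous f) (hg : Continuous g) :
    Continuous (fun x => f x * g x) := by
  have : Continuous (fun p : FormAlg n × FormAlg n => p.1 * p.2) :=
    (LinearMap.toContinuousBilinearMap (LinearMap.mul ℝ (FormAlg n))).continuous₂
  exact this.comp (hf.prodMk hg)

theorem hasCompactSupport_smul (f : E n → ℝ) {w : E n → FormAlg n} (hw : HasCompactSupport w) :
    HasCompactSupport (fun x => f x • w x) :=
  HasCompactSupport.smul_left (f := f) hw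

theorem smul_mem_testForm {Φ : E n → ℝ} (hΦ : ContDiff ℝ ∞ Φ) {w : E n → FormAlg n}
    (hw : w ∈ TestForm n) : (fun x => Φ x • w x) ∈ TestForm n :=
  ⟨ContDiff.smul hΦ hw.1, hasCompactSupport_smul Φ hw.2⟩

open Classical in
/-- The `h`-summand of the derivative of the cut-off function, wedged with `w`. -/
def wallForm (H : Finset (Module.Dual ℝ (E n) × ℝ)) (s : Bool) (w : E n → FormAlg n) (k : ℕ)
    (h : Module.Dual ℝ (E n) × ℝ) (x : E n) : FormAlg n :=
  (((k : ℝ) + 1) * (deriv χ (((k : ℝ) + 1) * (h.2 - h.1 x)) * cutoff (H.erase h) k x)) •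
    (cov s h.1 * w x)

theorem continuous_wallForm (H : Finset (Module.Dual ℝ (E n) × ℝ)) (s : Bool)
    {w : E n → FormAlg n} (hw : Continuous w) (k : ℕ) (h : Module.Dual ℝ (E n) × ℝ) :
    Continuous (wallForm H s w k h) := by
  refine Continuous.smul (continuous_const.mul (Continuous.mul ?_
    (contDiff_cutoff _ k).continuous)) (continuous_mul_formAlg continuous_const hw)
  exact continuous_deriv_smoothTransition.comp
    (continuous_const.mul (continuous_const.sub (continuous_dual h.1)))

theorem hasCompactSupport_wallForm (H : Finset (Module.Dual ℝ (E n) × ℝ)) (s : Bool)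
    {w : E n → FormAlg n} (hw : HasCompactSupport w) (k : ℕ) (h : Module.Dual ℝ (E n) × ℝ) :
    HasCompactSupport (wallForm H s w k h) :=
  hasCompactSupport_smul _ (hw.comp_left (g := fun y => cov s h.1 * y) (mul_zero _))

/-- Leibniz' rule for the compactly supported form `cutoff • w`, whose derivative has integral zero.
-/
theorem frameIntegral_cutoff_eq {d : ℕ} (x₀ : E n) {b : Fin d → E n} (hb : LinearIndependent ℝ b)
    (H : Finset (Module.Dual ℝ (E n) × ℝ)) (s : Bool) {w : E n → FormAlg n} (hw : w ∈ TestForm n)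
    (k : ℕ) : frameIntegral x₀ b Set.univ (fun x => cutoff H k x • diffOp (dxs s) w x) =
      ∑ h ∈ H, frameIntegral x₀ b Set.univ (wallForm H s w k h) := by
  have hd := diffOp_mem (dxs s) hw
  have h0 := frameIntegral_diffOp_univ x₀ hb s (smul_mem_testForm (contDiff_cutoff H k) hw)
  have h1 : (fun x => cutoff H k x • diffOp (dxs s) w x) = fun x =>
      diffOp (dxs s) (fun x => cutoff H k x • w x) x + ∑ h ∈ H, wallForm H s w k h x := by
    funext x
    rw [diffOp_smul s ((contDiff_cutoff H k).differentiable (by simp) x)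
      (hw.1.differentiable (by simp) x), fderiv_cutoff, map_neg, map_sum, neg_mul,
      Finset.sum_mul, add_assoc, left_eq_add]
    simp only [map_smul, smul_mul_assoc, wallForm]
    exact neg_add_cancel _
  have h2 := diffOp_mem (dxs s) (smul_mem_testForm (contDiff_cutoff H k) hw)
  have h3 : HasCompactSupport (fun x => ∑ h ∈ H, wallForm H s w k h x) := by
    have : (fun x => ∑ h ∈ H, wallForm H s w k h x) = ∑ h ∈ H, wallForm H s w k h := by
      funext x; simp
    rw [this]
    exact HasCompactSupport.finset_sum fun h _ => hasCompactSupport_wallForm H s hw.2 k h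
  rw [h1, frameIntegral_add x₀ hb h2.1.continuous h2.2
    (continuous_finsetSum _ fun h _ => continuous_wallForm H s hw.1.continuous k h) h3, h0, zero_add]
  exact frameIntegral_sum x₀ hb H (fun h _ => continuous_wallForm H s hw.1.continuous k h)
    fun h _ => hasCompactSupport_wallForm H s hw.2 k h

/-- The formula of Stokes for polyhedra. -/
theorem stokes {σ : Set (E n)} (hσ : IsPolyhedron σ) (μ : Weight (vectorSpan ℝ σ)) (s : Bool)
    {w : E n → FormAlg n} (hw : w ∈ TestForm n) (F : Finset (Set (E n)))
    (hF : ∀ τ, τ ∈ F ↔ IsFacet τ σ) (ν : ∀ τ : Set (E n), Weight (vectorSpan ℝ τ))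
    (v : Set (E n) → E n) (hv : ∀ τ, IsFacet τ σ → IsNormalVector μ (ν τ) (v τ)) :
    integral σ μ (diffOp (dxs s) w) = -∑ τ ∈ F, integral τ (ν τ) (fun x => kap s (v τ) (w x)) := by
  classical
  obtain ⟨H, hH⟩ := hσ.exists_isReduced
  have hbase := mem_affineSpan ℝ (basePoint_mem hσ.1)
  have hb := frame_linearIndependent μ
  have hd := diffOp_mem (dxs s) hw
  have hlim1 := (tendsto_frameIntegral_cutoff hH hbase hb (span_frame μ) hd.1.continuous hd.2
    hσ.measurableSet).const_mul μ.scale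
  have hlim2 := tendsto_finsetSum H fun h hh => exists_tendsto_wall hσ hH hh μ
    (ν := ν (wall σ h)) (v := v (wall σ h)) (hv _) s hw.1.continuous hw.2
  have heq : ∀ k : ℕ, μ.scale * frameIntegral (basePoint σ) (fun i => (μ.frame i : E n)) Set.univ
      (fun x => cutoff H k x • diffOp (dxs s) w x) =
      ∑ h ∈ H, μ.scale * frameIntegral (basePoint σ) (fun i => (μ.frame i : E n)) Set.univ
        (fun x => (((k : ℝ) + 1) * (deriv χ (((k : ℝ) + 1) * (h.2 - h.1 x)) *
          cutoff (H.erase h) k x)) • (cov s h.1 * w x)) := by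
    intro k
    rw [← Finset.mul_sum, frameIntegral_cutoff_eq _ hb H s hw k]
    rfl
  simp only [heq] at hlim1
  -- One sequence has two limits: the cut-off integrals tend to the integral over `σ`, and the slabs
  -- that carry the derivative of the cut-off tend to the facets.
  have hfin := tendsto_nhds_unique hlim1 hlim2
  have h6 : integral σ μ (diffOp (dxs s) w) = μ.scale * frameIntegral (basePoint σ)
      (fun i => (μ.frame i : E n)) σ (diffOp (dxs s) w) := rfl
  rw [h6, hfin, Finset.sum_neg_distrib, ← Finset.sum_filter]
  congr 1
  refine Finset.sum_bij (fun h _ => wall σ h) ?_ ?_ ?_ ?_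
  · intro h hh
    rw [hF]; exact (Finset.mem_filter.1 hh).2
  · intro h hh k hk heq
    rw [Finset.mem_filter] at hh hk
    exact hH.wall_injOn hh.1 hk.1 hh.2 heq
  · intro τ hτ
    rw [hF] at hτ
    obtain ⟨h, hh, rfl⟩ := hH.exists_wall_eq hσ.convex hτ
    exact ⟨h, Finset.mem_filter.2 ⟨hh, hτ⟩, rfl⟩
  · intro h hh
    rfl

end Stokes

end DeltaForm

end

noncomputable section

namespace DeltaForm

open scoped ContDiff
open MeasureTheory Filter Topology

/-! ### Derivatives of polyhedral currents -/

section Derivative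

variable {n : ℕ}

/-! ## Smooth forms -/

theorem contDiff_mul_formAlg {f g : E n → FormAlg n} (hf : ContDiff ℝ ∞ f) (hg : ContDiff ℝ ∞ g) :
    ContDiff ℝ ∞ (fun x => f x * g x) :=
  (LinearMap.toContinuousBilinearMap (LinearMap.mul ℝ (FormAlg n))).isBoundedBilinearMap.contDiff.comp
    (hf.prodMk hg)

theorem contDiff_of_mem {f : E n → FormAlg n} (hf : f ∈ SmoothForm n) : ContDiff ℝ ∞ f := hf

theorem hasCompactSupport_mul (f : E n → FormAlg n) {w : E n → FormAlg n}
    (hw : HasCompactSupport w) : HasCompactSupport (fun x => f x * w x) :=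
  HasCompactSupport.mul_left (f := f) hw

theorem mul_mem_testForm {f : E n → FormAlg n} (hf : f ∈ SmoothForm n) {w : E n → FormAlg n}
    (hw : w ∈ TestForm n) : (fun x => f x * w x) ∈ TestForm n :=
  ⟨contDiff_mul_formAlg hf hw.1, hasCompactSupport_mul f hw.2⟩

theorem diffOp_mem_smoothForm (s : Bool) {f : E n → FormAlg n} (hf : f ∈ SmoothForm n) :
    diffOp (dxs s) f ∈ SmoothForm n := by
  change ContDiff ℝ ∞ (fun x => ∑ i, dxs s i * fderiv ℝ f x (Pi.single i 1))
  refine ContDiff.sum fun i _ => ?_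
  refine contDiff_mul_formAlg contDiff_const ?_
  exact ((contDiff_of_mem hf).fderiv_right (m := ∞) (by simp)).clm_apply contDiff_const

theorem linearMap_comp_mem_smoothForm (L : FormAlg n →ₗ[ℝ] FormAlg n) {f : E n → FormAlg n}
    (hf : f ∈ SmoothForm n) : (fun x => L (f x)) ∈ SmoothForm n :=
  (LinearMap.toContinuousLinearMap L).contDiff.comp (contDiff_of_mem hf)

theorem linearMap_comp_mem_testForm (L : FormAlg n →ₗ[ℝ] FormAlg n) {f : E n → FormAlg n}
    (hf : f ∈ TestForm n) : (fun x => L (f x)) ∈ TestForm n :=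
  ⟨linearMap_comp_mem_smoothForm L hf.1, hf.2.comp_left (map_zero L)⟩

theorem fderiv_bilinear {F : Type*} [NormedAddCommGroup F] [NormedSpace ℝ F]
    (B : F →L[ℝ] F →L[ℝ] F) {f g : E n → F} {x : E n} (hf : DifferentiableAt ℝ f x)
    (hg : DifferentiableAt ℝ g x) (v : E n) :
    fderiv ℝ (fun y => B (f y) (g y)) x v = B (fderiv ℝ f x v) (g x) + B (f x) (fderiv ℝ g x v) := by
  rw [(B.hasFDerivAt_of_bilinear hf.hasFDerivAt hg.hasFDerivAt).fderiv]
  simp [add_comm]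

theorem fderiv_mul_formAlg {f g : E n → FormAlg n} {x : E n} (hf : DifferentiableAt ℝ f x)
    (hg : DifferentiableAt ℝ g x) (v : E n) :
    fderiv ℝ (fun y => f y * g y) x v = fderiv ℝ f x v * g x + f x * fderiv ℝ g x v := by
  have hB : ∀ a c : FormAlg n,
      LinearMap.toContinuousBilinearMap (LinearMap.mul ℝ (FormAlg n)) a c = a * c := fun _ _ => rfl
  have h := fderiv_bilinear (LinearMap.toContinuousBilinearMap (LinearMap.mul ℝ (FormAlg n))) hf hg v
  simpa only [hB] using h

theorem fderiv_linearMap_comp (L : FormAlg n →ₗ[ℝ] FormAlg n) {f : E n → FormAlg n} {x : E n}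
    (hf : DifferentiableAt ℝ f x) (v : E n) :
    fderiv ℝ (fun y => L (f y)) x v = L (fderiv ℝ f x v) := by
  have h := (LinearMap.toContinuousLinearMap L).hasFDerivAt.comp x hf.hasFDerivAt
  have h2 : fderiv ℝ (fun y => L (f y)) x = _ := h.fderiv
  rw [h2]
  rfl

/-- Leibniz' rule under the top coefficient. The sign in the definition of `d'T` compensates for
moving the covector past `f`, and the remaining global involution is invisible in even degree. -/
theorem topValue_mul_diffOp_involute {d : ℕ} (b : Fin d → E n) (s : Bool) {f w : E n → FormAlg n}
    {x : E n} (hf : DifferentiableAt ℝ f x) (hw : DifferentiableAt ℝ w x) :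
    topValue b (f x * diffOp (dxs s) (fun y => CliffordAlgebra.involute (w y)) x) =
      topValue b (diffOp (dxs s) f x * w x) -
        topValue b (diffOp (dxs s) (fun y => f y * w y) x) := by
  have h1 : ∀ i : Fin n, f x * (dxs s i * fderiv ℝ (fun y => CliffordAlgebra.involute (w y)) x
      (Pi.single i 1)) = -CliffordAlgebra.involute (dxs s i * (f x * fderiv ℝ w x (Pi.single i 1))) := by
    intro i
    have h2 := fderiv_linearMap_comp
      (CliffordAlgebra.involute : FormAlg n →ₐ[ℝ] FormAlg n).toLinearMap hw (Pi.single i 1)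
    simp only [AlgHom.toLinearMap_apply] at h2
    rw [h2, ← mul_assoc, dxs, mul_cov, map_mul, map_mul, involute_cov]
    simp only [neg_mul, neg_neg, mul_assoc]
  simp only [diffOp, Finset.mul_sum, h1, map_sum, map_neg, topValue_involute, Finset.sum_mul,
    fderiv_mul_formAlg hf hw, mul_add, map_add, Finset.sum_add_distrib, Finset.sum_neg_distrib,
    mul_assoc]
  ring

/-! ## Integrals -/

theorem integral_def {σ : Set (E n)} (μ : Weight (vectorSpan ℝ σ)) (ζ : E n → FormAlg n) :
    integral σ μ ζ = μ.scale *
      frameIntegral (basePoint σ) (fun i => (μ.frame i : E n)) σ ζ := rfl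

theorem frameIntegral_congr {d : ℕ} {x₀ : E n} {b : Fin d → E n} {S : Set (E n)}
    (hS : MeasurableSet S) {ζ ξ : E n → FormAlg n}
    (h : ∀ x ∈ S, topValue b (ζ x) = topValue b (ξ x)) :
    frameIntegral x₀ b S ζ = frameIntegral x₀ b S ξ := by
  rw [frameIntegral, frameIntegral]
  exact setIntegral_congr_fun (hS.preimage (by fun_prop)) fun t ht => h _ ht

theorem integral_congr {σ : Set (E n)} (hσ : MeasurableSet σ) (μ : Weight (vectorSpan ℝ σ))
    {ζ ξ : E n → FormAlg n}
    (h : ∀ x ∈ σ, topValue (fun i => (μ.frame i : E n)) (ζ x) =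
      topValue (fun i => (μ.frame i : E n)) (ξ x)) :
    integral σ μ ζ = integral σ μ ξ := by
  rw [integral_def, integral_def, frameIntegral_congr hσ h]

theorem integral_eq_zero {σ : Set (E n)} (hσ : MeasurableSet σ) (μ : Weight (vectorSpan ℝ σ))
    {ζ : E n → FormAlg n} (h : ∀ x ∈ σ, ζ x = 0) : integral σ μ ζ = 0 := by
  rw [integral_congr hσ μ (ξ := fun _ => 0) (fun x hx => by rw [h x hx]), integral_def,
    frameIntegral]
  simp

theorem integral_add {σ : Set (E n)} (μ : Weight (vectorSpan ℝ σ))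
    {ζ ξ : E n → FormAlg n} (hζ : ζ ∈ TestForm n) (hξ : ξ ∈ TestForm n) :
    integral σ μ (fun x => ζ x + ξ x) = integral σ μ ζ + integral σ μ ξ := by
  rw [integral_def, integral_def, integral_def, frameIntegral_add _ (frame_linearIndependent μ)
    hζ.1.continuous hζ.2 hξ.1.continuous hξ.2, mul_add]

theorem integral_smul {σ : Set (E n)} (μ : Weight (vectorSpan ℝ σ)) (c : ℝ)
    (ζ : E n → FormAlg n) : integral σ μ (fun x => c • ζ x) = c * integral σ μ ζ := by
  simp only [integral_def, frameIntegral, map_smul, smul_eq_mul]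
  rw [integral_const_mul]
  ring

theorem integral_sum {σ : Set (E n)} (μ : Weight (vectorSpan ℝ σ)) {ι : Type*} (J : Finset ι)
    {ζ : ι → E n → FormAlg n} (hζ : ∀ j ∈ J, ζ j ∈ TestForm n) :
    integral σ μ (fun x => ∑ j ∈ J, ζ j x) = ∑ j ∈ J, integral σ μ (ζ j) := by
  simp only [integral_def]
  rw [frameIntegral_sum _ (frame_linearIndependent μ) J (fun j hj => (hζ j hj).1.continuous)
    (fun j hj => (hζ j hj).2), Finset.mul_sum]

/-- The derivatives `d'T` and `d''T`. -/
def Current.ds (s : Bool) (T : Current n) : Current n := T ∘ₗ diffOpTest (dxs s) ∘ₗ signTest n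

/-- The first term is the polyhedral part of the derivative; the second is an exact form, ready for
`stokes`. -/
theorem Piece.eval_ds (P : Piece n) (s : Bool) (η : TestForm n) :
    P.eval (diffOpTest (dxs s) (signTest n η)) =
      integral P.carrier P.weight (fun x => diffOp (dxs s) P.form x * (η : E n → FormAlg n) x) -
      integral P.carrier P.weight
        (diffOp (dxs s) (fun x => (P.form : E n → FormAlg n) x * (η : E n → FormAlg n) x)) := by
  have h1 := mul_mem_testForm (diffOp_mem_smoothForm s P.form.2) η.2
  have h2 := diffOp_mem (dxs s) (mul_mem_testForm P.form.2 η.2)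
  have h3 : integral P.carrier P.weight
      (fun x => diffOp (dxs s) P.form x * (η : E n → FormAlg n) x) =
      P.eval (diffOpTest (dxs s) (signTest n η)) + integral P.carrier P.weight
        (diffOp (dxs s) (fun x => (P.form : E n → FormAlg n) x * (η : E n → FormAlg n) x)) := by
    rw [Piece.eval, ← integral_add _ (mul_mem_testForm P.form.2
      (diffOpTest (dxs s) (signTest n η)).2) h2]
    refine integral_congr P.isPolyhedron.measurableSet _ fun x _ => ?_
    have h4 := topValue_mul_diffOp_involute (fun i => (P.weight.frame i : E n)) s
      (f := P.form) (w := η) (x := x)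
      (((contDiff_of_mem P.form.2).differentiable (by simp)) x) ((η.2.1.differentiable (by simp)) x)
    rw [map_add]
    refine eq_add_of_sub_eq ?_
    exact h4.symm
  rw [h3]; ring

theorem Piece.eval_eq_zero (P : Piece n) (η : TestForm n)
    (h : ∀ x ∈ P.carrier, (η : E n → FormAlg n) x = 0) : P.eval η = 0 :=
  integral_eq_zero P.isPolyhedron.measurableSet _ fun x hx => by rw [h x hx, mul_zero]

theorem eq_zero_of_inter_tsupport {η : E n → FormAlg n} {σ : Set (E n)}
    (h : ¬ (σ ∩ tsupport η).Nonempty) {x : E n} (hx : x ∈ σ) : η x = 0 := by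
  by_contra hne
  exact h ⟨x, hx, subset_tsupport η hne⟩

theorem IsPolyhedron.finite_facets {σ : Set (E n)} (hσ : IsPolyhedron σ) :
    {τ | IsFacet τ σ}.Finite := by
  obtain ⟨H, hH⟩ := hσ.exists_isReduced
  refine (H.finite_toSet.image (wall σ)).subset fun τ hτ => ?_
  obtain ⟨h, hh, rfl⟩ := hH.exists_wall_eq hσ.convex hτ
  exact ⟨h, hh, rfl⟩

theorem IsLocallyFiniteSum.eq_sum {ι : Type} {P : ι → Piece n} {T : Current n}
    (h : IsLocallyFiniteSum P T) (η : TestForm n) (F : Finset ι)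
    (hF : ∀ i, ((P i).carrier ∩ tsupport (η : E n → FormAlg n)).Nonempty → i ∈ F) :
    T η = ∑ i ∈ F, (P i).eval η := by
  rw [h.2 η]
  refine finsum_eq_sum_of_support_subset _ fun i hi => ?_
  by_contra hiF
  exact hi (Piece.eval_eq_zero _ _ fun x hx =>
    eq_zero_of_inter_tsupport (fun hne => hiF (hF i hne)) hx)

theorem exists_finset_inter_tsupport {ι : Type} {P : ι → Piece n}
    (h : LocallyFinite (fun i => (P i).carrier)) (η : TestForm n) : ∃ F : Finset ι,
    ∀ i, ((P i).carrier ∩ tsupport (η : E n → FormAlg n)).Nonempty ↔ i ∈ F :=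
  ⟨(h.finite_nonempty_inter_compact η.2.2.isCompact).toFinset, fun i => by simp⟩

open Classical in
/-- The derivative of a current presented by a polyhedral datum. -/
theorem PolyhedralDatum.Presents.ds_eq {D : PolyhedralDatum n} {T : Current n} (h : D.Presents T)
    (s : Bool) (v : D.cells → D.cells → E n)
    (hv : ∀ τ σ : D.cells, IsFacet (τ : Set (E n)) σ →
      IsNormalVector (D.weight σ) (D.weight τ) (v τ σ)) (η : TestForm n) (F : Finset D.cells)
    (hF : ∀ σ : D.cells, ((σ : Set (E n)) ∩ tsupport (η : E n → FormAlg n)).Nonempty → σ ∈ F) :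
    T.ds s η = ∑ σ ∈ F, integral (σ : Set (E n)) (D.weight σ)
        (fun x => diffOp (dxs s) (D.form σ) x * (η : E n → FormAlg n) x) +
      ∑ τ ∈ F, ∑ σ ∈ F, if IsFacet (τ : Set (E n)) σ then
        integral (τ : Set (E n)) (D.weight τ)
          (fun x => kap s (v τ σ) ((D.form σ : E n → FormAlg n) x * (η : E n → FormAlg n) x))
        else 0 := by
  have hsupp : tsupport ((diffOpTest (dxs s) (signTest n η) : TestForm n) : E n → FormAlg n) ⊆
      tsupport (η : E n → FormAlg n) := by
    refine closure_minimal (fun x hx => ?_) (isClosed_tsupport _)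
    by_contra hcon
    apply hx
    have h1 : (fun y => CliffordAlgebra.involute ((η : E n → FormAlg n) y)) =ᶠ[𝓝 x]
        fun _ => (0 : FormAlg n) := by
      filter_upwards [(isClosed_tsupport (η : E n → FormAlg n)).isOpen_compl.mem_nhds hcon] with y hy
      rw [image_eq_zero_of_notMem_tsupport hy, map_zero]
    change diffOp (dxs s) (fun y => CliffordAlgebra.involute ((η : E n → FormAlg n) y)) x = 0
    simp [diffOp, h1.fderiv_eq]
  have h1 := IsLocallyFiniteSum.eq_sum h (diffOpTest (dxs s) (signTest n η)) F fun σ hσ =>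
    hF σ (hσ.mono (Set.inter_subset_inter_right _ hsupp))
  change T (diffOpTest (dxs s) (signTest n η)) = _
  rw [h1, Finset.sum_comm (s := F), ← Finset.sum_add_distrib]
  refine Finset.sum_congr rfl fun σ _ => ?_
  rw [Piece.eval_ds, sub_eq_add_neg]
  refine congrArg₂ (· + ·) rfl ?_
  -- `stokes` wants weights and normal vectors for arbitrary sets. The values off the complex are
  -- irrelevant, as facets of a cell are cells.
  let ν : ∀ τ : Set (E n), Weight (vectorSpan ℝ τ) := fun τ =>
    if hτ : τ ∈ D.cells then D.weight ⟨τ, hτ⟩ else (exists_weight _).some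
  have hν : ∀ τ : D.cells, ν τ = D.weight τ := fun τ => dif_pos τ.2
  let u : Set (E n) → E n := fun τ => if hτ : τ ∈ D.cells then v ⟨τ, hτ⟩ σ else 0
  have hu : ∀ τ : D.cells, u τ = v τ σ := fun τ => dif_pos τ.2
  have hfc : ∀ τ, IsFacet τ (σ : Set (E n)) → τ ∈ D.cells := fun τ hτ =>
    D.face_mem σ σ.2 τ hτ.1
  have hst := stokes (D.isPolyhedron σ σ.2) (D.weight σ) s
    (mul_mem_testForm (D.form σ).2 η.2) (D.isPolyhedron σ σ.2).finite_facets.toFinset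
    (fun τ => by simp) ν u (fun τ hτ => by
      have h2 := hν ⟨τ, hfc τ hτ⟩
      have h3 := hu ⟨τ, hfc τ hτ⟩
      simp only at h2 h3
      rw [h2, h3]
      exact hv ⟨τ, hfc τ hτ⟩ σ hτ)
  change -integral (σ : Set (E n)) (D.weight σ) (diffOp (dxs s)
    fun x => (D.form σ : E n → FormAlg n) x * (η : E n → FormAlg n) x) = _
  rw [hst, neg_neg, ← Finset.sum_filter]
  symm
  -- Facets of `σ` outside `F` miss the support of `η` and contribute zero, so only nonzero terms
  -- need to be matched.
  refine Finset.sum_bij_ne_zero (fun τ _ _ => (τ : Set (E n))) ?_ ?_ ?_ ?_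
  · intro τ hτ _
    simpa using (Finset.mem_filter.1 hτ).2
  · intro τ _ _ τ' _ _ heq
    exact Subtype.ext heq
  · intro τ hτ hne
    have hτf : IsFacet τ (σ : Set (E n)) := by simpa using hτ
    have hτc := hfc τ hτf
    have hmem : (⟨τ, hτc⟩ : D.cells) ∈ F := by
      refine hF _ ?_
      by_contra hcon
      apply hne
      refine integral_eq_zero (D.isPolyhedron τ hτc).measurableSet _ fun x hx => ?_
      rw [eq_zero_of_inter_tsupport hcon hx, mul_zero, map_zero]
    refine ⟨⟨τ, hτc⟩, Finset.mem_filter.2 ⟨hmem, hτf⟩, ?_, rfl⟩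
    have h2 := hν ⟨τ, hτc⟩
    have h3 := hu ⟨τ, hτc⟩
    simp only at h2 h3
    rwa [h2, h3] at hne
  · intro τ _ _
    rw [hν, hu]

end Derivative

end DeltaForm

end

noncomputable section

namespace DeltaForm

open scoped ContDiff
open MeasureTheory Filter Topology

/-! ### Balanced data have polyhedral derivatives -/

section Balancing

variable {n : ℕ}

/-- The projection along `N` onto the kernel of a retraction onto `N`. -/
def coprojection {N : Submodule ℝ (E n)} (p : E n →ₗ[ℝ] N) : E n →ₗ[ℝ] E n :=
  LinearMap.id - N.subtype ∘ₗ p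

theorem coprojection_apply {N : Submodule ℝ (E n)} (p : E n →ₗ[ℝ] N) (v : E n) :
    coprojection p v = v - p v := rfl

theorem coprojection_eq_zero {N : Submodule ℝ (E n)} {p : E n →ₗ[ℝ] N}
    (hp : p ∘ₗ N.subtype = LinearMap.id) {v : E n} (hv : v ∈ N) : coprojection p v = 0 := by
  have h := LinearMap.congr_fun hp ⟨v, hv⟩
  simp only [LinearMap.comp_apply, Submodule.subtype_apply, LinearMap.id_apply] at h
  rw [coprojection_apply, h, sub_self]

theorem kap_sum_single (s : Bool) (v : E n) (x : FormAlg n) :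
    kap s v x = ∑ j, v j • kap s (Pi.single j 1) x := by
  conv_lhs => rw [pi_eq_sum_univ' v]
  rw [map_sum, LinearMap.sum_apply]
  refine Finset.sum_congr rfl fun j _ => ?_
  rw [map_smul, LinearMap.smul_apply]

theorem PolyhedralDatum.finite_star (D : PolyhedralDatum n) (τ : D.cells) :
    {σ : D.cells | IsFacet (τ : Set (E n)) σ}.Finite := by
  obtain ⟨x, hx⟩ := (D.isPolyhedron τ τ.2).1
  exact (D.locallyFinite.point_finite x).subset fun σ hσ => hσ.1.subset hx

theorem PolyhedralDatum.Balanced.sum_eq_zero {D : PolyhedralDatum n} (hD : D.Balanced)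
    (τ : D.cells) {st : Finset D.cells} (hst : ∀ σ, σ ∈ st ↔ IsFacet (τ : Set (E n)) σ)
    {v : D.cells → E n} (hv : ∀ σ : D.cells, IsFacet (τ : Set (E n)) σ →
      IsNormalVector (D.weight σ) (D.weight τ) (v σ)) (l : Module.Dual ℝ (E n))
    (hl : ∀ u ∈ vectorSpan ℝ (τ : Set (E n)), l u = 0) {x : E n} (hx : x ∈ (τ : Set (E n))) :
    restrict (vectorSpan ℝ (τ : Set (E n)))
      (∑ σ ∈ st, l (v σ) • (D.form σ : E n → FormAlg n) x) = 0 := by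
  have h := hD τ v hv l.toAffineMap (fun a ha b hb => by
    have := hl _ (sub_mem_vectorSpan ha hb)
    rwa [map_sub, sub_eq_zero] at this) x hx
  rw [map_sum]
  simp only [map_smul]
  rw [← h]
  simp only [← hst]
  rw [finsum_mem_finset_eq_sum]
  rfl

/-- For balanced data the boundary term in the derivative is linear in the values of the test form. -/
theorem PolyhedralDatum.Balanced.topValue_sum_kap {D : PolyhedralDatum n} (hD : D.Balanced)
    (τ : D.cells) {st : Finset D.cells} (hst : ∀ σ, σ ∈ st ↔ IsFacet (τ : Set (E n)) σ)
    {v : D.cells → E n} (hv : ∀ σ : D.cells, IsFacet (τ : Set (E n)) σ →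
      IsNormalVector (D.weight σ) (D.weight τ) (v σ)) (s : Bool)
    {p : E n →ₗ[ℝ] vectorSpan ℝ (τ : Set (E n))}
    (hp : p ∘ₗ (vectorSpan ℝ (τ : Set (E n))).subtype = LinearMap.id)
    {x : E n} (hx : x ∈ (τ : Set (E n))) (y : FormAlg n) :
    topValue (fun i => ((D.weight τ).frame i : E n))
      (∑ σ ∈ st, kap s (v σ) ((D.form σ : E n → FormAlg n) x * y)) =
    topValue (fun i => ((D.weight τ).frame i : E n))
      ((∑ σ ∈ st, kap s (coprojection p (v σ)) ((D.form σ : E n → FormAlg n) x)) * y) := by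
  -- The tangential part `p (v σ)` of a normal vector gives a contraction that `topValue` kills.
  have h1 : ∀ σ : D.cells, topValue (fun i => ((D.weight τ).frame i : E n))
      (kap s (v σ) ((D.form σ : E n → FormAlg n) x * y)) =
      topValue (fun i => ((D.weight τ).frame i : E n))
      (kap s (coprojection p (v σ)) ((D.form σ : E n → FormAlg n) x * y)) := by
    intro σ
    rw [coprojection_apply, map_sub, LinearMap.sub_apply, map_sub,
      topValue_kap (fun i => ((D.weight τ).frame i : E n)) s
        (v := (p (v σ) : E n)) (by rw [span_frame]; exact (p (v σ)).2), sub_zero]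
  -- Expanding the transverse vectors in coordinates isolates, in front of each contraction of `y`,
  -- the balancing form of the linear function `u ↦ coprojection p u j`, which vanishes on `N_τ`.
  have h2 : ∑ σ ∈ st, CliffordAlgebra.involute ((D.form σ : E n → FormAlg n) x) *
      kap s (coprojection p (v σ)) y =
      ∑ j, CliffordAlgebra.involute (∑ σ ∈ st, (coprojection p (v σ)) j •
        (D.form σ : E n → FormAlg n) x) * kap s (Pi.single j 1) y := by
    simp only [map_sum, Finset.sum_mul, map_smul]
    rw [Finset.sum_comm]
    refine Finset.sum_congr rfl fun σ _ => ?_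
    rw [kap_sum_single, Finset.mul_sum]
    refine Finset.sum_congr rfl fun j _ => ?_
    rw [mul_smul_comm, smul_mul_assoc]
  have h3 : topValue (fun i => ((D.weight τ).frame i : E n))
      (∑ σ ∈ st, CliffordAlgebra.involute ((D.form σ : E n → FormAlg n) x) *
        kap s (coprojection p (v σ)) y) = 0 := by
    rw [h2, map_sum]
    refine Finset.sum_eq_zero fun j _ => ?_
    refine topValue_eq_zero_of_restrict (vectorSpan ℝ (τ : Set (E n))) _
      (fun i => ((D.weight τ).frame i).2) ?_
    have h4 := hD.sum_eq_zero τ hst hv (LinearMap.proj j ∘ₗ coprojection p)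
      (fun u hu => by rw [LinearMap.comp_apply, coprojection_eq_zero hp hu, map_zero]) hx
    simp only [LinearMap.comp_apply, LinearMap.proj_apply] at h4
    rw [map_mul, restrict_involute, h4, map_zero, zero_mul]
  rw [map_sum]
  simp only [h1]
  rw [← map_sum]
  simp only [kap_mul, Finset.sum_add_distrib]
  rw [map_add, h3, add_zero, Finset.sum_mul]

theorem sum_kap_mem_smoothForm {ι : Type*} (s : Bool) (J : Finset ι) (v : ι → E n)
    (f : ι → SmoothForm n) :
    (fun x => ∑ j ∈ J, kap s (v j) ((f j : E n → FormAlg n) x)) ∈ SmoothForm n := by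
  have h := Submodule.sum_mem (SmoothForm n) (t := J)
    (f := fun j x => kap s (v j) ((f j : E n → FormAlg n) x))
    fun j _ => linearMap_comp_mem_smoothForm (kap s (v j)) (f j).2
  convert h using 1
  funext x
  simp

/-- The derivatives of a current with a balanced presentation are polyhedral. -/
theorem PolyhedralDatum.Presents.isPolyhedral_ds {D : PolyhedralDatum n} {T : Current n}
    (h : D.Presents T) (hD : D.Balanced) (s : Bool) : IsPolyhedral (T.ds s) := by
  classical
  have hex : ∀ τ σ : D.cells, ∃ u, IsFacet (τ : Set (E n)) σ →
      IsNormalVector (D.weight σ) (D.weight τ) u := by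
    intro τ σ
    by_cases hf : IsFacet (τ : Set (E n)) σ
    · obtain ⟨u, hu⟩ := exists_isNormalVector hf (D.weight σ) (D.weight τ)
      exact ⟨u, fun _ => hu⟩
    · exact ⟨0, fun h => absurd h hf⟩
  choose v hv using hex
  choose p hp using fun τ : D.cells => exists_retraction (vectorSpan ℝ (τ : Set (E n)))
  let st : D.cells → Finset D.cells := fun τ => (D.finite_star τ).toFinset
  have hst : ∀ τ σ, σ ∈ st τ ↔ IsFacet (τ : Set (E n)) σ := fun τ σ => by simp [st]
  -- The pieces of `P₁` carry the derivatives of the forms. Those of `P₂` carry the forms left over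
  -- from the boundary, with normal vectors replaced by their transverse parts.
  let P₁ : D.cells → Piece n := fun σ => ⟨σ, D.isPolyhedron σ σ.2, D.weight σ,
    ⟨_, diffOp_mem_smoothForm s (D.form σ).2⟩⟩
  let P₂ : D.cells → Piece n := fun τ => ⟨τ, D.isPolyhedron τ τ.2, D.weight τ,
    ⟨_, sum_kap_mem_smoothForm s (st τ) (fun σ => coprojection (p τ) (v τ σ)) D.form⟩⟩
  refine ⟨D.cells ⊕ D.cells, Sum.elim P₁ P₂, ?_, fun η => ?_⟩
  · convert D.locallyFinite.sumElim D.locallyFinite using 2 with i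
    rcases i with i | i <;> rfl
  obtain ⟨F, hF⟩ := exists_finset_inter_tsupport (P := D.piece) D.locallyFinite η
  have hF' : ∀ σ : D.cells, ((σ : Set (E n)) ∩ tsupport (η : E n → FormAlg n)).Nonempty ↔ σ ∈ F :=
    hF
  have hsum : ∑ᶠ i, (Sum.elim P₁ P₂ i).eval η = ∑ σ ∈ F, (P₁ σ).eval η + ∑ τ ∈ F, (P₂ τ).eval η := by
    rw [finsum_eq_sum_of_support_subset (s := F.disjSum F), Finset.sum_disjSum]
    · rfl
    · intro i hi
      by_contra hcon
      apply hi
      rcases i with i | i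
      · refine Piece.eval_eq_zero _ _ fun x hx => eq_zero_of_inter_tsupport (fun hne => ?_) hx
        exact hcon (Finset.mem_coe.2 (Finset.inl_mem_disjSum.2 ((hF' i).1 hne)))
      · refine Piece.eval_eq_zero _ _ fun x hx => eq_zero_of_inter_tsupport (fun hne => ?_) hx
        exact hcon (Finset.mem_coe.2 (Finset.inr_mem_disjSum.2 ((hF' i).1 hne)))
  rw [hsum, h.ds_eq s v hv η F fun σ hσ => (hF' σ).1 hσ]
  refine congrArg₂ (· + ·) rfl (Finset.sum_congr rfl fun τ hτ => ?_)
  have hsub : st τ ⊆ F := fun σ hσ => (hF' σ).1 (((hF' τ).2 hτ).mono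
    (Set.inter_subset_inter_left _ ((hst τ σ).1 hσ).1.subset))
  have hfil : F.filter (fun σ : D.cells => IsFacet (τ : Set (E n)) σ) = st τ := by
    ext σ
    rw [Finset.mem_filter, ← hst]
    exact ⟨fun h => h.2, fun h => ⟨hsub h, h⟩⟩
  rw [← Finset.sum_filter, hfil, ← integral_sum _ _ fun σ _ =>
    linearMap_comp_mem_testForm _ (mul_mem_testForm (D.form σ).2 η.2)]
  exact integral_congr (D.isPolyhedron τ τ.2).measurableSet _ fun x hx =>
    hD.topValue_sum_kap τ (hst τ) (hv τ) s (hp τ) hx _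

end Balancing

end DeltaForm

end

noncomputable section

namespace DeltaForm

open scoped ContDiff
open MeasureTheory Filter Topology

/-! ### Polyhedral derivatives force balancing -/

section Localization

variable {n : ℕ}

theorem topValue_mul_cov_mul {d : ℕ} (b : Fin d → E n) (s : Bool) {l : Module.Dual ℝ (E n)}
    (hl : ∀ i, l (b i) = 0) (x y : FormAlg n) : topValue b (x * (cov s l * y)) = 0 := by
  rw [← mul_assoc, mul_cov, mul_assoc, topValue_cov_mul b s l hl]

/-- `kap s` contracts with vectors of kind `!s`, the kind of the covector. Since `l` vanishes on the
frame, only the term in which the contraction hits this covector survives; it produces the slope `l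
v` needed for balancing. -/
theorem topValue_kap_mul_cov_mul {d : ℕ} (b : Fin d → E n) (s : Bool) {l : Module.Dual ℝ (E n)}
    (hl : ∀ i, l (b i) = 0) (v : E n) (x y : FormAlg n) :
    topValue b (kap s v (x * (cov (!s) l * y))) =
      (bif s then (-1 : ℝ) else 1) * (l v * topValue b (CliffordAlgebra.involute x * y)) := by
  rw [kap_mul, map_add, topValue_mul_cov_mul b _ hl, zero_add, kap_eq, con_cov_mul, mul_smul_comm,
    map_smul, mul_sub, map_sub, topValue_mul_cov_mul b _ hl, sub_zero, mul_smul_comm, map_smul]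
  rfl

/-- A smooth function which vanishes exactly on a given affine subspace. -/
theorem exists_penalty {τ : Set (E n)} (hτ : τ.Nonempty) : ∃ q : E n → ℝ, ContDiff ℝ ∞ q ∧
    (∀ x, 0 ≤ q x) ∧ ∀ x, q x = 0 ↔ x ∈ affineSpan ℝ τ := by
  obtain ⟨x₀, hx₀⟩ := hτ
  obtain ⟨p, hp⟩ := exists_retraction (vectorSpan ℝ τ)
  refine ⟨fun x => ∑ j, (coprojection p (x - x₀) j) ^ 2, ?_, fun x => by positivity, fun x => ?_⟩
  · refine ContDiff.sum fun j _ => ContDiff.pow ?_ 2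
    exact (contDiff_dual (LinearMap.proj j ∘ₗ coprojection p)).comp
      (contDiff_id.sub contDiff_const)
  · rw [mem_affineSpan_iff hx₀, Finset.sum_eq_zero_iff_of_nonneg fun _ _ => sq_nonneg _]
    constructor
    · intro h
      have h1 : coprojection p (x - x₀) = 0 := by
        funext j
        simpa using h j (Finset.mem_univ j)
      rw [coprojection_apply, sub_eq_zero] at h1
      rw [h1]
      exact (p (x - x₀)).2
    · intro h j _
      rw [coprojection_eq_zero hp h]
      simp

/-- Since `ρ` is not contained in `S`, the subspace `S` meets the affine span of `ρ` in a null set.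
Elsewhere `q > 0`, so the exponentials, bounded by `1`, tend to zero almost everywhere. -/
theorem tendsto_integral_exp_smul {ρ : Set (E n)} (hρ : IsPolyhedron ρ)
    (μ : Weight (vectorSpan ℝ ρ)) {S : AffineSubspace ℝ (E n)} (hS : ¬ ρ ⊆ S) {q : E n → ℝ}
    (hq : Continuous q) (hq0 : ∀ x, 0 ≤ q x) (hqS : ∀ x, q x = 0 → x ∈ S) {ζ : E n → FormAlg n}
    (hζ : Continuous ζ) (hζc : HasCompactSupport ζ) :
    Tendsto (fun k : ℕ => integral ρ μ (fun x => Real.exp (-(k * q x)) • ζ x)) atTop (𝓝 0) := by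
  obtain ⟨y, hyρ, hyS⟩ := Set.not_subset.1 hS
  have hb := frame_linearIndependent μ
  have hbase := mem_affineSpan ℝ (basePoint_mem hρ.1)
  set b : Fin _ → E n := fun i => (μ.frame i : E n) with hbdef
  obtain ⟨t₀, ht₀⟩ := exists_add_sum_eq hbase (mem_affineSpan ℝ hyρ) (span_frame μ)
  have hnull := volume_preimage_affineSubspace (affFrame (basePoint ρ) b) S (t := t₀) (by
    rw [affFrame_apply, ht₀]; exact hyS)
  obtain ⟨L, hL⟩ : ∃ L : FormAlg n →ₗ[ℝ] ℝ, L = topValue b := ⟨_, rfl⟩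
  have hLc := continuous_linearMap_formAlg L
  have hg : Continuous (fun x => L (ζ x)) := hLc.comp hζ
  have hgc : HasCompactSupport (fun x => L (ζ x)) := hζc.comp_left (map_zero L)
  have hint := integrable_frame (basePoint ρ) hb hg hgc
  have hfr : Continuous (fun t : Fin _ → ℝ => basePoint ρ + ∑ i, t i • b i) :=
    (isClosedEmbedding_frame (basePoint ρ) hb).continuous
  have hlim : Tendsto (fun k : ℕ => ∫ t in {t : Fin _ → ℝ | basePoint ρ + ∑ i, t i • b i ∈ ρ},
      Real.exp (-(k * q (basePoint ρ + ∑ i, t i • b i))) * L (ζ (basePoint ρ + ∑ i, t i • b i)))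
      atTop (𝓝 (∫ t in {t : Fin _ → ℝ | basePoint ρ + ∑ i, t i • b i ∈ ρ}, (0 : ℝ))) := by
    refine tendsto_integral_of_dominated_convergence
      (fun t => ‖L (ζ (basePoint ρ + ∑ i, t i • b i))‖) (fun k => ?_) hint.norm.restrict
      (fun k => ?_) ?_
    · refine Continuous.aestronglyMeasurable ?_
      exact (Real.continuous_exp.comp ((continuous_const.mul (hq.comp hfr)).neg)).mul (hg.comp hfr)
    · refine Eventually.of_forall fun t => ?_
      rw [norm_mul, Real.norm_eq_abs, Real.abs_exp]
      refine mul_le_of_le_one_left (norm_nonneg _) ?_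
      rw [Real.exp_le_one_iff, neg_nonpos]
      exact mul_nonneg (Nat.cast_nonneg k) (hq0 _)
    · refine ae_restrict_of_ae ?_
      have : ∀ᵐ t : Fin _ → ℝ, t ∉ (affFrame (basePoint ρ) b) ⁻¹' (S : Set (E n)) :=
        measure_eq_zero_iff_ae_notMem.1 hnull
      filter_upwards [this] with t ht
      have hpos : 0 < q (basePoint ρ + ∑ i, t i • b i) := by
        refine lt_of_le_of_ne (hq0 _) fun h => ht ?_
        change affFrame (basePoint ρ) b t ∈ S
        rw [affFrame_apply]
        exact hqS _ h.symm
      rw [← zero_mul (L (ζ (basePoint ρ + ∑ i, t i • b i)))]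
      refine Tendsto.mul_const _ ?_
      refine Real.tendsto_exp_atBot.comp (tendsto_neg_atTop_atBot.comp ?_)
      exact Tendsto.atTop_mul_const hpos tendsto_natCast_atTop_atTop
  have heq : ∀ k : ℕ, integral ρ μ (fun x => Real.exp (-(k * q x)) • ζ x) =
      μ.scale * ∫ t in {t : Fin _ → ℝ | basePoint ρ + ∑ i, t i • b i ∈ ρ},
      Real.exp (-(k * q (basePoint ρ + ∑ i, t i • b i))) *
        L (ζ (basePoint ρ + ∑ i, t i • b i)) := by
    intro k
    rw [integral_def, frameIntegral, hL]
    simp only [map_smul, smul_eq_mul]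
    rfl
  simp only [heq]
  simpa using hlim.const_mul μ.scale

theorem vectorSpan_le_of_subset_affineSpan {ρ τ : Set (E n)} (h : ρ ⊆ affineSpan ℝ τ) :
    vectorSpan ℝ ρ ≤ vectorSpan ℝ τ := by
  have h1 := AffineSubspace.direction_le (affineSpan_le.2 h)
  rwa [direction_affineSpan, direction_affineSpan] at h1

theorem integral_mul_cov_mul_eq_zero {ρ : Set (E n)} (hρ : IsPolyhedron ρ)
    (μ : Weight (vectorSpan ℝ ρ)) (s : Bool) {l : Module.Dual ℝ (E n)}
    (hl : ∀ u ∈ vectorSpan ℝ ρ, l u = 0) (β : E n → FormAlg n) (f : E n → ℝ) (ξ : FormAlg n) :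
    integral ρ μ (fun x => β x * (f x • (cov s l * ξ))) = 0 := by
  rw [integral_congr hρ.measurableSet μ (ξ := fun _ => 0) fun x _ => ?_,
    integral_eq_zero hρ.measurableSet μ fun _ _ => rfl]
  rw [mul_smul_comm, map_smul, topValue_mul_cov_mul _ s fun i => hl _ (μ.frame i).2, map_zero,
    smul_zero]

/-- The homothety with centre `x` and ratio `t` maps `τ` into itself and carries the ball of radius
`ε` around `x₀` to the ball of radius `t * ε` around the new point. -/
theorem InRelint.combo {τ : Set (E n)} (hτ : Convex ℝ τ) {x₀ x : E n} (hx₀ : InRelint x₀ τ)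
    (hx : x ∈ τ) {t : ℝ} (ht : 0 < t) (ht1 : t ≤ 1) : InRelint (x + t • (x₀ - x)) τ := by
  obtain ⟨h0, ε, hε, h⟩ := hx₀
  refine ⟨hτ.add_smul_sub_mem hx h0 ⟨ht.le, ht1⟩, t * ε, by positivity, fun y hy hd => ?_⟩
  have h1 : x + t⁻¹ • (y - x) ∈ τ := by
    refine h _ ?_ ?_
    · have := AffineMap.lineMap_mem t⁻¹ (mem_affineSpan ℝ hx) hy
      rw [AffineMap.lineMap_apply] at this
      simpa [add_comm] using this
    · rw [dist_eq_norm] at hd ⊢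
      have h2 : x + t⁻¹ • (y - x) - x₀ = t⁻¹ • (y - (x + t • (x₀ - x))) := by
        rw [← sub_sub, smul_sub t⁻¹ (y - x), smul_smul, inv_mul_cancel₀ ht.ne', one_smul]
        abel
      rw [h2, norm_smul, Real.norm_of_nonneg (inv_nonneg.2 ht.le), inv_mul_lt_iff₀ ht]
      exact hd
  have h3 := hτ.add_smul_sub_mem hx h1 ⟨ht.le, ht1⟩
  rwa [add_sub_cancel_left, smul_smul, mul_inv_cancel₀ ht.ne', one_smul,
    add_sub_cancel] at h3

/-- The intersection of the two cells is a face of `τ` through a point of its relative interior,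
hence all of `τ`. -/
theorem PolyhedralComplex.subset_of_inRelint (D : PolyhedralComplex n) {σ τ : Set (E n)}
    (hσ : σ ∈ D.cells) (hτ : τ ∈ D.cells) {x : E n} (hx : InRelint x τ) (hxσ : x ∈ σ) :
    IsFace τ σ := by
  have h := D.inter_face σ hσ τ hτ ⟨x, hxσ, hx.1⟩
  have h2 := h.2.eq_of_inRelint hx ⟨hxσ, hx.1⟩
  rw [h2] at h
  exact h.1

/-- If a derivative of `T` is polyhedral, then testing it with forms concentrated near the polyhedron
`τ` shows that the balancing form at `τ` has vanishing integrals. -/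
theorem PolyhedralDatum.Presents.integral_balancing_eq_zero {D : PolyhedralDatum n} {T : Current n}
    (h : D.Presents T) {s : Bool} (hds : IsPolyhedral (T.ds s)) (τ : D.cells) {st : Finset D.cells}
    (hst : ∀ σ, σ ∈ st ↔ IsFacet (τ : Set (E n)) σ)
    {v : D.cells → E n} (hv : ∀ σ : D.cells, IsFacet (τ : Set (E n)) σ →
      IsNormalVector (D.weight σ) (D.weight τ) (v σ)) {l : Module.Dual ℝ (E n)}
    (hl : ∀ u ∈ vectorSpan ℝ (τ : Set (E n)), l u = 0) {x₀ : E n}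
    (hx₀ : InRelint x₀ (τ : Set (E n))) {χ : E n → ℝ} (hχ : ContDiff ℝ ∞ χ)
    (hχc : HasCompactSupport χ)
    (hcells : ∀ σ : D.cells, ((σ : Set (E n)) ∩ tsupport χ).Nonempty → x₀ ∈ (σ : Set (E n)))
    (ξ : FormAlg n) :
    integral (τ : Set (E n)) (D.weight τ) (fun x => χ x • (CliffordAlgebra.involute
      (∑ σ ∈ st, l (v σ) • (D.form σ : E n → FormAlg n) x) * ξ)) = 0 := by
  classical
  obtain ⟨q, hq, hq0, hqτ⟩ := exists_penalty (D.isPolyhedron τ τ.2).1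
  have hG : (fun x => χ x • (cov (!s) l * ξ)) ∈ TestForm n :=
    ⟨hχ.smul contDiff_const, HasCompactSupport.smul_right (f := χ)
      (f' := fun _ => cov (!s) l * ξ) hχc⟩
  -- These weights equal `1` on the affine span of `τ` and decay to zero off it.
  let φ : ℕ → E n → ℝ := fun k x => Real.exp (-(k * q x))
  have hφ : ∀ k, ContDiff ℝ ∞ (φ k) := fun k =>
    Real.contDiff_exp.comp ((contDiff_const.mul hq).neg)
  have hη : ∀ k, (fun x => φ k x • χ x • (cov (!s) l * ξ)) ∈ TestForm n := fun k =>
    ⟨(hφ k).smul hG.1, HasCompactSupport.smul_left (f := φ k) hG.2⟩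
  let η : ℕ → TestForm n := fun k => ⟨_, hη k⟩
  have hsupp : ∀ k, tsupport (η k : E n → FormAlg n) ⊆ tsupport χ := by
    intro k
    refine closure_mono fun x hx hcon => hx ?_
    change φ k x • χ x • (cov (!s) l * ξ) = 0
    rw [hcon, zero_smul, smul_zero]
  -- No polyhedral piece survives in the limit: inside the affine span of `τ` the covector of `l`
  -- restricts to zero, and otherwise the exponential decays almost everywhere.
  have hlim : ∀ (ρ : Set (E n)) (hρ : IsPolyhedron ρ) (μ : Weight (vectorSpan ℝ ρ))
      (β : SmoothForm n), Tendsto (fun k => integral ρ μ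
        (fun x => (β : E n → FormAlg n) x * (η k : E n → FormAlg n) x)) atTop (𝓝 0) := by
    intro ρ hρ μ β
    by_cases hsub : ρ ⊆ affineSpan ℝ (τ : Set (E n))
    · have h0 : ∀ k, integral ρ μ
          (fun x => (β : E n → FormAlg n) x * (η k : E n → FormAlg n) x) = 0 := by
        intro k
        have := integral_mul_cov_mul_eq_zero hρ μ (!s)
          (fun u hu => hl u (vectorSpan_le_of_subset_affineSpan hsub hu)) β
          (fun x => φ k x * χ x) ξ
        simpa only [mul_smul] using this
      simp only [h0]
      exact tendsto_const_nhds
    · have hβ := mul_mem_testForm β.2 hG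
      have := tendsto_integral_exp_smul hρ μ hsub hq.continuous hq0 (fun x => (hqτ x).1)
        hβ.1.continuous hβ.2
      refine this.congr fun k => congrArg _ (funext fun x => ?_)
      exact (mul_smul_comm (φ k x) ((β : E n → FormAlg n) x) _).symm
  have hleft : Tendsto (fun k => T.ds s (η k)) atTop (𝓝 0) := by
    obtain ⟨ι, Q, hQ⟩ := hds
    have hF := hQ.1.finite_nonempty_inter_compact hχc.isCompact
    have heq : ∀ k, T.ds s (η k) = ∑ i ∈ hF.toFinset, (Q i).eval (η k) := fun k =>
      hQ.eq_sum _ _ fun i hi => by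
        simpa using hi.mono (Set.inter_subset_inter_right _ (hsupp k))
    simp only [heq]
    have := tendsto_finsetSum hF.toFinset fun i _ =>
      hlim _ (Q i).isPolyhedron (Q i).weight (Q i).form
    rw [Finset.sum_const_zero] at this
    exact this
  have hex : ∀ τ' σ : D.cells, ∃ u, IsFacet (τ' : Set (E n)) σ →
      IsNormalVector (D.weight σ) (D.weight τ') u := by
    intro τ' σ
    by_cases hf : IsFacet (τ' : Set (E n)) σ
    · obtain ⟨u, hu⟩ := exists_isNormalVector hf (D.weight σ) (D.weight τ')
      exact ⟨u, fun _ => hu⟩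
    · exact ⟨0, fun h => absurd h hf⟩
  choose v' hv' using hex
  -- The given normal vectors are used at `τ`, arbitrary ones at all other cells.
  let w : D.cells → D.cells → E n := fun τ' σ => if τ' = τ then v σ else v' τ' σ
  have hw : ∀ τ' σ : D.cells, IsFacet (τ' : Set (E n)) σ →
      IsNormalVector (D.weight σ) (D.weight τ') (w τ' σ) := by
    intro τ' σ hf
    by_cases heq : τ' = τ
    · subst heq
      simpa [w] using hv σ hf
    · simpa [w, heq] using hv' τ' σ hf
  have hfin := D.locallyFinite.finite_nonempty_inter_compact hχc.isCompact
  -- `τ` and its star are adjoined even where they miss the support of `χ`, so that the boundary sum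
  -- at `τ` runs over all of `st`.
  obtain ⟨F, hF⟩ : ∃ F : Finset D.cells, F = hfin.toFinset ∪ insert τ st := ⟨_, rfl⟩
  have hFmem : ∀ σ : D.cells, ((σ : Set (E n)) ∩ tsupport χ).Nonempty → σ ∈ F := by
    intro σ hσ
    rw [hF, Finset.mem_union]
    left
    simpa using hσ
  have hτF : τ ∈ F := by rw [hF]; simp
  have hstF : st ⊆ F := by
    rw [hF]
    exact (Finset.subset_insert _ _).trans Finset.subset_union_right
  have hmain := fun k => h.ds_eq s w hw (η k) F fun σ hσ =>
    hFmem σ (hσ.mono (Set.inter_subset_inter_right _ (hsupp k)))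
  obtain ⟨C, hC⟩ : ∃ C : ℝ, C = (bif s then (-1 : ℝ) else 1) * integral (τ : Set (E n)) (D.weight τ)
      (fun x => χ x • (CliffordAlgebra.involute
        (∑ σ ∈ st, l (v σ) • (D.form σ : E n → FormAlg n) x) * ξ)) := ⟨_, rfl⟩
  have hsecond : ∀ τ' ∈ F, Tendsto (fun k => ∑ σ ∈ F, if IsFacet (τ' : Set (E n)) σ then
        integral (τ' : Set (E n)) (D.weight τ')
          (fun x => kap s (w τ' σ) ((D.form σ : E n → FormAlg n) x * (η k : E n → FormAlg n) x))
        else 0) atTop (𝓝 (if τ' = τ then C else 0)) := by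
    intro τ' hτ'
    by_cases heq : τ' = τ
    · subst heq
      rw [if_pos rfl]
      refine tendsto_const_nhds.congr fun k => ?_
      have hfil : F.filter (fun σ : D.cells => IsFacet (τ' : Set (E n)) σ) = st := by
        ext σ
        rw [Finset.mem_filter, ← hst]
        exact ⟨fun h => h.2, fun h => ⟨hstF h, h⟩⟩
      rw [← Finset.sum_filter, hfil, ← integral_sum _ _ fun σ _ =>
        linearMap_comp_mem_testForm _ (mul_mem_testForm (D.form σ).2 (η k).2), hC, ← integral_smul]
      refine integral_congr (D.isPolyhedron τ' τ'.2).measurableSet _ fun x hx => ?_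
      have hφ1 : φ k x = 1 := by
        simp only [φ, (hqτ x).2 (mem_affineSpan ℝ hx)]
        simp
      have hval : (η k : E n → FormAlg n) x = χ x • (cov (!s) l * ξ) := by
        change φ k x • χ x • (cov (!s) l * ξ) = _
        rw [hφ1, one_smul]
      rw [hval]
      simp only [mul_smul_comm, map_smul, map_sum, Finset.sum_mul, smul_mul_assoc,
        topValue_kap_mul_cov_mul _ s (fun i => hl _ ((D.weight τ').frame i).2), smul_eq_mul,
        Finset.mul_sum, w, if_true]
      refine Finset.sum_congr rfl fun σ _ => ?_
      ring
    · rw [if_neg heq]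
      suffices hzero : ∀ σ ∈ F, Tendsto (fun k => if IsFacet (τ' : Set (E n)) σ then
          integral (τ' : Set (E n)) (D.weight τ')
          (fun x => kap s (w τ' σ) ((D.form σ : E n → FormAlg n) x * (η k : E n → FormAlg n) x))
          else 0) atTop (𝓝 0) by
        have := tendsto_finsetSum F hzero
        rwa [Finset.sum_const_zero] at this
      intro σ _
      split_ifs with hf
      swap
      · exact tendsto_const_nhds
      by_cases hmeet : ((τ' : Set (E n)) ∩ tsupport χ).Nonempty
      · have hx₀' := hcells τ' hmeet
        have hface := D.subset_of_inRelint τ'.2 τ.2 hx₀ hx₀'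
        -- A cell other than `τ` that meets the support of `χ` has `τ` as a proper face, so it
        -- leaves the affine span of `τ` and its boundary term decays.
        have hsub : ¬ (τ' : Set (E n)) ⊆ affineSpan ℝ (τ : Set (E n)) := by
          intro hsub
          apply heq
          refine Subtype.ext (Set.Subset.antisymm (fun y hy => ?_) hface.subset)
          exact hface.mem_of_mem_affineSpan hy (hsub hy)
        have hβ := linearMap_comp_mem_testForm (kap s (w τ' σ))
          (mul_mem_testForm (D.form σ).2 hG)
        have := tendsto_integral_exp_smul (D.isPolyhedron τ' τ'.2) (D.weight τ') hsub
          hq.continuous hq0 (fun x => (hqτ x).1) hβ.1.continuous hβ.2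
        refine this.congr fun k => congrArg _ (funext fun x => ?_)
        rw [← map_smul]
        exact congrArg _ (mul_smul_comm (φ k x) ((D.form σ : E n → FormAlg n) x) _).symm
      · refine tendsto_const_nhds.congr fun k => ?_
        symm
        refine integral_eq_zero (D.isPolyhedron τ' τ'.2).measurableSet _ fun x hx => ?_
        rw [eq_zero_of_inter_tsupport (η := (η k : E n → FormAlg n))
          (fun hne => hmeet (hne.mono (Set.inter_subset_inter_right _ (hsupp k)))) hx, mul_zero,
          map_zero]
  have hright := (tendsto_finsetSum F fun σ _ => hlim _ (D.isPolyhedron σ σ.2) (D.weight σ)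
    ⟨_, diffOp_mem_smoothForm s (D.form σ).2⟩).add (tendsto_finsetSum F hsecond)
  have hCzero := tendsto_nhds_unique hleft (hright.congr fun k => (hmain k).symm)
  rw [Finset.sum_const_zero, zero_add, Finset.sum_ite_eq' F τ, if_pos hτF, hC] at hCzero
  refine (mul_eq_zero.1 hCzero.symm).resolve_left ?_
  cases s <;> simp

/-- A form on `τ` whose products with all bump functions near a point `x₀` of the relative interior
have integral zero vanishes at `x₀`. -/
theorem eq_zero_of_integral_bump {τ : Set (E n)} (hτ : IsPolyhedron τ)
    (μ : Weight (vectorSpan ℝ τ)) {x₀ : E n} (hx₀ : InRelint x₀ τ) {ζ : E n → FormAlg n}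
    (hζ : Continuous ζ) {U : Set (E n)} (hU : U ∈ 𝓝 x₀)
    (h : ∀ χ : E n → ℝ, ContDiff ℝ ∞ χ → HasCompactSupport χ → tsupport χ ⊆ U →
      integral τ μ (fun x => χ x • ζ x) = 0) :
    topValue (fun i => (μ.frame i : E n)) (ζ x₀) = 0 := by
  by_contra hne
  have hb := frame_linearIndependent μ
  have hbase := mem_affineSpan ℝ (basePoint_mem hτ.1)
  obtain ⟨hxτ, ε, hε, hball⟩ := hx₀
  obtain ⟨t₀, ht₀⟩ := exists_add_sum_eq hbase (mem_affineSpan ℝ hxτ) (span_frame μ)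
  set b : Fin _ → E n := fun i => (μ.frame i : E n) with hbdef
  obtain ⟨L, hL⟩ : ∃ L : FormAlg n →ₗ[ℝ] ℝ, L = topValue b := ⟨_, rfl⟩
  have hLc : Continuous (fun x => L (ζ x)) := (continuous_linearMap_formAlg L).comp hζ
  rw [← hL] at hne
  -- Multiplying by the constant `L (ζ x₀)` makes the integrand nonnegative near `x₀`, whatever the
  -- sign of that constant.
  have hV : {x | 0 < L (ζ x₀) * L (ζ x)} ∈ 𝓝 x₀ :=
    (isOpen_lt continuous_const (continuous_const.mul hLc)).mem_nhds (by
      simpa using mul_self_pos.2 hne)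
  obtain ⟨r, hr, hrsub⟩ := Metric.mem_nhds_iff.1
    (Filter.inter_mem (Filter.inter_mem hU hV) (Metric.ball_mem_nhds x₀ hε))
  let f : ContDiffBump x₀ := ⟨r / 4, r / 2, by positivity, by linarith⟩
  have hfs : tsupport f ⊆ Metric.ball x₀ r := by
    rw [f.tsupport_eq]
    exact Metric.closedBall_subset_ball (by simp only [f]; linarith)
  have h0 := h f f.contDiff f.hasCompactSupport fun x hx => (hrsub (hfs hx)).1.1
  rw [integral_def, mul_eq_zero, or_iff_right μ.scale_pos.ne',
    frameIntegral_eq_indicator _ _ hτ.measurableSet] at h0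
  -- Near `x₀` the polyhedron fills its affine span, so the indicator can be dropped and the
  -- integrand is continuous.
  have h1 : ∀ t : Fin _ → ℝ, τ.indicator (fun x => topValue b ((f x) • ζ x))
      (basePoint τ + ∑ i, t i • b i) =
      f (basePoint τ + ∑ i, t i • b i) * L (ζ (basePoint τ + ∑ i, t i • b i)) := by
    intro t
    by_cases ht : basePoint τ + ∑ i, t i • b i ∈ τ
    · rw [Set.indicator_of_mem ht, map_smul, hL]; rfl
    · rw [Set.indicator_of_notMem ht]
      have : f (basePoint τ + ∑ i, t i • b i) = 0 := by
        by_contra hcon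
        apply ht
        exact hball _ (add_sum_mem_affineSpan hbase (fun i => (μ.frame i).2) t)
          (hrsub (hfs (subset_tsupport _ hcon))).2
      rw [this, zero_mul]
  rw [integral_congr_ae (Eventually.of_forall h1)] at h0
  have hfr := isClosedEmbedding_frame (basePoint τ) hb
  have hcont : Continuous (fun t : Fin _ → ℝ => L (ζ x₀) * (f (basePoint τ + ∑ i, t i • b i) *
      L (ζ (basePoint τ + ∑ i, t i • b i)))) :=
    continuous_const.mul ((f.continuous.comp hfr.continuous).mul (hLc.comp hfr.continuous))
  have hcomp : HasCompactSupport (fun t : Fin _ → ℝ => L (ζ x₀) *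
      (f (basePoint τ + ∑ i, t i • b i) * L (ζ (basePoint τ + ∑ i, t i • b i)))) :=
    (HasCompactSupport.mul_right (f' := fun t : Fin _ → ℝ => L (ζ (basePoint τ + ∑ i, t i • b i)))
      (f.hasCompactSupport.comp_isClosedEmbedding hfr)).mul_left
  have hpos := hcont.integral_pos_of_hasCompactSupport_nonneg_nonzero (μ := volume) hcomp
    (fun t => by
      by_cases hz : f (basePoint τ + ∑ i, t i • b i) = 0
      · simp [hz]
      · have := (hrsub (hfs (subset_tsupport _ hz))).1.2
        have h2 : 0 < L (ζ x₀) * L (ζ (basePoint τ + ∑ i, t i • b i)) := this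
        have h3 := f.nonneg (x := basePoint τ + ∑ i, t i • b i)
        change 0 ≤ L (ζ x₀) * (f (basePoint τ + ∑ i, t i • b i) *
          L (ζ (basePoint τ + ∑ i, t i • b i)))
        nlinarith [mul_nonneg h3 h2.le]) (x := t₀) (by
      have h4 : f x₀ = 1 := f.one_of_mem_closedBall (by simp [f.rIn_pos.le])
      simp only [hbdef] at ht₀ ⊢
      rw [ht₀, h4, one_mul]
      exact mul_ne_zero hne hne)
  rw [integral_const_mul, h0, mul_zero] at hpos
  exact lt_irrefl _ hpos

theorem involute_injective {R M : Type*} [CommRing R] [AddCommGroup M] [Module R M] :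
    Function.Injective (CliffordAlgebra.involute (Q := (0 : QuadraticForm R M))) :=
  CliffordAlgebra.involute_involutive.injective

/-- Every presentation of a current with a polyhedral derivative is balanced. -/
theorem PolyhedralDatum.Presents.balanced {D : PolyhedralDatum n} {T : Current n}
    (h : D.Presents T) {s : Bool} (hds : IsPolyhedral (T.ds s)) : D.Balanced := by
  intro τ v hv z hz x hx
  have hst : ∀ σ, σ ∈ (D.finite_star τ).toFinset ↔ IsFacet (τ : Set (E n)) σ := fun σ => by simp
  generalize (D.finite_star τ).toFinset = st at hst
  have hl : ∀ u ∈ vectorSpan ℝ (τ : Set (E n)), z.linear u = 0 := fun u hu =>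
    eq_zero_of_mem_vectorSpan (fun a ha b hb => by
      rw [← sub_eq_zero, ← map_sub, ← vsub_eq_sub, AffineMap.linearMap_vsub, hz a ha b hb]
      simp) hu
  let B : E n → FormAlg n := fun y => ∑ σ ∈ st, z.linear (v σ) • (D.form σ : E n → FormAlg n) y
  have hB : Continuous B := continuous_finsetSum _ fun σ _ =>
    Continuous.const_smul (g := (D.form σ : E n → FormAlg n))
      (contDiff_of_mem (D.form σ).2).continuous (z.linear (v σ))
  have hrel : ∀ (ξ : FormAlg n) (y : E n), InRelint y (τ : Set (E n)) →
      topValue (fun i => ((D.weight τ).frame i : E n))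
        (CliffordAlgebra.involute (B y) * ξ) = 0 := by
    intro ξ y hy
    -- By local finiteness `y` has a neighbourhood that avoids all cells not containing `y`.
    have hU : ⋂ σ ∈ {σ : D.cells | y ∉ (σ : Set (E n))}, (σ : Set (E n))ᶜ ∈ 𝓝 y := by
      have := D.locallyFinite.iInter_compl_mem_nhds
        (fun σ => (D.isPolyhedron σ σ.2).isClosed) y
      simpa using this
    refine eq_zero_of_integral_bump (D.isPolyhedron τ τ.2) (D.weight τ) hy
      (ζ := fun y => CliffordAlgebra.involute (B y) * ξ) ?_ hU fun χ hχ hχc hχU => ?_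
    · exact (continuous_linearMap_formAlg (LinearMap.mulRight ℝ ξ ∘ₗ
        (CliffordAlgebra.involute : FormAlg n →ₐ[ℝ] FormAlg n).toLinearMap)).comp hB
    · refine h.integral_balancing_eq_zero hds τ hst hv hl hy hχ hχc (fun σ hσ => ?_) ξ
      by_contra hcon
      obtain ⟨u, hu1, hu2⟩ := hσ
      have := hχU hu2
      simp only [Set.mem_iInter] at this
      exact this σ hcon hu1
  -- The identity extends from the relative interior to all of `τ` by continuity along the segment
  -- from `x` to an interior point.
  have hall : ∀ ξ : FormAlg n, topValue (fun i => ((D.weight τ).frame i : E n))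
      (CliffordAlgebra.involute (B x) * ξ) = 0 := by
    intro ξ
    have hτc := (D.isPolyhedron τ τ.2).convex
    obtain ⟨x₀, hx₀⟩ := exists_inRelint hτc ⟨x, hx⟩
    obtain ⟨L, hL⟩ : ∃ L : FormAlg n →ₗ[ℝ] ℝ, L = topValue
      (fun i => ((D.weight τ).frame i : E n)) ∘ₗ (LinearMap.mulRight ℝ ξ ∘ₗ
        (CliffordAlgebra.involute : FormAlg n →ₐ[ℝ] FormAlg n).toLinearMap) := ⟨_, rfl⟩
    have hLB : ∀ y, L (B y) = topValue (fun i => ((D.weight τ).frame i : E n))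
      (CliffordAlgebra.involute (B y) * ξ) := fun y => by rw [hL]; rfl
    rw [← hLB]
    have hcont : Continuous (fun t : ℝ => L (B (x + t • (x₀ - x)))) :=
      (continuous_linearMap_formAlg L).comp (hB.comp (by fun_prop))
    have hlim : Tendsto (fun t : ℝ => L (B (x + t • (x₀ - x)))) (𝓝[>] 0) (𝓝 (L (B x))) := by
      have := (hcont.tendsto 0).mono_left (nhdsWithin_le_nhds (s := Set.Ioi 0))
      simpa using this
    refine tendsto_nhds_unique hlim (tendsto_const_nhds.congr' ?_)
    filter_upwards [Ioc_mem_nhdsGT (show (0 : ℝ) < 1 by norm_num)] with t ht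
    rw [hLB, hrel ξ _ (hx₀.combo hτc hx ht.1 ht.2)]
  have hfin := restrict_eq_zero_of_forall_topValue (vectorSpan ℝ (τ : Set (E n))) _
    (frame_linearIndependent (D.weight τ)) (span_frame (D.weight τ)) hall
  rw [restrict_involute] at hfin
  have hfin2 : restrict (vectorSpan ℝ (τ : Set (E n))) (B x) = 0 :=
    involute_injective (hfin.trans (map_zero _).symm)
  simp only [← hst]
  rw [finsum_mem_finset_eq_sum, ← hfin2, map_sum]
  simp only [map_smul]

end Localization

end DeltaForm

end

noncomputable section

namespace DeltaForm

open scoped ContDiff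
open MeasureTheory Filter Topology

/-! ## Regular subdivisions

A family `a h j` of affine functions, with `j` in a finite type, defines the convex piecewise affine
functions `max_j (a h j)`. Their common domains of linearity and the faces of these are the cells of a
polyhedral complex, under a condition of local finiteness. -/

section Subdivision

variable {n : ℕ} {I J : Type}

/-- `a h j` is maximal at `x` among the functions `a h j'`. -/
def Active (a : I → J → E n →ᵃ[ℝ] ℝ) (h : I) (j : J) (x : E n) : Prop :=
  ∀ j', a h j' x ≤ a h j x

/-- The points at which all functions are active that are active at `x`. -/
def cellOf (a : I → J → E n →ᵃ[ℝ] ℝ) (x : E n) : Set (E n) :=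
  {y | ∀ h j, Active a h j x → Active a h j y}

variable {a : I → J → E n →ᵃ[ℝ] ℝ}

theorem mem_cellOf_self (x : E n) : x ∈ cellOf a x := fun _ _ => id

theorem cellOf_subset {x y : E n} (h : y ∈ cellOf a x) : cellOf a y ⊆ cellOf a x :=
  fun _ hz i j hij => hz i j (h i j hij)

theorem exists_active [Finite J] [Nonempty J] (a : I → J → E n →ᵃ[ℝ] ℝ) (h : I) (x : E n) :
    ∃ j, Active a h j x :=
  Finite.exists_max fun j => a h j x

theorem Active.eq {h : I} {j j' : J} {x : E n} (hj : Active a h j x) (hj' : Active a h j' x) :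
    a h j x = a h j' x := le_antisymm (hj' j) (hj j')

theorem active_of_eq {h : I} {j j' : J} {x : E n} (hj : Active a h j x)
    (heq : a h j' x = a h j x) : Active a h j' x := fun k => (hj k).trans heq.ge

theorem apply_add_smul (f : E n →ᵃ[ℝ] ℝ) (x y : E n) (t : ℝ) :
    f (x + t • (x - y)) = f x + t * (f x - f y) := by
  have h1 := f.map_vadd x (t • (x - y))
  have h2 := f.linearMap_vsub x y
  simp only [vadd_eq_add, vsub_eq_sub, map_smul, smul_eq_mul] at h1 h2
  rw [add_comm x, h1, h2, add_comm]

/-- Functions active at a point strictly between two points of a cell are active at both. -/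
theorem active_of_between [Finite J] [Nonempty J] {x w u : E n} (hw : w ∈ cellOf a x)
    (hu : u ∈ cellOf a x) {t : ℝ} (ht : 0 < t) (hwu : w + t • (w - u) ∈ cellOf a x) :
    u ∈ cellOf a w := by
  intro h j hj
  obtain ⟨j₀, hj₀⟩ := exists_active a h x
  have h1 := hj.eq (hw h j₀ hj₀)
  have h2 := hu h j₀ hj₀ j
  have h3 := hwu h j₀ hj₀ j
  -- The affine function `a h j - a h j₀` is zero at `w` and at most zero at two points on opposite
  -- sides of `w`, so it vanishes at `u`.
  rw [apply_add_smul, apply_add_smul, h1] at h3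
  refine active_of_eq (hu h j₀ hj₀) (le_antisymm h2 ?_)
  nlinarith

/-- A system `a` is admissible if it has a constant zero member which, on bounded sets, is the only
active one for all but finitely many indices, and which is active only on bounded sets for suitable
indices. -/
structure Admissible (a : I → J → E n →ᵃ[ℝ] ℝ) (o : J) : Prop where
  zero : ∀ h x, a h o x = 0
  finite : ∀ R : ℝ, {h | ¬ ∀ x, ‖x‖ ≤ R → ∀ j, j ≠ o → a h j x < 0}.Finite
  bounded : ∀ R : ℝ, ∃ h, ∃ R' : ℝ, (∀ x, ‖x‖ ≤ R → ∀ j, j ≠ o → a h j x < 0) ∧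
    ∀ x, (∀ j, a h j x ≤ 0) → ‖x‖ ≤ R'

variable {o : J}

theorem Admissible.active_iff (ha : Admissible a o) {h : I} {x : E n}
    (hx : ∀ j, j ≠ o → a h j x < 0) (j : J) : Active a h j x ↔ j = o := by
  constructor
  · intro hj
    by_contra hne
    have := hj o
    rw [ha.zero] at this
    exact absurd (hx j hne) (not_lt.2 this)
  · rintro rfl j'
    rw [ha.zero]
    by_cases hj' : j' = j
    · rw [hj', ha.zero]
    · exact (hx j' hj').le

/-- Near a bounded set only finitely many indices matter. -/
theorem Admissible.exists_finset [Finite J] (ha : Admissible a o) (R : ℝ) :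
    ∃ F : Finset I, ∀ x, (∃ y, ‖y‖ ≤ R ∧ y ∈ cellOf a x) →
      cellOf a x = {y | ∀ h ∈ F, ∀ j, Active a h j x → Active a h j y} := by
  classical
  have : Nonempty J := ⟨o⟩
  -- The index `h₀` confines `x` to the ball of radius `R₀`. Then `h₁`, as a member of the finite
  -- set, confines every solution `z` of the finitely many conditions to the ball of radius `R₁`.
  -- For the indices left out, only `o` is active at `x` and at `z`.
  obtain ⟨h₀, R₀, h1, h2⟩ := ha.bounded R
  obtain ⟨h₁, R₁, h3, h4⟩ := ha.bounded R₀
  refine ⟨insert h₁ (ha.finite (max R₀ R₁)).toFinset, fun x => ?_⟩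
  rintro ⟨y, hy, hxy⟩
  have hx : ‖x‖ ≤ R₀ := by
    refine h2 x fun j => ?_
    obtain ⟨k, hk⟩ := exists_active a h₀ x
    have hko := (ha.active_iff (h1 y hy) k).1 (hxy h₀ k hk)
    have := hk j
    rwa [hko, ha.zero] at this
  refine Set.Subset.antisymm (fun z hz h _ => hz h) fun z hz => ?_
  have hz1 : ‖z‖ ≤ R₁ := by
    refine h4 z fun j => ?_
    have h5 := hz h₁ (Finset.mem_insert_self _ _) o ((ha.active_iff (h3 x hx) o).2 rfl) j
    rwa [ha.zero] at h5
  intro h j hj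
  by_cases hF : h ∈ insert h₁ (ha.finite (max R₀ R₁)).toFinset
  · exact hz h hF j hj
  · rw [Finset.mem_insert, not_or] at hF
    have h6 : ∀ x, ‖x‖ ≤ max R₀ R₁ → ∀ j, j ≠ o → a h j x < 0 := by
      have h7 := hF.2
      rw [Set.Finite.mem_toFinset] at h7
      exact not_not.1 h7
    rw [ha.active_iff (h6 x (hx.trans (le_max_left _ _)))] at hj
    rwa [ha.active_iff (h6 z (hz1.trans (le_max_right _ _)))]

theorem Admissible.exists_finset_cellOf [Finite J] (ha : Admissible a o) (x : E n) :
    ∃ F : Finset I, cellOf a x = {y | ∀ h ∈ F, ∀ j, Active a h j x → Active a h j y} := by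
  obtain ⟨F, hF⟩ := ha.exists_finset ‖x‖
  exact ⟨F, hF x ⟨x, le_rfl, mem_cellOf_self x⟩⟩

theorem affineMap_apply (f : E n →ᵃ[ℝ] ℝ) (x : E n) : f x = f.linear x + f 0 := by
  have := congrFun f.decomp x
  simpa using this

theorem Admissible.isPolyhedron_cellOf [Finite J] (ha : Admissible a o) (x : E n) :
    IsPolyhedron (cellOf a x) := by
  classical
  have := Fintype.ofFinite J
  refine ⟨⟨x, mem_cellOf_self x⟩, ?_⟩
  obtain ⟨F, hF⟩ := ha.exists_finset_cellOf x
  refine ⟨((F ×ˢ (Finset.univ : Finset (J × J))).filter fun k => Active a k.1 k.2.1 x).image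
    fun k => ((a k.1 k.2.2).linear - (a k.1 k.2.1).linear, a k.1 k.2.1 0 - a k.1 k.2.2 0), ?_⟩
  rw [hF]
  ext y
  simp only [Set.mem_ofPred_eq, Finset.mem_image, Finset.mem_filter, Finset.mem_product,
    Finset.mem_univ, and_true, forall_exists_index, and_imp]
  constructor
  · rintro h _ ⟨i, j, j'⟩ hi hj rfl
    have h1 := h i hi j hj j'
    rw [affineMap_apply (a i j'), affineMap_apply (a i j)] at h1
    simp only [LinearMap.sub_apply]
    linarith
  · intro h i hi j hj j'
    have h1 := h _ ⟨i, j, j'⟩ hi hj rfl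
    simp only [LinearMap.sub_apply] at h1
    rw [affineMap_apply (a i j'), affineMap_apply (a i j)]
    linarith

/-- Each point lies in the relative interior of its own cell. Functions active at `w` agree along
the line, inactive ones stay below for small `t`, and only finitely many indices matter. -/
theorem Admissible.exists_prolong [Finite J] (ha : Admissible a o) {w y : E n}
    (hy : y ∈ cellOf a w) : ∃ t : ℝ, 0 < t ∧ w + t • (w - y) ∈ cellOf a w := by
  obtain ⟨F, hF⟩ := ha.exists_finset_cellOf w
  have hev : ∀ h ∈ F, ∀ j j' : J, ∀ᶠ t : ℝ in 𝓝[>] 0, Active a h j w →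
      a h j' (w + t • (w - y)) ≤ a h j (w + t • (w - y)) := by
    intro h _ j j'
    by_cases hj : Active a h j w
    swap
    · exact Eventually.of_forall fun t h => absurd h hj
    simp only [apply_add_smul]
    by_cases hj' : Active a h j' w
    · refine Eventually.of_forall fun t _ => le_of_eq ?_
      rw [hj.eq hj', (hy h j hj).eq (hy h j' hj')]
    · have hlt : a h j' w < a h j w :=
        lt_of_le_of_ne (hj j') fun heq => hj' (active_of_eq hj heq)
      have hc : ∀ k, Tendsto (fun t : ℝ => a h k w + t * (a h k w - a h k y)) (𝓝[>] 0)
          (𝓝 (a h k w)) := by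
        intro k
        have : Continuous (fun t : ℝ => a h k w + t * (a h k w - a h k y)) := by fun_prop
        have := (this.tendsto 0).mono_left (nhdsWithin_le_nhds (s := Set.Ioi 0))
        simpa using this
      filter_upwards [(hc j').eventually_lt (hc j) hlt] with t ht _
      exact ht.le
  have hall : ∀ᶠ t : ℝ in 𝓝[>] 0, ∀ h ∈ F, ∀ j j', Active a h j w →
      a h j' (w + t • (w - y)) ≤ a h j (w + t • (w - y)) := by
    rw [Filter.eventually_all_finset]
    intro h hh
    rw [Filter.eventually_all]
    intro j
    rw [Filter.eventually_all]
    exact hev h hh j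
  obtain ⟨t, ht, ht0⟩ := (hall.and self_mem_nhdsWithin).exists
  refine ⟨t, ht0, ?_⟩
  rw [hF]
  exact fun h hh j hj j' => ht h hh j j' hj

/-- On the cell of `x` the function `a h (j₀ h)` realizes the maximum. The supporting function is
the sum of the differences `a h j - a h (j₀ h)` over the finitely many pairs in `K`, active at `y`;
all are at most zero, so the sum vanishes exactly where every one of them does. -/
theorem Admissible.isFace_inter [Finite J] (ha : Admissible a o) {x y : E n}
    (hne : (cellOf a x ∩ cellOf a y).Nonempty) : IsFace (cellOf a x ∩ cellOf a y) (cellOf a x) := by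
  classical
  have : Nonempty J := ⟨o⟩
  have := Fintype.ofFinite J
  obtain ⟨F, hF⟩ := ha.exists_finset_cellOf y
  choose j₀ hj₀ using fun h => exists_active a h x
  let K := (F ×ˢ (Finset.univ : Finset J)).filter fun k => Active a k.1 k.2 y
  have hle : ∀ z ∈ cellOf a x, ∀ k ∈ K, a k.1 k.2 z - a k.1 (j₀ k.1) z ≤ 0 := fun z hz k _ =>
    sub_nonpos.2 (hz _ _ (hj₀ k.1) k.2)
  have hsum : ∀ z, (∑ k ∈ K, ((a k.1 k.2).linear - (a k.1 (j₀ k.1)).linear)) z =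
      ∑ k ∈ K, (a k.1 k.2 z - a k.1 (j₀ k.1) z) - ∑ k ∈ K, (a k.1 k.2 0 - a k.1 (j₀ k.1) 0) := by
    intro z
    rw [LinearMap.sum_apply, ← Finset.sum_sub_distrib]
    refine Finset.sum_congr rfl fun k _ => ?_
    rw [affineMap_apply (a k.1 k.2) z, affineMap_apply (a k.1 (j₀ k.1)) z, LinearMap.sub_apply]
    ring
  refine isFace_iff.2 ⟨hne, ∑ k ∈ K, ((a k.1 k.2).linear - (a k.1 (j₀ k.1)).linear),
    -∑ k ∈ K, (a k.1 k.2 0 - a k.1 (j₀ k.1) 0), fun z hz => ?_, ?_⟩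
  · rw [hsum]
    linarith [Finset.sum_nonpos (hle z hz)]
  · ext z
    simp only [Set.mem_inter_iff, Set.mem_ofPred_eq, and_congr_right_iff]
    intro hz
    rw [hsum, sub_eq_neg_self, Finset.sum_eq_zero_iff_of_nonpos (hle z hz), hF]
    constructor
    · intro h k hk
      simp only [K, Finset.mem_filter, Finset.mem_product] at hk
      exact sub_eq_zero.2 ((h _ hk.1.1 _ hk.2).eq (hz _ _ (hj₀ k.1)))
    · intro h i hi j hj
      have := h (i, j) (by simp [K, hi, hj])
      exact active_of_eq (hz _ _ (hj₀ i)) (sub_eq_zero.1 this)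

/-- For `w` in the relative interior of the face, both inclusions follow by prolonging segments
beyond `w`: within the face this forces activity at `u`, and within the cell of `w` it forces `l` to
be maximal at `y`. -/
theorem Admissible.eq_cellOf_of_isFace [Finite J] (ha : Admissible a o) {x : E n} {τ : Set (E n)}
    (hτ : IsFace τ (cellOf a x)) : ∃ w, τ = cellOf a w := by
  have : Nonempty J := ⟨o⟩
  have hc := (ha.isPolyhedron_cellOf x).convex
  obtain ⟨w, hw⟩ := exists_inRelint (hτ.convex hc) hτ.1
  refine ⟨w, Set.Subset.antisymm (fun u hu => ?_) fun y hy => ?_⟩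
  · obtain ⟨t, ht, h⟩ := hw.exists_prolong (mem_affineSpan ℝ hu)
    exact active_of_between (hτ.subset hw.1) (hτ.subset hu) ht (hτ.subset h)
  · obtain ⟨-, l, m, hl, hτ'⟩ := isFace_iff.1 hτ
    have hwx := hτ.subset hw.1
    have hwm : l w = m := by
      have := hw.1
      rw [hτ'] at this
      exact this.2
    obtain ⟨t, ht, h⟩ := ha.exists_prolong hy
    have hyx := cellOf_subset hwx hy
    have h1 := hl _ (cellOf_subset hwx h)
    have h2 := hl y hyx
    rw [map_add, map_smul, map_sub, hwm, smul_eq_mul] at h1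
    rw [hτ']
    refine ⟨hyx, le_antisymm h2 ?_⟩
    nlinarith

/-- The complex of the cells of an admissible system. -/
def Admissible.complex [Finite J] (ha : Admissible a o) : PolyhedralComplex n where
  cells := Set.range (cellOf a)
  isPolyhedron := by
    rintro _ ⟨x, rfl⟩
    exact ha.isPolyhedron_cellOf x
  face_mem := by
    rintro _ ⟨x, rfl⟩ τ hτ
    obtain ⟨w, rfl⟩ := ha.eq_cellOf_of_isFace hτ
    exact ⟨w, rfl⟩
  inter_face := by
    rintro _ ⟨x, rfl⟩ _ ⟨y, rfl⟩ hne
    refine ⟨ha.isFace_inter hne, ?_⟩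
    rw [Set.inter_comm] at hne ⊢
    exact ha.isFace_inter hne
  locallyFinite := by
    classical
    intro x
    refine ⟨Metric.ball x 1, Metric.ball_mem_nhds x one_pos, ?_⟩
    obtain ⟨F, hF⟩ := ha.exists_finset (‖x‖ + 1)
    -- A cell that meets the ball is determined by its active pairs in the finite set `F × J`.
    have hfin : Set.Finite ((fun A : Set (F × J) => {y : E n | ∀ k ∈ A, Active a k.1 k.2 y}) ''
        Set.univ) := Set.finite_univ.image _
    refine Set.Finite.of_finite_image (f := Subtype.val) (hfin.subset ?_) Subtype.val_injective.injOn
    rintro _ ⟨⟨_, z, rfl⟩, ⟨y, hy1, hy2⟩, rfl⟩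
    refine ⟨{k | Active a k.1 k.2 z}, trivial, ?_⟩
    have hy : ‖y‖ ≤ ‖x‖ + 1 := by
      have := norm_le_norm_add_norm_sub' y x
      rw [Metric.mem_ball, dist_eq_norm] at hy2
      linarith
    change _ = cellOf a z
    rw [hF z ⟨y, hy, hy1⟩]
    ext u
    simp

end Subdivision

end DeltaForm

end

noncomputable section

namespace DeltaForm

open scoped ContDiff
open MeasureTheory Filter Topology

/-! ## Complexes adapted to a locally finite family of polyhedra -/

section Adapted

variable {n : ℕ} {I : Type}

/-- Linear forms with maximum the norm of `ℝⁿ`. -/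
def normForm : Option (Fin n × Bool) → Module.Dual ℝ (E n)
  | none => 0
  | some (i, true) => LinearMap.proj i
  | some (i, false) => -LinearMap.proj i

theorem normForm_le (d : Option (Fin n × Bool)) (x : E n) : normForm d x ≤ ‖x‖ := by
  rcases d with _ | ⟨i, _ | _⟩
  · simp [normForm]
  · have := (neg_le_abs (x i)).trans (norm_le_pi_norm x i)
    simpa [normForm] using this
  · have := (le_abs_self (x i)).trans (norm_le_pi_norm x i)
    simpa [normForm] using this

theorem exists_normForm_eq (x : E n) : ∃ d, normForm d x = ‖x‖ := by
  rcases isEmpty_or_nonempty (Fin n) with h | h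
  · refine ⟨none, ?_⟩
    rw [Subsingleton.elim x 0]
    simp
  · obtain ⟨i, hi⟩ := Finite.exists_max fun i => ‖x i‖
    have hx : ‖x‖ = |x i| := le_antisymm ((pi_norm_le_iff_of_nonneg (norm_nonneg _)).2 hi)
      (norm_le_pi_norm x i)
    rcases abs_cases (x i) with h' | h'
    · exact ⟨some (i, true), by rw [hx, h'.1]; rfl⟩
    · exact ⟨some (i, false), by rw [hx, h'.1]; rfl⟩

/-- A half-space `l ≤ c` with a radius `m` below which it plays no role, and a large slope. -/
structure Fence (n : ℕ) where
  l : Module.Dual ℝ (E n)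
  c : ℝ
  m : ℕ
  A : ℝ
  lt : ∀ x : E n, ‖x‖ ≤ m → |l x - c| < A / 2

theorem Fence.pos (f : Fence n) : 0 < f.A := by
  have := (abs_nonneg _).trans_lt (f.lt 0 (by simp))
  linarith

theorem exists_fence (l : Module.Dual ℝ (E n)) (c : ℝ) (m : ℕ) :
    ∃ f : Fence n, f.l = l ∧ f.c = c ∧ f.m = m := by
  have hc : Continuous fun x => |l x - c| := ((continuous_dual l).sub continuous_const).abs
  obtain ⟨C, hC⟩ := (isCompact_closedBall (0 : E n) m).bddAbove_image hc.continuousOn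
  refine ⟨⟨l, c, m, 2 * (C + 1), fun x hx => ?_⟩, rfl, rfl, rfl⟩
  have := hC ⟨x, by simpa using hx, rfl⟩
  simp only at this
  linarith

/-- The functions `0` and `A (‖x‖ - m + 1 / 2) ± (l - c)`, the norm being split into linear forms. -/
def Fence.fn (f : Fence n) : Option (Bool × Option (Fin n × Bool)) → E n →ᵃ[ℝ] ℝ
  | none => 0
  | some (b, d) => (f.A • normForm d + (bif b then (1 : ℝ) else -1) • f.l).toAffineMap +
      AffineMap.const ℝ (E n) (f.A * (1 / 2 - f.m) - (bif b then (1 : ℝ) else -1) * f.c)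

theorem Fence.fn_some (f : Fence n) (b : Bool) (d : Option (Fin n × Bool)) (x : E n) :
    f.fn (some (b, d)) x = f.A * (normForm d x - f.m + 1 / 2) +
      (bif b then (1 : ℝ) else -1) * (f.l x - f.c) := by
  simp [Fence.fn]
  ring

/-- In the ball of radius `m - 1` the first term is at most `-A / 2`, which outweighs `|l - c| < A /
2`. The fence is therefore invisible near the origin. -/
theorem Fence.fn_neg (f : Fence n) {x : E n} (hx : ‖x‖ + 1 ≤ f.m)
    (j : Option (Bool × Option (Fin n × Bool))) (hj : j ≠ none) : f.fn j x < 0 := by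
  obtain ⟨⟨b, d⟩, rfl⟩ := Option.ne_none_iff_exists'.1 hj
  rw [Fence.fn_some]
  have h1 := f.lt x (by linarith)
  have h2 := normForm_le d x
  have h3 := f.pos
  have h4 : f.A * (normForm d x - f.m + 1 / 2) ≤ f.A * (-(1 / 2)) :=
    mul_le_mul_of_nonneg_left (by linarith) h3.le
  have h5 := abs_lt.1 h1
  cases b <;> simp only [cond_true, cond_false] <;> linarith

theorem admissible_fence (f : I → Fence n) (hfin : ∀ R : ℕ, {h | (f h).m ≤ R}.Finite)
    (hball : ∀ k : ℕ, ∃ h, (f h).m = k ∧ (f h).l = 0 ∧ (f h).c = 0) :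
    Admissible (fun h => (f h).fn) none where
  zero h x := rfl
  finite R := by
    refine (hfin (⌈R⌉₊ + 1)).subset fun h hh => ?_
    by_contra hcon
    simp only [Set.mem_ofPred_eq, not_le] at hcon
    refine hh fun x hx => (f h).fn_neg ?_
    have h1 := Nat.le_ceil R
    have h2 : ((⌈R⌉₊ : ℝ) + 1) ≤ (f h).m := by exact_mod_cast hcon.le
    linarith
  bounded R := by
    obtain ⟨h, hm, hl, hc⟩ := hball (⌈R⌉₊ + 1)
    refine ⟨h, ⌈R⌉₊ + 1, fun x hx => (f h).fn_neg ?_, fun x hx => ?_⟩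
    · rw [hm]
      push_cast
      linarith [Nat.le_ceil R]
    · obtain ⟨d, hd⟩ := exists_normForm_eq x
      have h1 := hx (some (true, d))
      rw [Fence.fn_some, hl, hc, hd, hm] at h1
      simp only [LinearMap.zero_apply, sub_zero, mul_zero, add_zero] at h1
      have h2 := (f h).pos
      push_cast at h1
      by_contra hcon
      push Not at hcon
      have := mul_pos h2 (show 0 < ‖x‖ - (⌈R⌉₊ + 1) + 1 / 2 by linarith)
      linarith

/-- At norm at least `m` the maximum is `A (‖x‖ - m + 1 / 2) + |l - c|`, so `l x ≤ c` makes a branch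
with `-(l - c)` active. It stays active at `y`, and comparison with the branch of opposite sign and
the same `d` gives `l y ≤ c`. -/
theorem le_of_mem_cellOf_fence (f : I → Fence n) (h : I) {x y : E n} (hx : (f h).m ≤ ‖x‖)
    (hlx : (f h).l x ≤ (f h).c) (hy : y ∈ cellOf (fun h => (f h).fn) x) :
    (f h).l y ≤ (f h).c := by
  obtain ⟨d, hd⟩ := exists_normForm_eq x
  have hA := (f h).pos
  have hact : Active (fun h => (f h).fn) h (some (false, d)) x := by
    have h0 : 0 ≤ (f h).A * (‖x‖ - (f h).m + 1 / 2) := mul_nonneg hA.le (by linarith)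
    rintro (_ | ⟨b, d'⟩)
    · rw [Fence.fn_some, hd]
      change 0 ≤ _
      simp only [cond_false]
      linarith
    · rw [Fence.fn_some, Fence.fn_some, hd]
      have h1 : (f h).A * (normForm d' x - (f h).m + 1 / 2) ≤
          (f h).A * (‖x‖ - (f h).m + 1 / 2) :=
        mul_le_mul_of_nonneg_left (by linarith [normForm_le d' x]) hA.le
      cases b <;> simp only [cond_true, cond_false] <;> linarith
  have := hy h _ hact (some (true, d))
  rw [Fence.fn_some, Fence.fn_some] at this
  simp only [cond_true, cond_false] at this
  linarith

/-- `K` is adapted to `P` if `P` is a union of polyhedra of `K`. -/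
def PolyhedralComplex.Adapted (K : PolyhedralComplex n) (P : Set (E n)) : Prop :=
  ∀ x ∈ P, ∃ σ ∈ K.cells, x ∈ σ ∧ σ ⊆ P

/-- The boundary hyperplanes of all the polyhedra need not form a locally finite family. Each
half-space is therefore replaced by a fence whose radius is at most the distance of its polyhedron
from the origin: it is still effective on the polyhedron, and only finitely many fences reach into a
given ball. -/
theorem exists_adapted_complex {ι : Type} (P : ι → Set (E n)) (hP : ∀ i, IsPolyhedron (P i))
    (hfin : LocallyFinite P) : ∃ K : PolyhedralComplex n, ∀ i, K.Adapted (P i) := by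
  choose H hH using fun i => (hP i).2
  let m : ι → ℕ := fun i => ⌊Metric.infDist 0 (P i)⌋₊
  have hm : ∀ i, ∀ x ∈ P i, (m i : ℝ) ≤ ‖x‖ := by
    intro i x hx
    have h1 := Metric.infDist_le_dist_of_mem (x := 0) hx
    rw [dist_zero_left] at h1
    exact (Nat.floor_le Metric.infDist_nonneg).trans h1
  -- The summand `ℕ` supplies the fences with `l = 0` and `c = 0` of all radii that bound the cells.
  choose f hfl hfc hfm using fun k : (Σ i, H i) ⊕ ℕ =>
    exists_fence (n := n) (Sum.elim (fun q : Σ i, H i => q.2.1.1) (fun _ => 0) k)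
      (Sum.elim (fun q : Σ i, H i => q.2.1.2) (fun _ => 0) k)
      (Sum.elim (fun q : Σ i, H i => m q.1) id k)
  have hfinite : ∀ R : ℕ, {h | (f h).m ≤ R}.Finite := by
    intro R
    have h1 : {i | m i ≤ R}.Finite := by
      refine (hfin.finite_nonempty_inter_compact
        (isCompact_closedBall (0 : E n) (R + 1))).subset fun i hi => ?_
      obtain ⟨y, hy, hd⟩ := (hP i).isClosed.exists_infDist_eq_dist (hP i).1 (0 : E n)
      refine ⟨y, hy, ?_⟩
      rw [mem_closedBall_zero_iff, ← dist_zero_left, ← hd]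
      refine (Nat.lt_floor_add_one _).le.trans ?_
      have : (m i : ℝ) ≤ R := by exact_mod_cast hi
      linarith
    have h2 : (Sum.inl '' (Sigma.fst ⁻¹' {i | m i ≤ R}) ∪ Sum.inr '' {k | k ≤ R} :
        Set ((Σ i, H i) ⊕ ℕ)).Finite := by
      refine Set.Finite.union (Set.Finite.image _ ?_) ((Set.finite_le_nat R).image _)
      refine Set.Finite.preimage' h1 fun i _ => ?_
      refine (Set.finite_range (fun q : H i => (⟨i, q⟩ : Σ i, H i))).subset ?_
      rintro ⟨j, q⟩ rfl
      exact ⟨q, rfl⟩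
    refine h2.subset fun h hh => ?_
    simp only [Set.mem_ofPred_eq, hfm] at hh
    rcases h with h | h
    · exact Or.inl ⟨h, hh, rfl⟩
    · exact Or.inr ⟨h, hh, rfl⟩
  have ha := admissible_fence f hfinite fun k => ⟨Sum.inr k, hfm _, hfl _, hfc _⟩
  refine ⟨ha.complex, fun i x hx => ⟨_, ⟨x, rfl⟩, mem_cellOf_self x, fun y hy => ?_⟩⟩
  rw [hH i] at hx ⊢
  intro h hh
  have h1 := le_of_mem_cellOf_fence f (Sum.inl ⟨i, h, hh⟩) (x := x) (y := y)
    (by rw [hfm]; exact hm i x (by rw [hH i]; exact hx))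
    (by rw [hfl, hfc]; exact hx h hh) hy
  rw [hfl, hfc] at h1
  exact h1

end Adapted

end DeltaForm

end

noncomputable section

namespace DeltaForm

open scoped ContDiff
open MeasureTheory Filter Topology

/-! ## Presentations over a given complex -/

section Presentation

variable {n : ℕ}

theorem IsFace.eq_of_dim_le {τ σ : Set (E n)} (h : IsFace τ σ) (hd : dim σ ≤ dim τ) : τ = σ := by
  refine Set.Subset.antisymm h.subset fun x hx => h.mem_of_mem_affineSpan hx ?_
  obtain ⟨y, hy⟩ := h.1
  have hN : vectorSpan ℝ τ = vectorSpan ℝ σ :=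
    Submodule.eq_of_le_of_finrank_le (vectorSpan_mono ℝ h.subset) hd
  rw [mem_affineSpan_iff hy, hN]
  exact sub_mem_vectorSpan hx (h.subset hy)

theorem exists_weight_ratio {N : Submodule ℝ (E n)} (μ : Weight N) {σ : Set (E n)}
    (hσ : IsPolyhedron σ) (w : Weight (vectorSpan ℝ σ)) (hN : vectorSpan ℝ σ = N) :
    ∃ c : ℝ, ∀ (x₀ : E n) (ζ : E n → FormAlg n), basePoint σ - x₀ ∈ N →
      μ.scale * frameIntegral x₀ (fun i => (μ.frame i : E n)) σ ζ = c * integral σ w ζ := by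
  have hb := frame_linearIndependent w
  have hbN := (span_frame w).trans hN
  obtain ⟨c, hc, hμ⟩ := exists_toExt_eq μ hb hbN
  refine ⟨c / w.scale, fun x₀ ζ hx => ?_⟩
  rw [scale_mul_frameIntegral μ hσ.measurableSet hb hbN hx hc hμ, integral_def, ← mul_assoc,
    div_mul_cancel₀ _ w.scale_pos.ne']

-- Almost every point of `P` at which `ζ` is nonzero avoids the lower-dimensional cells in `F`, and
-- then it lies in exactly one cell of dimension `dim P` contained in `P`.
open Classical in
theorem frameIntegral_eq_sum_cells (K : PolyhedralComplex n) {P : Set (E n)} (hP : IsPolyhedron P)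
    (hK : K.Adapted P) (μ : Weight (vectorSpan ℝ P)) {ζ : E n → FormAlg n} (hζ : Continuous ζ)
    (hζc : HasCompactSupport ζ) (F : Finset K.cells)
    (hF : ∀ σ : K.cells, ((σ : Set (E n)) ∩ tsupport ζ).Nonempty → σ ∈ F) :
    frameIntegral (basePoint P) (fun i => (μ.frame i : E n)) P ζ =
      ∑ σ ∈ F.filter (fun σ : K.cells => (σ : Set (E n)) ⊆ P ∧ dim (σ : Set (E n)) = dim P),
        frameIntegral (basePoint P) (fun i => (μ.frame i : E n)) σ ζ := by
  have hb := frame_linearIndependent μ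
  have hbase := mem_affineSpan ℝ (basePoint_mem hP.1)
  have hspan := span_frame μ
  set b : Fin _ → E n := fun i => (μ.frame i : E n) with hbdef
  obtain ⟨L, hL⟩ : ∃ L : FormAlg n →ₗ[ℝ] ℝ, L = topValue b := ⟨_, rfl⟩
  have hg : Continuous (fun x => L (ζ x)) := (continuous_linearMap_formAlg L).comp hζ
  have hgc : HasCompactSupport (fun x => L (ζ x)) := hζc.comp_left (map_zero L)
  have hint := integrable_frame (basePoint P) hb hg hgc
  have hfr : Continuous (fun t : Fin _ → ℝ => basePoint P + ∑ i, t i • b i) :=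
    (isClosedEmbedding_frame (basePoint P) hb).continuous
  rw [frameIntegral_eq_indicator _ _ hP.measurableSet]
  have h1 : ∀ σ ∈ F.filter (fun σ : K.cells => (σ : Set (E n)) ⊆ P ∧ dim (σ : Set (E n)) = dim P),
      frameIntegral (basePoint P) b σ ζ = ∫ t : Fin _ → ℝ,
        (σ : Set (E n)).indicator (fun x => topValue b (ζ x)) (basePoint P + ∑ i, t i • b i) :=
    fun σ _ => frameIntegral_eq_indicator _ _ (K.isPolyhedron σ σ.2).measurableSet ζ
  rw [Finset.sum_congr rfl h1, ← integral_finsetSum _ fun σ _ => ?_]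
  swap
  · rw [← hL]
    exact hint.indicator ((K.isPolyhedron σ σ.2).measurableSet.preimage hfr.measurable)
  have hnull : ∀ ρ ∈ F.filter (fun ρ : K.cells => dim (ρ : Set (E n)) < dim P),
      ∀ᵐ t : Fin _ → ℝ, basePoint P + ∑ i, t i • b i ∉ affineSpan ℝ (ρ : Set (E n)) := by
    intro ρ hρ
    have hlt := (Finset.mem_filter.1 hρ).2
    have hnot : ¬ P ⊆ affineSpan ℝ (ρ : Set (E n)) := fun hsub =>
      absurd (Submodule.finrank_mono (vectorSpan_le_of_subset_affineSpan hsub)) (not_le.2 hlt)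
    obtain ⟨y, hyP, hy⟩ := Set.not_subset.1 hnot
    obtain ⟨t₀, ht₀⟩ := exists_add_sum_eq hbase (mem_affineSpan ℝ hyP) hspan
    have h2 := volume_preimage_affineSubspace (affFrame (basePoint P) b)
      (affineSpan ℝ (ρ : Set (E n))) (t := t₀) (by rw [affFrame_apply, ht₀]; exact hy)
    filter_upwards [measure_eq_zero_iff_ae_notMem.1 h2] with t ht
    rw [← affFrame_apply]
    exact ht
  refine integral_congr_ae ?_
  filter_upwards [(Filter.eventually_all_finset _).2 hnull] with t ht
  obtain ⟨x, hx⟩ : ∃ x, x = basePoint P + ∑ i, t i • b i := ⟨_, rfl⟩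
  rw [← hx] at ht ⊢
  by_cases hz : ζ x = 0
  · simp [Set.indicator_apply, hz]
  have hxs : x ∈ tsupport ζ := subset_tsupport ζ hz
  by_cases hxP : x ∈ P
  swap
  · rw [Set.indicator_of_notMem hxP, Finset.sum_eq_zero]
    intro σ hσ
    exact Set.indicator_of_notMem (fun h => hxP ((Finset.mem_filter.1 hσ).2.1 h)) _
  -- Off the null set, all cells through `x` have at least the dimension of `P`. Applied to the
  -- intersection of two full-dimensional cells, this makes the common face equal to both.
  have hgood : ∀ ρ : K.cells, x ∈ (ρ : Set (E n)) → dim P ≤ dim (ρ : Set (E n)) := by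
    intro ρ hxρ
    by_contra hcon
    exact ht ρ (Finset.mem_filter.2 ⟨hF ρ ⟨x, hxρ, hxs⟩, not_le.1 hcon⟩) (mem_affineSpan ℝ hxρ)
  obtain ⟨σ, hσ, hxσ, hσP⟩ := hK x hxP
  have hdσ : dim σ = dim P := le_antisymm
    (Submodule.finrank_mono (vectorSpan_mono ℝ hσP)) (hgood ⟨σ, hσ⟩ hxσ)
  rw [Set.indicator_of_mem hxP, Finset.sum_eq_single (⟨σ, hσ⟩ : K.cells)]
  · rw [Set.indicator_of_mem hxσ]
  · intro σ' hσ' hne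
    refine Set.indicator_of_notMem (fun hxσ' => hne ?_) _
    have hσ'm := (Finset.mem_filter.1 hσ').2
    obtain ⟨hf1, hf2⟩ := K.inter_face σ hσ σ' σ'.2 ⟨x, hxσ, hxσ'⟩
    have hd := hgood ⟨_, K.face_mem σ hσ _ hf1⟩ ⟨hxσ, hxσ'⟩
    have e1 := hf1.eq_of_dim_le (hdσ.le.trans hd)
    have e2 := hf2.eq_of_dim_le (hσ'm.2.le.trans hd)
    exact Subtype.ext (e2.symm.trans e1)
  · intro hcon
    exact absurd (Finset.mem_filter.2 ⟨hF ⟨σ, hσ⟩ ⟨x, hxσ, hxs⟩, hσP, hdσ⟩) hcon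

/-- A locally finite sum of weighted polyhedra, each a union of polyhedra of `K`, has a presentation
over `K`. -/
theorem IsLocallyFiniteSum.exists_presentation {ι : Type} {P : ι → Piece n} {T : Current n}
    (hT : IsLocallyFiniteSum P T) (K : PolyhedralComplex n) (hK : ∀ i, K.Adapted (P i).carrier)
    (w : ∀ σ : K.cells, Weight (vectorSpan ℝ (σ : Set (E n)))) :
    ∃ f : K.cells → SmoothForm n, (PolyhedralDatum.mk K w f).Presents T ∧
      ∀ σ : K.cells, ∃ (J : Finset ι) (c : ι → ℝ), f σ = ∑ i ∈ J, c i • (P i).form ∧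
        ∀ i ∈ J, dim (P i).carrier = dim (σ : Set (E n)) := by
  classical
  have hfin : ∀ σ : K.cells, {i | (σ : Set (E n)) ⊆ (P i).carrier ∧
      dim (σ : Set (E n)) = dim (P i).carrier}.Finite := by
    intro σ
    obtain ⟨x, hx⟩ := (K.isPolyhedron σ σ.2).1
    exact (hT.1.point_finite x).subset fun i hi => hi.1 hx
  -- On a full-dimensional subcell the two weights differ by a constant, which is absorbed into the
  -- form on the cell.
  have hratio : ∀ (i : ι) (σ : K.cells), ∃ c : ℝ, (σ : Set (E n)) ⊆ (P i).carrier ∧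
      dim (σ : Set (E n)) = dim (P i).carrier → ∀ ζ : E n → FormAlg n,
      (P i).weight.scale * frameIntegral (basePoint (P i).carrier)
        (fun j => ((P i).weight.frame j : E n)) σ ζ = c * integral (σ : Set (E n)) (w σ) ζ := by
    intro i σ
    by_cases h : (σ : Set (E n)) ⊆ (P i).carrier ∧ dim (σ : Set (E n)) = dim (P i).carrier
    · have hN : vectorSpan ℝ (σ : Set (E n)) = vectorSpan ℝ (P i).carrier :=
        Submodule.eq_of_le_of_finrank_le (vectorSpan_mono ℝ h.1) h.2.ge
      obtain ⟨c, hc⟩ := exists_weight_ratio (P i).weight (K.isPolyhedron σ σ.2) (w σ) hN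
      exact ⟨c, fun _ ζ => hc _ ζ (sub_mem_vectorSpan
        (h.1 (basePoint_mem (K.isPolyhedron σ σ.2).1)) (basePoint_mem (P i).isPolyhedron.1))⟩
    · exact ⟨0, fun h' => absurd h' h⟩
  choose c hc using hratio
  have hmem : ∀ σ i, i ∈ (hfin σ).toFinset ↔ (σ : Set (E n)) ⊆ (P i).carrier ∧
      dim (σ : Set (E n)) = dim (P i).carrier := fun σ i => by simp
  refine ⟨fun σ => ∑ i ∈ (hfin σ).toFinset, c i σ • (P i).form, ⟨K.locallyFinite, fun η => ?_⟩,
    fun σ => ⟨(hfin σ).toFinset, fun i => c i σ, rfl, fun i hi => ((hmem σ i).1 hi).2.symm⟩⟩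
  obtain ⟨F', hF'⟩ := exists_finset_inter_tsupport hT.1 η
  have hFfin := K.locallyFinite.finite_nonempty_inter_compact η.2.2.isCompact
  obtain ⟨F, hF⟩ : ∃ F : Finset K.cells, F = hFfin.toFinset := ⟨_, rfl⟩
  have hFm : ∀ σ : K.cells, σ ∈ F ↔ ((σ : Set (E n)) ∩ tsupport (η : E n → FormAlg n)).Nonempty :=
    fun σ => by rw [hF]; simp
  have hfs : ∑ᶠ σ, ((PolyhedralDatum.mk K w
      (fun σ => ∑ i ∈ (hfin σ).toFinset, c i σ • (P i).form)).piece σ).eval η =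
      ∑ σ ∈ F, ((PolyhedralDatum.mk K w
      (fun σ => ∑ i ∈ (hfin σ).toFinset, c i σ • (P i).form)).piece σ).eval η := by
    refine finsum_eq_sum_of_support_subset _ fun σ hσ => ?_
    by_contra hcon
    refine hσ (Piece.eval_eq_zero _ _ fun x hx => eq_zero_of_inter_tsupport (fun hne => ?_) hx)
    exact hcon (Finset.mem_coe.2 ((hFm σ).2 hne))
  rw [hfs, hT.eq_sum η F' fun i hi => (hF' i).1 hi]
  have hpiece : ∀ i, (P i).eval η = ∑ σ ∈ F, if (σ : Set (E n)) ⊆ (P i).carrier ∧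
      dim (σ : Set (E n)) = dim (P i).carrier then c i σ * integral (σ : Set (E n)) (w σ)
        (fun x => ((P i).form : E n → FormAlg n) x * (η : E n → FormAlg n) x) else 0 := by
    intro i
    have htest := mul_mem_testForm (P i).form.2 η.2
    rw [Piece.eval, integral_def, frameIntegral_eq_sum_cells K (P i).isPolyhedron (hK i)
      (P i).weight htest.1.continuous htest.2 F fun σ hσ => (hFm σ).2 (hσ.mono
        (Set.inter_subset_inter_right _ tsupport_mul_subset_right)), Finset.mul_sum, ← Finset.sum_filter]
    refine Finset.sum_congr rfl fun σ hσ => ?_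
    exact hc i σ (Finset.mem_filter.1 hσ).2 _
  have hcell : ∀ σ ∈ F, ((PolyhedralDatum.mk K w
      (fun σ => ∑ i ∈ (hfin σ).toFinset, c i σ • (P i).form)).piece σ).eval η =
      ∑ i ∈ F', if (σ : Set (E n)) ⊆ (P i).carrier ∧
      dim (σ : Set (E n)) = dim (P i).carrier then c i σ * integral (σ : Set (E n)) (w σ)
        (fun x => ((P i).form : E n → FormAlg n) x * (η : E n → FormAlg n) x) else 0 := by
    intro σ hσ
    have hfil : F'.filter (fun i => (σ : Set (E n)) ⊆ (P i).carrier ∧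
        dim (σ : Set (E n)) = dim (P i).carrier) = (hfin σ).toFinset := by
      ext i
      rw [Finset.mem_filter, hmem]
      refine ⟨fun h => h.2, fun h => ⟨(hF' i).1 (((hFm σ).1 hσ).mono
        (Set.inter_subset_inter_left _ h.1)), h⟩⟩
    rw [← Finset.sum_filter, hfil]
    simp only [← integral_smul]
    rw [← integral_sum (ζ := fun i x => c i σ • (((P i).form : E n → FormAlg n) x *
      (η : E n → FormAlg n) x)) _ _ fun i _ => (TestForm n).smul_mem (c i σ)
      (mul_mem_testForm (P i).form.2 η.2)]
    change integral (σ : Set (E n)) (w σ) _ = _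
    refine congrArg _ (funext fun x => ?_)
    have h3 : ((∑ i ∈ (hfin σ).toFinset, c i σ • (P i).form : SmoothForm n) : E n → FormAlg n) x =
        ∑ i ∈ (hfin σ).toFinset, c i σ • ((P i).form : E n → FormAlg n) x := by
      simp
    change ((∑ i ∈ (hfin σ).toFinset, c i σ • (P i).form : SmoothForm n) : E n → FormAlg n) x *
      (η : E n → FormAlg n) x = _
    rw [h3, Finset.sum_mul]
    refine Finset.sum_congr rfl fun i _ => ?_
    exact smul_mul_assoc _ _ _
  rw [Finset.sum_congr rfl hcell, Finset.sum_congr rfl fun i _ => hpiece i, Finset.sum_comm]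

theorem IsPolyhedral.exists_presentation {T : Current n} (hT : IsPolyhedral T) :
    ∃ D : PolyhedralDatum n, D.Presents T := by
  obtain ⟨ι, P, hP⟩ := hT
  obtain ⟨K, hK⟩ := exists_adapted_complex (fun i => (P i).carrier) (fun i => (P i).isPolyhedron)
    hP.1
  obtain ⟨f, hf, -⟩ := hP.exists_presentation K hK fun σ => (exists_weight _).some
  exact ⟨_, hf⟩

theorem IsDeltaForm.isPolyhedral_ds {T : Current n} (h : IsDeltaForm T) (s : Bool) :
    IsPolyhedral (T.ds s) := by
  cases s
  · exact h.2.1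
  · exact h.2.2

theorem PolyhedralDatum.Presents.isPolyhedral {D : PolyhedralDatum n} {T : Current n}
    (h : D.Presents T) : IsPolyhedral T := ⟨_, _, h⟩

theorem PolyhedralDatum.Presents.isDeltaForm {D : PolyhedralDatum n} {T : Current n}
    (h : D.Presents T) (hD : D.Balanced) : IsDeltaForm T :=
  ⟨h.isPolyhedral, h.isPolyhedral_ds hD false, h.isPolyhedral_ds hD true⟩

theorem PolyhedralDatum.Presents.isDeltaForm_iff {D : PolyhedralDatum n} {T : Current n}
    (h : D.Presents T) : IsDeltaForm T ↔ D.Balanced :=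
  ⟨fun hT => h.balanced (hT.isPolyhedral_ds false), h.isDeltaForm⟩

theorem isDeltaForm_iff_isBalanced {T : Current n} (hT : IsPolyhedral T) :
    IsDeltaForm T ↔ IsBalanced T := by
  constructor
  · intro h
    obtain ⟨D, hD⟩ := hT.exists_presentation
    exact ⟨D, hD, hD.isDeltaForm_iff.1 h⟩
  · rintro ⟨D, hD, hb⟩
    exact hD.isDeltaForm hb

theorem isDeltaForm_of_isPolyhedral_ds {T : Current n} (hT : IsPolyhedral T) {s : Bool}
    (hs : IsPolyhedral (T.ds s)) : IsDeltaForm T := by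
  obtain ⟨D, hD⟩ := hT.exists_presentation
  exact hD.isDeltaForm (hD.balanced hs)

end Presentation

end DeltaForm

end

noncomputable section

namespace DeltaForm

open scoped ContDiff
open MeasureTheory Filter Topology

/-! ## Bidegrees -/

section Bidegree

variable {n : ℕ}

theorem mul_mem_bidegree {p q : ℕ} (f : Fin p → Module.Dual ℝ (E n))
    (g : Fin q → Module.Dual ℝ (E n)) :
    ExteriorAlgebra.ιMulti ℝ p (fun i => ((f i, 0) : Cotangent n)) *
      ExteriorAlgebra.ιMulti ℝ q (fun j => ((0, g j) : Cotangent n)) ∈ bidegree n p q :=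
  Submodule.subset_span ⟨f, g, rfl⟩

theorem bidegree_induction {p q : ℕ} {V : Submodule ℝ (FormAlg n)} (L : FormAlg n →ₗ[ℝ] FormAlg n)
    (h : ∀ (f : Fin p → Module.Dual ℝ (E n)) (g : Fin q → Module.Dual ℝ (E n)),
      L (ExteriorAlgebra.ιMulti ℝ p (fun i => ((f i, 0) : Cotangent n)) *
        ExteriorAlgebra.ιMulti ℝ q (fun j => ((0, g j) : Cotangent n))) ∈ V) {x : FormAlg n}
    (hx : x ∈ bidegree n p q) : L x ∈ V := by
  have : bidegree n p q ≤ V.comap L := by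
    rw [bidegree, Submodule.span_le]
    rintro _ ⟨f, g, rfl⟩
    exact h f g
  exact this hx

theorem involute_mem_bidegree {p q : ℕ} {x : FormAlg n} (hx : x ∈ bidegree n p q) :
    CliffordAlgebra.involute x ∈ bidegree n p q := by
  refine bidegree_induction (V := bidegree n p q)
    (CliffordAlgebra.involute : FormAlg n →ₐ[ℝ] FormAlg n).toLinearMap (fun f g => ?_) hx
  rw [AlgHom.toLinearMap_apply, map_mul, involute_ιMulti, involute_ιMulti, smul_mul_smul_comm]
  exact Submodule.smul_mem _ _ (mul_mem_bidegree f g)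

theorem cov_false_mul_mem_bidegree {p q : ℕ} (l : Module.Dual ℝ (E n)) {x : FormAlg n}
    (hx : x ∈ bidegree n p q) : cov false l * x ∈ bidegree n (p + 1) q := by
  refine bidegree_induction (V := bidegree n (p + 1) q) (LinearMap.mulLeft ℝ (cov false l))
    (fun f g => ?_) hx
  have h := mul_mem_bidegree (Fin.cons l f : Fin (p + 1) → Module.Dual ℝ (E n)) g
  rw [ExteriorAlgebra.ιMulti_succ_apply, mul_assoc] at h
  exact h

theorem cov_true_mul_mem_bidegree {p q : ℕ} (l : Module.Dual ℝ (E n)) {x : FormAlg n}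
    (hx : x ∈ bidegree n p q) : cov true l * x ∈ bidegree n p (q + 1) := by
  have h0 : cov true l * x = CliffordAlgebra.involute x * cov true l := by
    rw [mul_cov, CliffordAlgebra.involute_involute]
  rw [h0]
  refine bidegree_induction (V := bidegree n p (q + 1)) (LinearMap.mulRight ℝ (cov true l))
    (fun f g => ?_) (involute_mem_bidegree hx)
  have h := mul_mem_bidegree f (Fin.snoc g l : Fin (q + 1) → Module.Dual ℝ (E n))
  have h1 : (fun j => ((0, (Fin.snoc g l : Fin (q + 1) → Module.Dual ℝ (E n)) j) : Cotangent n)) =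
      Fin.snoc (fun j => ((0, g j) : Cotangent n)) (0, l) := by
    funext j
    induction j using Fin.lastCases <;> simp
  rw [h1, ιMulti_snoc, ← mul_assoc] at h
  exact h

theorem bidegree_eq_bot {p q : ℕ} (h : n < p ∨ n < q) : bidegree n p q = ⊥ := by
  have key : ∀ {k : ℕ} (L : Module.Dual ℝ (E n) →ₗ[ℝ] Cotangent n)
      (f : Fin k → Module.Dual ℝ (E n)), n < k → ExteriorAlgebra.ιMulti ℝ k (L ∘ f) = 0 := by
    intro k L f hk
    refine AlternatingMap.map_linearDependent _ _ fun hli => ?_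
    have := (LinearIndependent.of_comp L hli).fintype_card_le_finrank
    rw [Fintype.card_fin, Subspace.dual_finrank_eq, Module.finrank_fin_fun] at this
    omega
  rw [bidegree, Submodule.span_eq_bot]
  rintro _ ⟨f, g, rfl⟩
  rcases h with h | h
  · exact mul_eq_zero_of_left (key (LinearMap.inl ℝ _ _) f h) _
  · exact mul_eq_zero_of_right _ (key (LinearMap.inr ℝ _ _) g h)

theorem ι_eq_cov (m : Cotangent n) : ExteriorAlgebra.ι ℝ m = cov false m.1 + cov true m.2 := by
  simp [cov, ← map_add]

theorem exists_bidegree_sum (x : FormAlg n) : ∃ f : ℕ → ℕ → FormAlg n,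
    (∀ p q, f p q ∈ bidegree n p q) ∧
      x = ∑ p ∈ Finset.range (n + 1), ∑ q ∈ Finset.range (n + 1), f p q := by
  induction x using exterior_left_induction with
  | alg r =>
    refine ⟨fun p q => if p = 0 ∧ q = 0 then algebraMap ℝ _ r else 0, fun p q => ?_, ?_⟩
    · beta_reduce
      split_ifs with h
      · obtain ⟨rfl, rfl⟩ := h
        have := (bidegree n 0 0).smul_mem r
          (mul_mem_bidegree (n := n) (p := 0) (q := 0) Fin.elim0 Fin.elim0)
        rw [ExteriorAlgebra.ιMulti_zero_apply, ExteriorAlgebra.ιMulti_zero_apply, mul_one] at this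
        rwa [Algebra.algebraMap_eq_smul_one]
      · exact zero_mem _
    · rw [Finset.sum_eq_single 0 (fun p _ hp => Finset.sum_eq_zero fun q _ => by simp [hp])
        (by simp), Finset.sum_eq_single 0 (fun q _ hq => by simp [hq]) (by simp)]
      simp
  | add x y hx hy =>
    obtain ⟨f, hf, hfx⟩ := hx
    obtain ⟨g, hg, hgy⟩ := hy
    refine ⟨fun p q => f p q + g p q, fun p q => add_mem (hf p q) (hg p q), ?_⟩
    simp only [Finset.sum_add_distrib]
    rw [← hfx, ← hgy]
  | mul x m hx =>
    obtain ⟨f, hf, hfx⟩ := hx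
    refine ⟨fun p q => (match p with | 0 => 0 | p + 1 => cov false m.1 * f p q) +
      (match q with | 0 => 0 | q + 1 => cov true m.2 * f p q), fun p q => add_mem ?_ ?_, ?_⟩
    · rcases p with _ | p
      · exact zero_mem _
      · exact cov_false_mul_mem_bidegree _ (hf p q)
    · rcases q with _ | q
      · exact zero_mem _
      · exact cov_true_mul_mem_bidegree _ (hf p q)
    · have h1 : ∀ q, cov false m.1 * f n q = 0 := fun q => by
        have := cov_false_mul_mem_bidegree m.1 (hf n q)
        rwa [bidegree_eq_bot (Or.inl (Nat.lt_succ_self n)), Submodule.mem_bot] at this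
      have h2 : ∀ p, cov true m.2 * f p n = 0 := fun p => by
        have := cov_true_mul_mem_bidegree m.2 (hf p n)
        rwa [bidegree_eq_bot (Or.inr (Nat.lt_succ_self n)), Submodule.mem_bot] at this
      simp only [Finset.sum_add_distrib]
      rw [ι_eq_cov, add_mul]
      congr 1
      · rw [Finset.sum_range_succ', hfx, Finset.mul_sum, Finset.sum_range_succ]
        simp only [Finset.mul_sum, h1, Finset.sum_const_zero]
      · rw [hfx, Finset.mul_sum]
        refine Finset.sum_congr rfl fun p _ => ?_
        rw [Finset.mul_sum, Finset.sum_range_succ, h2, Finset.sum_range_succ']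

/-- Decompositions are chosen on a basis and extended linearly, so that they preserve smoothness of
forms. Uniqueness of the components is not needed here. -/
theorem exists_bidegree_projections (n : ℕ) : ∃ π : ℕ → ℕ → FormAlg n →ₗ[ℝ] FormAlg n,
    (∀ p q x, π p q x ∈ bidegree n p q) ∧
      ∀ x, x = ∑ p ∈ Finset.range (n + 1), ∑ q ∈ Finset.range (n + 1), π p q x := by
  choose f hf hfx using fun x : FormAlg n => exists_bidegree_sum x
  let B := Module.finBasis ℝ (FormAlg n)
  refine ⟨fun p q => B.constr ℝ fun k => f (B k) p q, fun p q x => ?_, fun x => ?_⟩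
  · rw [Module.Basis.constr_apply_fintype]
    exact Submodule.sum_mem _ fun k _ => Submodule.smul_mem _ _ (hf _ p q)
  · have h : (LinearMap.id : FormAlg n →ₗ[ℝ] FormAlg n) = ∑ p ∈ Finset.range (n + 1),
        ∑ q ∈ Finset.range (n + 1), B.constr ℝ fun k => f (B k) p q := by
      refine B.ext fun k => ?_
      simp only [LinearMap.sum_apply, Module.Basis.constr_basis, LinearMap.id_apply]
      exact hfx (B k)
    have h2 := LinearMap.congr_fun h x
    simpa only [LinearMap.sum_apply, LinearMap.id_apply] using h2

/-- The automorphism which multiplies forms of bidegree `(p, q)` by `2 ^ p * 3 ^ q`. -/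
def bigrading (M : Type*) [AddCommGroup M] [Module ℝ M] :
    ExteriorAlgebra ℝ (M × M) →ₐ[ℝ] ExteriorAlgebra ℝ (M × M) :=
  ExteriorAlgebra.map (((2 : ℝ) • LinearMap.id).prodMap ((3 : ℝ) • LinearMap.id))

theorem bigrading_eq {p q : ℕ} {x : FormAlg n} (hx : x ∈ bidegree n p q) :
    bigrading (Module.Dual ℝ (E n)) x = ((2 : ℝ) ^ p * 3 ^ q) • x := by
  have h : ((bigrading (Module.Dual ℝ (E n))).toLinearMap -
      ((2 : ℝ) ^ p * 3 ^ q) • (LinearMap.id : FormAlg n →ₗ[ℝ] FormAlg n)) x ∈ (⊥ : Submodule ℝ (FormAlg n)) := by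
    refine bidegree_induction _ (fun f g => ?_) hx
    have key : ∀ {k : ℕ} (c : ℝ) (L : Module.Dual ℝ (E n) →ₗ[ℝ] Cotangent n)
        (f : Fin k → Module.Dual ℝ (E n)),
        ExteriorAlgebra.ιMulti ℝ k (fun i => L (c • f i)) =
          c ^ k • ExteriorAlgebra.ιMulti ℝ k (fun i => L (f i)) := by
      intro k c L f
      have := (ExteriorAlgebra.ιMulti ℝ (M := Cotangent n) k).toMultilinearMap.map_smul_univ
        (fun _ => c) (fun i => L (f i))
      simpa using this
    have h1 := key 2 (LinearMap.inl ℝ _ _) f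
    have h2 := key 3 (LinearMap.inr ℝ _ _) g
    have h3 : bigrading (Module.Dual ℝ (E n))
        (ExteriorAlgebra.ιMulti ℝ p (fun i => ((f i, 0) : Cotangent n))) =
        (2 : ℝ) ^ p • ExteriorAlgebra.ιMulti ℝ p (fun i => ((f i, 0) : Cotangent n)) := by
      rw [bigrading, ExteriorAlgebra.map_apply_ιMulti]
      refine Eq.trans (congrArg _ (funext fun i => ?_)) h1
      simp
    have h4 : bigrading (Module.Dual ℝ (E n))
        (ExteriorAlgebra.ιMulti ℝ q (fun i => ((0, g i) : Cotangent n))) =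
        (3 : ℝ) ^ q • ExteriorAlgebra.ιMulti ℝ q (fun i => ((0, g i) : Cotangent n)) := by
      rw [bigrading, ExteriorAlgebra.map_apply_ιMulti]
      refine Eq.trans (congrArg _ (funext fun i => ?_)) h2
      simp
    rw [Submodule.mem_bot, LinearMap.sub_apply, AlgHom.toLinearMap_apply, map_mul, h3, h4,
      smul_mul_smul_comm, LinearMap.smul_apply, LinearMap.id_apply, sub_self]
  rw [Submodule.mem_bot, LinearMap.sub_apply, sub_eq_zero] at h
  exact h

theorem bigrading_restrict (N : Submodule ℝ (E n)) (x : FormAlg n) :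
    bigrading (Module.Dual ℝ N) (restrict N x) =
      restrict N (bigrading (Module.Dual ℝ (E n)) x) := by
  have h1 := AlgHom.congr_fun (ExteriorAlgebra.map_comp_map
    (N.subtype.dualMap.prodMap N.subtype.dualMap)
    (((2 : ℝ) • LinearMap.id).prodMap ((3 : ℝ) • (LinearMap.id : Module.Dual ℝ N →ₗ[ℝ] _)))) x
  have h2 := AlgHom.congr_fun (ExteriorAlgebra.map_comp_map
    (((2 : ℝ) • LinearMap.id).prodMap ((3 : ℝ) • (LinearMap.id : Module.Dual ℝ (E n) →ₗ[ℝ] _)))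
    (N.subtype.dualMap.prodMap N.subtype.dualMap)) x
  rw [AlgHom.comp_apply] at h1 h2
  rw [bigrading, bigrading, restrict]
  refine h1.trans (Eq.trans ?_ h2.symm)
  congr 2

/-- Eigenvectors with distinct eigenvalues and vanishing sum vanish. -/
theorem eq_zero_of_sum_eigenvectors {V κ : Type*} [AddCommGroup V] [Module ℝ V] (φ : V →ₗ[ℝ] V)
    (c : κ → ℝ) (s : Finset κ) (hc : Set.InjOn c s) (X : κ → V)
    (hX : ∀ k ∈ s, φ (X k) = c k • X k) (hsum : ∑ k ∈ s, X k = 0) : ∀ k ∈ s, X k = 0 := by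
  classical
  induction s using Finset.induction_on generalizing X with
  | empty => simp
  | insert j s hj ih =>
    have h1 : ∑ k ∈ s, (c k - c j) • X k = 0 := by
      have h2 := congrArg (fun v => φ v - c j • v) hsum
      simp only [map_sum, Finset.smul_sum, map_zero, smul_zero, sub_zero] at h2
      rw [← Finset.sum_sub_distrib, Finset.sum_insert hj, hX j (Finset.mem_insert_self _ _),
        sub_self, zero_add] at h2
      rw [← h2]
      refine Finset.sum_congr rfl fun k hk => ?_
      rw [hX k (Finset.mem_insert_of_mem hk), sub_smul]
    have h3 : ∀ k ∈ s, X k = 0 := by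
      intro k hk
      have h4 := ih (hc.mono (Finset.coe_subset.2 (Finset.subset_insert _ _))) (fun k => (c k - c j) • X k) (fun k hk => by
        rw [map_smul, hX k (Finset.mem_insert_of_mem hk), smul_comm]) h1 k hk
      refine (smul_eq_zero.1 h4).resolve_left (sub_ne_zero.2 fun h => ?_)
      exact hj (hc (Finset.mem_coe.2 (Finset.mem_insert_of_mem hk))
        (Finset.mem_coe.2 (Finset.mem_insert_self _ _)) h ▸ hk)
    intro k hk
    rcases Finset.mem_insert.1 hk with rfl | hk
    · rwa [Finset.sum_insert hj, Finset.sum_eq_zero h3, add_zero] at hsum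
    · exact h3 k hk

theorem two_pow_mul_three_pow_injective {p q p' q' : ℕ}
    (h : (2 : ℝ) ^ p * 3 ^ q = 2 ^ p' * 3 ^ q') : p = p' ∧ q = q' := by
  have hN : 2 ^ p * 3 ^ q = 2 ^ p' * 3 ^ q' := by exact_mod_cast h
  have key : ∀ {p q p' q' : ℕ}, 2 ^ p * 3 ^ q = 2 ^ p' * 3 ^ q' → p ≤ p' ∧ q ≤ q' := by
    intro p q p' q' h
    constructor
    · have h1 : 2 ^ p ∣ 2 ^ p' * 3 ^ q' := h ▸ Dvd.intro _ rfl
      exact (Nat.pow_dvd_pow_iff_le_right (by norm_num)).1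
        ((Nat.Coprime.pow p q' (by norm_num)).dvd_of_dvd_mul_right h1)
    · have h1 : 3 ^ q ∣ 2 ^ p' * 3 ^ q' := h ▸ Dvd.intro_left _ rfl
      exact (Nat.pow_dvd_pow_iff_le_right (by norm_num)).1
        ((Nat.Coprime.pow q p' (by norm_num)).dvd_of_dvd_mul_left h1)
  have h1 := key hN
  have h2 := key hN.symm
  omega

/-- `bigrading` commutes with restriction, so the restricted components are eigenvectors (or zero)
for the numbers `2 ^ p * 3 ^ q`, which are distinct by unique factorization. -/
theorem restrict_eq_zero_of_sum {κ : Type*} (N : Submodule ℝ (E n)) (s : Finset κ)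
    (p q : κ → ℕ) (hpq : ∀ k ∈ s, ∀ k' ∈ s, p k = p k' → q k = q k' → k = k') (Y : κ → FormAlg n)
    (hY : ∀ k ∈ s, Y k ∈ bidegree n (p k) (q k)) (hsum : restrict N (∑ k ∈ s, Y k) = 0) :
    ∀ k ∈ s, restrict N (Y k) = 0 := by
  refine eq_zero_of_sum_eigenvectors (bigrading (Module.Dual ℝ N)).toLinearMap
    (fun k => (2 : ℝ) ^ p k * 3 ^ q k) s (fun k hk k' hk' h => ?_) (fun k => restrict N (Y k))
    (fun k hk => ?_) (by rw [← hsum, map_sum])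
  · obtain ⟨h1, h2⟩ := two_pow_mul_three_pow_injective h
    exact hpq k hk k' hk' h1 h2
  · rw [AlgHom.toLinearMap_apply, bigrading_restrict, bigrading_eq (hY k hk), map_smul]

end Bidegree

end DeltaForm

end

noncomputable section

namespace DeltaForm

open scoped ContDiff
open MeasureTheory Filter Topology

/-! ## Trihomogeneous decompositions -/

section Decomposition

variable {n : ℕ}

theorem Piece.eval_add (P : Piece n) (η ξ : TestForm n) :
    P.eval (η + ξ) = P.eval η + P.eval ξ := by
  rw [Piece.eval, Piece.eval, Piece.eval, ← integral_add _ (mul_mem_testForm P.form.2 η.2)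
    (mul_mem_testForm P.form.2 ξ.2)]
  refine congrArg _ (funext fun x => ?_)
  exact mul_add _ _ _

theorem Piece.eval_smul (P : Piece n) (c : ℝ) (η : TestForm n) :
    P.eval (c • η) = c * P.eval η := by
  rw [Piece.eval, Piece.eval, ← integral_smul]
  refine congrArg _ (funext fun x => ?_)
  exact mul_smul_comm c ((P.form : E n → FormAlg n) x) ((η : E n → FormAlg n) x)

theorem finite_support_eval {ι : Type} {P : ι → Piece n}
    (h : LocallyFinite (fun i => (P i).carrier)) (η : TestForm n) :
    (Function.support fun i => (P i).eval η).Finite := by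
  obtain ⟨F, hF⟩ := exists_finset_inter_tsupport h η
  refine F.finite_toSet.subset fun i hi => ?_
  by_contra hcon
  exact hi (Piece.eval_eq_zero _ _ fun x hx =>
    eq_zero_of_inter_tsupport (fun hne => hcon ((hF i).1 hne)) hx)

theorem exists_isLocallyFiniteSum {ι : Type} (P : ι → Piece n)
    (h : LocallyFinite (fun i => (P i).carrier)) : ∃ T : Current n, IsLocallyFiniteSum P T :=
  ⟨{ toFun := fun η => ∑ᶠ i, (P i).eval η
     map_add' := fun η ξ => by
       rw [← finsum_add_distrib (finite_support_eval h η) (finite_support_eval h ξ)]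
       exact finsum_congr fun i => (P i).eval_add η ξ
     map_smul' := fun c η => by
       rw [RingHom.id_apply, smul_eq_mul, ← smul_eq_mul, smul_finsum' c (finite_support_eval h η)]
       exact finsum_congr fun i => (P i).eval_smul c η }, h, fun _ => rfl⟩

theorem isPolyhedral_zero : IsPolyhedral (0 : Current n) :=
  ⟨Empty, fun i => i.elim, locallyFinite_of_finite _, fun _ => (finsum_of_isEmpty _).symm⟩

theorem IsPolyhedral.add {T S : Current n} (hT : IsPolyhedral T) (hS : IsPolyhedral S) :
    IsPolyhedral (T + S) := by
  obtain ⟨ι, P, hP⟩ := hT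
  obtain ⟨κ, Q, hQ⟩ := hS
  refine ⟨ι ⊕ κ, Sum.elim P Q, ?_, fun η => ?_⟩
  · convert hP.1.sumElim hQ.1 using 2 with i
    rcases i with i | i <;> rfl
  · obtain ⟨F, hF⟩ := exists_finset_inter_tsupport hP.1 η
    obtain ⟨G, hG⟩ := exists_finset_inter_tsupport hQ.1 η
    rw [LinearMap.add_apply, hP.eq_sum η F fun i hi => (hF i).1 hi,
      hQ.eq_sum η G fun i hi => (hG i).1 hi,
      finsum_eq_sum_of_support_subset (s := F.disjSum G), Finset.sum_disjSum]
    · rfl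
    · intro i hi
      by_contra hcon
      apply hi
      rcases i with i | i
      · refine Piece.eval_eq_zero _ _ fun x hx => eq_zero_of_inter_tsupport (fun hne => ?_) hx
        exact hcon (Finset.mem_coe.2 (Finset.inl_mem_disjSum.2 ((hF i).1 hne)))
      · refine Piece.eval_eq_zero _ _ fun x hx => eq_zero_of_inter_tsupport (fun hne => ?_) hx
        exact hcon (Finset.mem_coe.2 (Finset.inr_mem_disjSum.2 ((hG i).1 hne)))

theorem isDeltaForm_zero : IsDeltaForm (0 : Current n) :=
  ⟨isPolyhedral_zero, isPolyhedral_zero, isPolyhedral_zero⟩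

theorem IsDeltaForm.add {T S : Current n} (hT : IsDeltaForm T) (hS : IsDeltaForm S) :
    IsDeltaForm (T + S) :=
  ⟨hT.1.add hS.1, hT.2.1.add hS.2.1, hT.2.2.add hS.2.2⟩

theorem isDeltaForm_sum {κ : Type*} (s : Finset κ) (S : κ → Current n)
    (h : ∀ k ∈ s, IsDeltaForm (S k)) : IsDeltaForm (∑ k ∈ s, S k) :=
  Finset.sum_induction S IsDeltaForm (fun _ _ => IsDeltaForm.add) isDeltaForm_zero h

theorem IsTrihomogeneous.eq_zero {p q r : ℕ} {T : Current n} (h : IsTrihomogeneous p q r T)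
    (hn : n < p ∨ n < q ∨ n < r) : T = 0 := by
  obtain ⟨ι, P, hP, hdeg⟩ := h
  refine LinearMap.ext fun η => ?_
  rw [hP.2, LinearMap.zero_apply]
  refine finsum_eq_zero_of_forall_eq_zero fun i => ?_
  obtain ⟨h1, h2⟩ := hdeg i
  have hpq : n < p ∨ n < q := by
    rcases hn with hn | hn | hn
    · exact Or.inl hn
    · exact Or.inr hn
    · omega
  refine integral_eq_zero (P i).isPolyhedron.measurableSet _ fun x _ => ?_
  have h3 := h2 x
  rw [bidegree_eq_bot hpq, Submodule.mem_bot] at h3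
  rw [h3, zero_mul]

theorem dim_le (σ : Set (E n)) : dim σ ≤ n := by
  have := Submodule.finrank_le (vectorSpan ℝ σ)
  rwa [Module.finrank_fin_fun] at this

/-- Pieces are sorted by codimension and their forms are split by the linear maps `π p q`; no
complex is required. -/
theorem IsPolyhedral.exists_triDecomposition {T : Current n} (hT : IsPolyhedral T) :
    ∃ S, IsTriDecomposition T S := by
  classical
  obtain ⟨ι, P, hP⟩ := hT
  obtain ⟨π, hπ, hsum⟩ := exists_bidegree_projections n
  let Q : ℕ → ℕ → ι → Piece n := fun p q i => ⟨(P i).carrier, (P i).isPolyhedron, (P i).weight,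
    ⟨_, linearMap_comp_mem_smoothForm (π p q) (P i).form.2⟩⟩
  have hfin : ∀ r : ℕ, LocallyFinite
      (fun i : {i // dim (P i).carrier + r = n} => (P i).carrier) := fun r =>
    hP.1.comp_injective Subtype.val_injective
  choose S hS using fun p q r => exists_isLocallyFiniteSum
    (fun i : {i // dim (P i).carrier + r = n} => Q p q i) (hfin r)
  refine ⟨S, fun p q r => ⟨_, _, hS p q r, fun i => ⟨i.2, fun x => hπ p q _⟩⟩, ?_⟩
  refine LinearMap.ext fun η => ?_
  obtain ⟨F, hF⟩ := exists_finset_inter_tsupport hP.1 η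
  have hval : ∀ p q r, S p q r η =
      ∑ i ∈ F, if dim (P i).carrier + r = n then (Q p q i).eval η else 0 := by
    intro p q r
    rw [(hS p q r).eq_sum η (F.subtype fun i => dim (P i).carrier + r = n)
      (fun i hi => Finset.mem_subtype.2 ((hF i).1 hi)), ← Finset.sum_filter,
      ← Finset.sum_subtype_eq_sum_filter]
  have hr : ∀ p q, ∑ r ∈ Finset.range (n + 1), S p q r η = ∑ i ∈ F, (Q p q i).eval η := by
    intro p q
    simp only [hval]
    rw [Finset.sum_comm]
    refine Finset.sum_congr rfl fun i _ => ?_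
    have hd := dim_le (P i).carrier
    rw [Finset.sum_eq_single (n - dim (P i).carrier) (fun r _ hr => if_neg (by omega))
      (fun h => absurd (Finset.mem_range.2 (by omega)) h), if_pos (by omega)]
  simp only [LinearMap.sum_apply, hr]
  rw [hP.eq_sum η F fun i hi => (hF i).1 hi]
  simp only [Finset.sum_comm (t := F)]
  refine Finset.sum_congr rfl fun i _ => ?_
  have htest : ∀ p q, (fun x => π p q (((P i).form : E n → FormAlg n) x) *
      (η : E n → FormAlg n) x) ∈ TestForm n := fun p q =>
    mul_mem_testForm (linearMap_comp_mem_smoothForm (π p q) (P i).form.2) η.2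
  have h1 : ∀ p, ∑ q ∈ Finset.range (n + 1), (Q p q i).eval η =
      integral (P i).carrier (P i).weight (fun x => ∑ q ∈ Finset.range (n + 1),
        π p q (((P i).form : E n → FormAlg n) x) * (η : E n → FormAlg n) x) := fun p =>
    (integral_sum _ _ fun q _ => htest p q).symm
  have h2 : ∀ p, (fun x => ∑ q ∈ Finset.range (n + 1),
        π p q (((P i).form : E n → FormAlg n) x) * (η : E n → FormAlg n) x) ∈ TestForm n := by
    intro p
    have := Submodule.sum_mem (TestForm n) (t := Finset.range (n + 1)) (fun q _ => htest p q)
    convert this using 1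
    funext x
    rw [Finset.sum_apply]
  simp only [h1]
  rw [← integral_sum _ _ fun p _ => h2 p]
  refine congrArg _ (funext fun x => ?_)
  conv_lhs => rw [hsum (((P i).form : E n → FormAlg n) x)]
  simp only [Finset.sum_mul]

theorem locallyFinite_sigma {X κ : Type*} [TopologicalSpace X] [Finite κ] {ι : κ → Type*}
    {f : ∀ k, ι k → Set X} (h : ∀ k, LocallyFinite (f k)) :
    LocallyFinite (fun a : Σ k, ι k => f a.1 a.2) := by
  intro x
  choose t ht hfin using fun k => h k x
  refine ⟨⋂ k, t k, Filter.iInter_mem.2 ht, ?_⟩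
  have : (⋃ k, Sigma.mk k '' {i | (f k i ∩ t k).Nonempty}).Finite :=
    Set.finite_iUnion fun k => (hfin k).image _
  refine this.subset ?_
  rintro ⟨k, i⟩ hi
  exact Set.mem_iUnion.2 ⟨k, i, hi.mono (Set.inter_subset_inter_right _ (Set.iInter_subset t k)),
    rfl⟩

theorem presents_sum {κ : Type*} (s : Finset κ) (K : PolyhedralComplex n)
    (w : ∀ σ : K.cells, Weight (vectorSpan ℝ (σ : Set (E n)))) (f : κ → K.cells → SmoothForm n)
    (S : κ → Current n) (h : ∀ k ∈ s, (PolyhedralDatum.mk K w (f k)).Presents (S k)) :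
    (PolyhedralDatum.mk K w (fun σ => ∑ k ∈ s, f k σ)).Presents (∑ k ∈ s, S k) := by
  refine ⟨K.locallyFinite, fun η => ?_⟩
  rw [LinearMap.sum_apply, Finset.sum_congr rfl fun k hk => (h k hk).2 η]
  refine (finsum_sum_comm s (fun (σ : K.cells) k => ((PolyhedralDatum.mk K w (f k)).piece σ).eval η)
    fun k hk => finite_support_eval (h k hk).1 η).symm.trans ?_
  refine finsum_congr fun σ => ?_
  refine (integral_sum (w σ) s (ζ := fun k x => ((f k σ : SmoothForm n) : E n → FormAlg n) x *
    (η : E n → FormAlg n) x) fun k _ => mul_mem_testForm (f k σ).2 η.2).symm.trans ?_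
  refine congrArg (integral (σ : Set (E n)) (w σ)) (funext fun x => ?_)
  change _ = ((∑ k ∈ s, f k σ : SmoothForm n) : E n → FormAlg n) x * _
  rw [← Finset.sum_mul]
  congr 1
  simp

/-- Balancing can be tested on trihomogeneous components. -/
theorem balanced_of_balanced_sum {κ : Type*} [Fintype κ] (K : PolyhedralComplex n)
    (w : ∀ σ : K.cells, Weight (vectorSpan ℝ (σ : Set (E n)))) (f : κ → K.cells → SmoothForm n)
    (p q r : κ → ℕ) (hinj : ∀ k k', p k = p k' → q k = q k' → r k = r k' → k = k')
    (hdeg : ∀ k σ x, (f k σ : E n → FormAlg n) x ∈ bidegree n (p k) (q k))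
    (hdim : ∀ k (σ : K.cells), dim (σ : Set (E n)) + r k ≠ n → f k σ = 0)
    (hbal : (PolyhedralDatum.mk K w fun σ => ∑ k, f k σ).Balanced) (k₀ : κ) :
    (PolyhedralDatum.mk K w (f k₀)).Balanced := by
  classical
  intro τ v hv z hz x hx
  have hl : ∀ u ∈ vectorSpan ℝ (τ : Set (E n)), z.linear u = 0 := fun u hu =>
    eq_zero_of_mem_vectorSpan (fun a ha b hb => by
      rw [← sub_eq_zero, ← map_sub, ← vsub_eq_sub, AffineMap.linearMap_vsub, hz a ha b hb]
      simp) hu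
  obtain ⟨st, hst⟩ : ∃ st : Finset K.cells, ∀ σ : K.cells, σ ∈ st ↔ IsFacet (τ : Set (E n)) σ :=
    ⟨((PolyhedralDatum.mk K w (f k₀)).finite_star τ).toFinset, fun σ => by simp⟩
  have hb := hbal.sum_eq_zero τ hst hv z.linear hl hx
  have hgoal : restrict (vectorSpan ℝ (τ : Set (E n)))
      (∑ σ ∈ st, z.linear (v σ) • (f k₀ σ : E n → FormAlg n) x) = 0 := by
    have hb' : restrict (vectorSpan ℝ (τ : Set (E n)))
        (∑ k, ∑ σ ∈ st, z.linear (v σ) • (f k σ : E n → FormAlg n) x) = 0 := by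
      rw [← hb, Finset.sum_comm]
      refine congrArg _ (Finset.sum_congr rfl fun σ _ => ?_)
      rw [← Finset.smul_sum]
      refine congrArg _ ?_
      change _ = ((∑ k, f k σ : SmoothForm n) : E n → FormAlg n) x
      simp
    -- The cells with facet `τ` all have dimension `dim τ + 1`, so a single codimension contributes
    -- at `τ`. Within it the components differ in bidegree and can be separated after restriction.
    by_cases hr : dim (τ : Set (E n)) + 1 + r k₀ = n
    · rw [← Finset.sum_filter_of_ne (p := fun k => r k = r k₀) fun k _ hne => ?_] at hb'
      · exact restrict_eq_zero_of_sum _ (Finset.univ.filter fun k => r k = r k₀) p q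
          (fun k hk k' hk' h1 h2 => hinj k k' h1 h2
            ((Finset.mem_filter.1 hk).2.trans (Finset.mem_filter.1 hk').2.symm)) _
          (fun k _ => Submodule.sum_mem _ fun σ _ => Submodule.smul_mem _ _ (hdeg k σ x)) hb'
          k₀ (Finset.mem_filter.2 ⟨Finset.mem_univ _, rfl⟩)
      · by_contra hk
        refine hne (Finset.sum_eq_zero fun σ hσ => ?_)
        rw [hdim k σ (by rw [← ((hst σ).1 hσ).2]; omega)]
        simp
    · rw [Finset.sum_eq_zero, map_zero]
      intro σ hσ
      rw [hdim k₀ σ (by rw [← ((hst σ).1 hσ).2]; exact hr)]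
      simp
  rw [map_sum] at hgoal
  simp only [map_smul] at hgoal
  simp only [← hst]
  rw [finsum_mem_finset_eq_sum]
  exact hgoal

/-- The trihomogeneous components of a δ-form are δ-forms. -/
theorem IsTriDecomposition.isDeltaForm {T : Current n} {S : ℕ → ℕ → ℕ → Current n}
    (hS : IsTriDecomposition T S) (hT : IsDeltaForm T) (p q r : ℕ) : IsDeltaForm (S p q r) := by
  classical
  by_cases hn : n < p ∨ n < q ∨ n < r
  · rw [(hS.1 p q r).eq_zero hn]
    exact isDeltaForm_zero
  push Not at hn
  obtain ⟨hp, hq, hr⟩ := hn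
  let G : Finset (ℕ × ℕ × ℕ) :=
    Finset.range (n + 1) ×ˢ Finset.range (n + 1) ×ˢ Finset.range (n + 1)
  choose ι P hP hdeg using fun k : G => hS.1 k.1.1 k.1.2.1 k.1.2.2
  -- One complex is adapted to the pieces of all components at once, so that their forms can be
  -- added cell by cell.
  obtain ⟨K, hK⟩ := exists_adapted_complex (fun a : Σ k, ι k => (P a.1 a.2).carrier)
    (fun a => (P a.1 a.2).isPolyhedron) (locallyFinite_sigma fun k => (hP k).1)
  let w : ∀ σ : K.cells, Weight (vectorSpan ℝ (σ : Set (E n))) := fun σ => (exists_weight _).some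
  choose f hf hform using fun k : G => (hP k).exists_presentation K (fun i => hK ⟨k, i⟩) w
  have hfdeg : ∀ (k : G) σ x, (f k σ : E n → FormAlg n) x ∈ bidegree n k.1.1 k.1.2.1 := by
    intro k σ x
    obtain ⟨J, c, hJ, -⟩ := hform k σ
    have : (f k σ : E n → FormAlg n) x = ∑ i ∈ J, c i • ((P k i).form : E n → FormAlg n) x := by
      rw [hJ]; simp
    rw [this]
    exact Submodule.sum_mem _ fun i _ => Submodule.smul_mem _ _ ((hdeg k i).2 x)
  have hfdim : ∀ (k : G) (σ : K.cells), dim (σ : Set (E n)) + k.1.2.2 ≠ n → f k σ = 0 := by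
    intro k σ hne
    obtain ⟨J, c, hJ, hd⟩ := hform k σ
    rw [hJ]
    refine Finset.sum_eq_zero fun i hi => absurd ?_ hne
    rw [← hd i hi]
    exact (hdeg k i).1
  have hTsum : T = ∑ k : G, S k.1.1 k.1.2.1 k.1.2.2 := by
    rw [hS.2, Finset.sum_coe_sort G fun k => S k.1 k.2.1 k.2.2, Finset.sum_product]
    refine Finset.sum_congr rfl fun p _ => ?_
    rw [Finset.sum_product]
  have hpres := presents_sum Finset.univ K w f (fun k : G => S k.1.1 k.1.2.1 k.1.2.2)
    fun k _ => hf k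
  rw [← hTsum] at hpres
  have hbal := hpres.isDeltaForm_iff.1 hT
  have hkG : (p, q, r) ∈ G := by
    simp only [G, Finset.mem_product, Finset.mem_range]
    omega
  exact (hf ⟨(p, q, r), hkG⟩).isDeltaForm (balanced_of_balanced_sum K w f (fun k => k.1.1)
    (fun k => k.1.2.1) (fun k => k.1.2.2)
    (fun k k' h1 h2 h3 => Subtype.ext (Prod.ext h1 (Prod.ext h2 h3))) hfdeg hfdim hbal _)

theorem IsTriDecomposition.isDeltaForm_iff {T : Current n} {S : ℕ → ℕ → ℕ → Current n}
    (hS : IsTriDecomposition T S) : IsDeltaForm T ↔ ∀ p q r, IsDeltaForm (S p q r) := by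
  refine ⟨fun hT => hS.isDeltaForm hT, fun h => ?_⟩
  rw [hS.2]
  exact isDeltaForm_sum _ _ fun p _ => isDeltaForm_sum _ _ fun q _ =>
    isDeltaForm_sum _ _ fun r _ => h p q r

end Decomposition

end DeltaForm

end
-- The theorem
theorem theorem3p3 (n : ℕ) (T : DeltaForm.Current n) (hT : DeltaForm.IsPolyhedral T) :
    (DeltaForm.IsDeltaForm T ↔ DeltaForm.IsBalanced T) ∧
    (∀ D : DeltaForm.PolyhedralDatum n, D.Presents T →
      (DeltaForm.IsDeltaForm T ↔ D.Balanced)) ∧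
    (∃ S : ℕ → ℕ → ℕ → DeltaForm.Current n, DeltaForm.IsTriDecomposition T S) ∧
    (∀ S : ℕ → ℕ → ℕ → DeltaForm.Current n, DeltaForm.IsTriDecomposition T S →
      (DeltaForm.IsDeltaForm T ↔ ∀ p q r, DeltaForm.IsDeltaForm (S p q r))) ∧
    (DeltaForm.IsPolyhedral T.d' ∨ DeltaForm.IsPolyhedral T.d'' → DeltaForm.IsDeltaForm T) :=
  ⟨DeltaForm.isDeltaForm_iff_isBalanced hT, fun _ hD => hD.isDeltaForm_iff,
    hT.exists_triDecomposition, fun _ hS => hS.isDeltaForm_iff, fun h =>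
      h.elim (DeltaForm.isDeltaForm_of_isPolyhedral_ds (s := false) hT)
        (DeltaForm.isDeltaForm_of_isPolyhedral_ds (s := true) hT)⟩
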